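/- **Setting.** Let $\mathcal G\rightrightarrows G_0$ be a smooth étale groupoid: $\mathcal G$ and $G_0$ are Hausdorff paracompact smooth manifolds of the same finite dimension $n$, the source $s$ and target $t$ are local diffeomorphisms, and the product $(x,y)\mapsto xy$ (defined when $t(x)=s(y)$, with $s(xy)=s(x)$, $t(xy)=t(y)$), the unit $u:G_0\to\mathcal G$ and the inversion $\iota$ are smooth. Let $A=\Omega^*(\mathcal G)$ and $B=\Omega^*(G_0)$ be the algebras of all smooth complex differential forms (no support condition), with the wedge product, the grading by degree, the de Rham differential and the topology of uniform convergence of all derivatives on compact subsets of charts. Put $\alpha=s^*$, $\beta=t^*:B\to A$, $\epsilon=u^*:A\to B$, $S=\iota^*:A\to A$. All signs follow the Koszul rule; thus $(a\otimes a')(c\otimes c')=(-1)^{|a'||c|}ac\otimes a'c'$. For topological graded algebras $A,B$ with maps $\alpha,\beta:B\to A$, let $A\otimes_BA$ be the completed quotient of the completed projective tensor product $A\otimes A$ by the closed right ideal generated by all $\beta(b)\otimes1-1\otimes\alpha(b)$; equivalently, it is the complete Hausdorff locally convex space that is universal for jointly continuous bilinear maps $f$ on $A\times A$, with values in complete Hausdorff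 locally convex spaces, such that $f(\beta(b)a,a')=(-1)^{|a||b|}f(a,\alpha(b)a')$. The space $A\otimes_BA\otimes_BA$ is defined likewise by trilinear maps. **Definition.** A (topological differential graded) *para-Hopf algebroid* consists of complete locally convex differential graded algebras $A,B$ and of continuous linear maps $\alpha,\beta:B\to A$, $\Delta:A\to A\otimes_BA$, $\epsilon:A\to B$, $S:A\to A$ of degree $0$ commuting with the differentials, such that the following hold. 1. $\alpha$ is a unital homomorphism, $\beta$ is a unital (graded) anti-homomorphism, and $\alpha(b)\beta(b')=(-1)^{|b||b'|}\beta(b')\alpha(b)$. 2. $\Delta$ is a $B$-$B$-bimodule map, where $b\cdot a=\alpha(b)a$ and $a\cdot b=(-1)^{|a||b|}\beta(b)a$ on $A$, and $b\cdot(a\otimes a')\cdot b'=(b\cdot a)\otimes(a'\cdot b')$. Moreover $\Delta(1)=1\otimes1$, $(\Delta\otimes_B\mathrm{id})\Delta=(\mathrm{id}\otimes_B\Delta)\Delta$, $\Delta(a)(\beta(b)\otimes1-1\otimes\alpha(b))=0$, and $\Delta(aa')=\Delta(a)\Delta(a')$. 3. $\epsilon$ is a $B$-$B$-bimodule map, $\epsilon(1)=1$,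 $\ker\epsilon$ is a left ideal, and $(\epsilon\otimes_B\mathrm{id})\Delta=(\mathrm{id}\otimes_B\epsilon)\Delta=\mathrm{id}$. 4. $S$ is a bijective unital (graded) anti-homomorphism with $S^2=\mathrm{id}$, $S\beta=\alpha$, $m_A(S\otimes_B\mathrm{id})\Delta=\beta\epsilon S$, where $m_A$ is the multiplication of $A$, and $$S(a^{(1)})^{(1)}a^{(2)}\otimes_BS(a^{(1)})^{(2)}=1\otimes_BS(a)\qquad(a\in A),$$ where $\Delta(a)=a^{(1)}\otimes_Ba^{(2)}$, and the left-hand side is the image of $\Delta(a)$ under the continuous linear map with $a\otimes a'\mapsto\Delta(S(a))(a'\otimes1)$. All the maps on $A\otimes_BA$ used here are required to be well defined and continuous. **Proposition 2.1.** For every smooth étale groupoid $\mathcal G$ as above, $\Omega^*(\mathcal G\times_{G_0}\mathcal G)$ with $a\otimes a'=\mathrm{pr}_1^*a\wedge\mathrm{pr}_2^*a'$ is $A\otimes_BA$, $\Omega^*(\mathcal G\times_{G_0}\mathcal G\times_{G_0}\mathcal G)$ with $a\otimes a'\otimes a''=\mathrm{pr}_1^*a\wedge\mathrm{pr}_2^*a'\wedge\mathrm{pr}_3^*a''$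 is $A\otimes_BA\otimes_BA$, and with $\Delta:\Omega^*(\mathcal G)\to\Omega^*(\mathcal G\times_{G_0}\mathcal G)$ the pullback along the product, the bialgebroid $\mathcal H(\mathcal G)=(A,B,\alpha,\beta,\Delta,\epsilon)$ with the antipode $S$ is a para-Hopf algebroid. -/

import Mathlib

open scoped Manifold ContDiff Topology

noncomputable section

namespace EtaleHopf

/-! ### Exterior algebra of the complexified cotangent space -/

/-- The model space `ℝⁿ`. -/
abbrev Eu (n : ℕ) : Type := EuclideanSpace ℝ (Fin n)

/-- Complexified cotangent vectors of `ℝⁿ`. -/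
abbrev Cov (n : ℕ) : Type := Eu n →L[ℝ] ℂ

/-- The complexified exterior algebra `Λ(ℝⁿ)^* ⊗ ℂ`. -/
abbrev Lam (n : ℕ) : Type := ExteriorAlgebra ℂ (Cov n)

instance (n : ℕ) : FiniteDimensional ℂ (Cov n) :=
  Module.Finite.of_injective
    ({ toFun := fun l => (l : Eu n →ₗ[ℝ] ℂ)
       map_add' := fun _ _ => rfl
       map_smul' := fun _ _ => rfl } : Cov n →ₗ[ℂ] (Eu n →ₗ[ℝ] ℂ))
    (fun _ _ h => ContinuousLinearMap.coe_injective h)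

instance (n : ℕ) : FiniteDimensional ℂ (Lam n) :=
  Module.Basis.finiteDimensional_of_finite (Module.finBasis ℂ (Cov n)).ExteriorAlgebra

/-- Coordinates of `Lam n`, used only to give it the topology of a finite-dimensional space. -/
def lamCoord (n : ℕ) : Lam n ≃ₗ[ℂ] (Fin (Module.finrank ℂ (Lam n)) → ℂ) :=
  (Module.finBasis ℂ (Lam n)).equivFun

/-- A norm on the finite-dimensional space `Lam n` (all norms are equivalent). -/
instance (n : ℕ) : NormedAddCommGroup (Lam n) :=
  NormedAddCommGroup.induced (Lam n) _ (lamCoord n) (lamCoord n).injective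

instance (n : ℕ) : NormedSpace ℂ (Lam n) :=
  NormedSpace.induced ℂ (Lam n) _ (lamCoord n)

/-- Transpose of a linear map on (complexified) covectors. -/
def covPull {n : ℕ} (D : Eu n →L[ℝ] Eu n) : Cov n →ₗ[ℂ] Cov n where
  toFun l := l.comp D
  map_add' _ _ := rfl
  map_smul' _ _ := rfl

/-- Pullback of exterior covectors along a linear map. -/
def lamPull {n : ℕ} (D : Eu n →L[ℝ] Eu n) : Lam n →ₐ[ℂ] Lam n :=
  ExteriorAlgebra.map (covPull D)

/-- The coordinate covector `dxᵢ`. -/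
def dx {n : ℕ} (i : Fin n) : Cov n :=
  Complex.ofRealCLM.comp (EuclideanSpace.proj i)

/-- The coordinate vector `eᵢ`. -/
def ev {n : ℕ} (i : Fin n) : Eu n := EuclideanSpace.single i 1

/-- The exterior derivative `∑ᵢ dxᵢ ∧ ∂ᵢη` on `ℝⁿ`. -/
def flatD {n : ℕ} (η : Eu n → Lam n) (y : Eu n) : Lam n :=
  ∑ i : Fin n, ExteriorAlgebra.ι ℂ (dx i) * fderiv ℝ η y (ev i)

/-! #### Auxiliary facts -/

theorem lamPull_ι {n : ℕ} (D : Eu n →L[ℝ] Eu n) (l : Cov n) :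
    lamPull D (ExteriorAlgebra.ι ℂ l) = ExteriorAlgebra.ι ℂ (l.comp D) :=
  ExteriorAlgebra.map_apply_ι _ _

theorem lamPull_comp {n : ℕ} (D D' : Eu n →L[ℝ] Eu n) (x : Lam n) :
    lamPull (D.comp D') x = lamPull D' (lamPull D x) := by
  have h := ExteriorAlgebra.map_comp_map (covPull D) (covPull D')
  exact (DFunLike.congr_fun h x).symm

theorem lamPull_id {n : ℕ} (x : Lam n) : lamPull (ContinuousLinearMap.id ℝ (Eu n)) x = x :=
  DFunLike.congr_fun (ExteriorAlgebra.map_id (R := ℂ) (M := Cov n)) x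

/-- A complex-linear map out of a finite-dimensional space as a real continuous linear map. -/
def toRealCLM {V W : Type*} [NormedAddCommGroup V] [NormedSpace ℂ V] [FiniteDimensional ℂ V]
    [NormedAddCommGroup W] [NormedSpace ℂ W] (f : V →ₗ[ℂ] W) : V →L[ℝ] W :=
  (LinearMap.toContinuousLinearMap f).restrictScalars ℝ

@[simp] theorem toRealCLM_apply {V W : Type*} [NormedAddCommGroup V] [NormedSpace ℂ V]
    [FiniteDimensional ℂ V] [NormedAddCommGroup W] [NormedSpace ℂ W] (f : V →ₗ[ℂ] W) (v : V) :
    toRealCLM f v = f v := rfl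

/-- Multiplication of `Lam n` as a continuous bilinear map. -/
def mulCLM (n : ℕ) : Lam n →L[ℝ] Lam n →L[ℝ] Lam n :=
  (ContinuousLinearMap.restrictScalarsL ℂ (Lam n) (Lam n) ℝ ℝ).comp
    (toRealCLM ((LinearMap.toContinuousLinearMap :
      (Lam n →ₗ[ℂ] Lam n) ≃ₗ[ℂ] (Lam n →L[ℂ] Lam n)).toLinearMap ∘ₗ LinearMap.mul ℂ (Lam n)))

@[simp] theorem mulCLM_apply {n : ℕ} (a b : Lam n) : mulCLM n a b = a * b := rfl

theorem contDiffAt_lamMul {n : ℕ} {k : ℕ∞ω} {V : Type*} [NormedAddCommGroup V] [NormedSpace ℝ V]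
    {f g : V → Lam n} {y : V} (hf : ContDiffAt ℝ k f y) (hg : ContDiffAt ℝ k g y) :
    ContDiffAt ℝ k (fun z => f z * g z) y :=
  ((mulCLM n).contDiff.contDiffAt.comp y hf).clm_apply hg

theorem fderiv_lamMul {n : ℕ} {V : Type*} [NormedAddCommGroup V] [NormedSpace ℝ V]
    {f g : V → Lam n} {y : V} (hf : DifferentiableAt ℝ f y) (hg : DifferentiableAt ℝ g y) (v : V) :
    fderiv ℝ (fun z => f z * g z) y v = f y * fderiv ℝ g y v + fderiv ℝ f y v * g y := by
  have h := (mulCLM n).hasFDerivAt_of_bilinear hf.hasFDerivAt hg.hasFDerivAt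
  have h' : fderiv ℝ (fun z => f z * g z) y = _ := h.fderiv
  rw [h']
  rfl

theorem contDiffAt_ι {n : ℕ} {k : ℕ∞ω} {V : Type*} [NormedAddCommGroup V] [NormedSpace ℝ V]
    {w : V → Cov n} {y : V} (hw : ContDiffAt ℝ k w y) :
    ContDiffAt ℝ k (fun z => ExteriorAlgebra.ι ℂ (w z)) y :=
  (toRealCLM (ExteriorAlgebra.ι ℂ (M := Cov n))).contDiff.contDiffAt.comp y hw

theorem fderiv_ι {n : ℕ} {V : Type*} [NormedAddCommGroup V] [NormedSpace ℝ V]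
    {w : V → Cov n} {y : V} (hw : DifferentiableAt ℝ w y) (v : V) :
    fderiv ℝ (fun z => ExteriorAlgebra.ι ℂ (w z)) y v = ExteriorAlgebra.ι ℂ (fderiv ℝ w y v) := by
  have h := (toRealCLM (ExteriorAlgebra.ι ℂ (M := Cov n))).hasFDerivAt.comp y hw.hasFDerivAt
  have h' : fderiv ℝ (fun z => ExteriorAlgebra.ι ℂ (w z)) y = _ := h.fderiv
  rw [h']
  rfl

theorem contDiffAt_lamPull_const {n : ℕ} {k : ℕ∞ω} {V : Type*} [NormedAddCommGroup V]
    [NormedSpace ℝ V] {T : V → (Eu n →L[ℝ] Eu n)} {y : V} (hT : ContDiffAt ℝ k T y) (x : Lam n) :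
    ContDiffAt ℝ k (fun z => lamPull (T z) x) y := by
  induction x using ExteriorAlgebra.induction with
  | algebraMap r => simpa using contDiffAt_const
  | ι l =>
    simp only [lamPull_ι]
    exact contDiffAt_ι (contDiffAt_const.clm_comp hT)
  | mul a b ha hb => simpa using contDiffAt_lamMul ha hb
  | add a b ha hb => simpa using ha.add hb

theorem lam_sum_coord {n : ℕ} (x : Lam n) :
    x = ∑ k, (lamCoord n x k) • Module.finBasis ℂ (Lam n) k :=
  ((Module.finBasis ℂ (Lam n)).sum_equivFun x).symm

/-- One coordinate of `Lam n`. -/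
def coordCLM (n : ℕ) (k : Fin (Module.finrank ℂ (Lam n))) : Lam n →L[ℝ] ℂ :=
  toRealCLM ((LinearMap.proj k).comp (lamCoord n).toLinearMap)

theorem coordCLM_apply {n : ℕ} (k : Fin (Module.finrank ℂ (Lam n))) (x : Lam n) :
    coordCLM n k x = lamCoord n x k := rfl

theorem lamPull_eq_sum {n : ℕ} (D : Eu n →L[ℝ] Eu n) (x : Lam n) :
    lamPull D x = ∑ k, (coordCLM n k x) • lamPull D (Module.finBasis ℂ (Lam n) k) := by
  conv_lhs => rw [lam_sum_coord x]
  simp [coordCLM_apply]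

theorem contDiffAt_lamPull {n : ℕ} {k : ℕ∞ω} {V : Type*} [NormedAddCommGroup V]
    [NormedSpace ℝ V] {T : V → (Eu n →L[ℝ] Eu n)} {η : V → Lam n} {y : V}
    (hT : ContDiffAt ℝ k T y) (hη : ContDiffAt ℝ k η y) :
    ContDiffAt ℝ k (fun z => lamPull (T z) (η z)) y := by
  simp only [lamPull_eq_sum _ (η _)]
  refine ContDiffAt.sum fun j _ => ?_
  exact ((coordCLM n j).contDiff.contDiffAt.comp y hη).smul (contDiffAt_lamPull_const hT _)

theorem cov_eq_sum {n : ℕ} (l : Cov n) : l = ∑ j, l (ev j) • dx j := by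
  ext v
  have hv : v = ∑ j, v j • ev j := by
    ext i
    simp [ev, Pi.single_apply]
  conv_lhs => rw [hv]
  simp [dx, mul_comm]

theorem eu_eq_sum {n : ℕ} (v : Eu n) : v = ∑ j, v j • ev j := by
  ext i
  simp [ev, Pi.single_apply]

theorem flatD_add {n : ℕ} {η θ : Eu n → Lam n} {y : Eu n} (hη : DifferentiableAt ℝ η y)
    (hθ : DifferentiableAt ℝ θ y) : flatD (fun z => η z + θ z) y = flatD η y + flatD θ y := by
  have h : fderiv ℝ (fun z => η z + θ z) y = _ := (hη.hasFDerivAt.add hθ.hasFDerivAt).fderiv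
  simp [flatD, h, mul_add, Finset.sum_add_distrib]

theorem flatD_smul {n : ℕ} (c : ℂ) {η : Eu n → Lam n} {y : Eu n} (hη : DifferentiableAt ℝ η y) :
    flatD (fun z => c • η z) y = c • flatD η y := by
  have h : fderiv ℝ (fun z => c • η z) y = _ := (hη.hasFDerivAt.const_smul c).fderiv
  simp [flatD, h, Finset.smul_sum]

theorem flatD_congr {n : ℕ} {η θ : Eu n → Lam n} {y : Eu n} (h : η =ᶠ[𝓝 y] θ) :
    flatD η y = flatD θ y := by
  simp [flatD, h.fderiv_eq]

theorem sum_symm_eq_zero {n : ℕ} (c : Fin n → Fin n → ℂ) (hc : ∀ i j, c i j = c j i) :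
    ∑ i, ∑ j, ExteriorAlgebra.ι ℂ (dx (n := n) i) * (c i j • ExteriorAlgebra.ι ℂ (dx (n := n) j))
      = 0 := by
  have h1 : ∑ i, ∑ j, ExteriorAlgebra.ι ℂ (dx (n := n) i) *
      (c i j • ExteriorAlgebra.ι ℂ (dx (n := n) j)) =
      - ∑ i, ∑ j, ExteriorAlgebra.ι ℂ (dx (n := n) i) *
      (c i j • ExteriorAlgebra.ι ℂ (dx (n := n) j)) := by
    conv_lhs => rw [Finset.sum_comm]
    rw [← Finset.sum_neg_distrib]
    refine Finset.sum_congr rfl fun i _ => ?_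
    rw [← Finset.sum_neg_distrib]
    refine Finset.sum_congr rfl fun j _ => ?_
    rw [mul_smul_comm, mul_smul_comm, hc j i, ← smul_neg,
      eq_neg_of_add_eq_zero_left (ExteriorAlgebra.ι_add_mul_swap (dx (n := n) j) (dx i))]
  have h2 := add_eq_zero_iff_eq_neg.mpr h1
  rw [← two_smul ℂ] at h2
  exact (smul_eq_zero.mp h2).resolve_left two_ne_zero

/-- Pullbacks of constant forms are closed. -/
theorem flatD_lamPull_const {n : ℕ} {τ : Eu n → Eu n} {y : Eu n} (hτ : ContDiffAt ℝ ∞ τ y)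
    (x : Lam n) : flatD (fun z => lamPull (fderiv ℝ τ z) x) y = 0 := by
  have hT : ContDiffAt ℝ ∞ (fderiv ℝ τ) y := hτ.fderiv_right (by simp)
  have hne : (∞ : ℕ∞ω) ≠ 0 := by simp
  induction x using CliffordAlgebra.left_induction with
  | algebraMap r =>
    have : (fun z => lamPull (fderiv ℝ τ z) (algebraMap ℂ (Lam n) r)) =
        fun _ => algebraMap ℂ (Lam n) r := by
      ext z; simp
    have e : flatD (fun z => lamPull (fderiv ℝ τ z) (algebraMap ℂ (Lam n) r)) y = 0 := by
      rw [this]; simp [flatD]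
    exact e
  | add a b ha hb =>
    simp only [map_add]
    rw [flatD_add ((contDiffAt_lamPull_const hT a).differentiableAt hne)
      ((contDiffAt_lamPull_const hT b).differentiableAt hne), ha, hb, add_zero]
  | ι_mul a l ha =>
    have ha' : ∑ i : Fin n, ExteriorAlgebra.ι ℂ (dx i) *
      fderiv ℝ (fun z => lamPull (fderiv ℝ τ z) a) y (ev i) = 0 := ha
    have e0 : (fun z => lamPull (fderiv ℝ τ z) (CliffordAlgebra.ι 0 l * a)) =
        fun z => ExteriorAlgebra.ι ℂ (l.comp (fderiv ℝ τ z)) * lamPull (fderiv ℝ τ z) a := by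
      ext z
      rw [map_mul]
      congr 1
      exact lamPull_ι _ _
    have hw : DifferentiableAt ℝ (fun z => l.comp (fderiv ℝ τ z)) y :=
      (contDiffAt_const.clm_comp hT).differentiableAt hne
    have hι : DifferentiableAt ℝ (fun z => ExteriorAlgebra.ι ℂ (l.comp (fderiv ℝ τ z))) y :=
      (contDiffAt_ι (contDiffAt_const.clm_comp hT)).differentiableAt hne
    have hA := (contDiffAt_lamPull_const hT a).differentiableAt hne
    rw [e0]
    unfold flatD
    simp only [fderiv_lamMul hι hA, mul_add, Finset.sum_add_distrib]
    have s1 : ∑ i : Fin n, ExteriorAlgebra.ι ℂ (dx i) *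
        (ExteriorAlgebra.ι ℂ (l.comp (fderiv ℝ τ y)) *
          fderiv ℝ (fun z => lamPull (fderiv ℝ τ z) a) y (ev i)) = 0 := by
      have : ∀ i : Fin n, ExteriorAlgebra.ι ℂ (dx i) *
        (ExteriorAlgebra.ι ℂ (l.comp (fderiv ℝ τ y)) *
          fderiv ℝ (fun z => lamPull (fderiv ℝ τ z) a) y (ev i)) =
          - (ExteriorAlgebra.ι ℂ (l.comp (fderiv ℝ τ y)) * (ExteriorAlgebra.ι ℂ (dx i) *
          fderiv ℝ (fun z => lamPull (fderiv ℝ τ z) a) y (ev i))) := by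
        intro i
        rw [← mul_assoc, ← mul_assoc, ← neg_mul,
          eq_neg_of_add_eq_zero_left (ExteriorAlgebra.ι_add_mul_swap (dx i) _)]
      simp only [this]
      rw [Finset.sum_neg_distrib, ← Finset.mul_sum, ha', mul_zero, neg_zero]
    have s2 : ∑ i : Fin n, ExteriorAlgebra.ι ℂ (dx i) *
        (fderiv ℝ (fun z => ExteriorAlgebra.ι ℂ (l.comp (fderiv ℝ τ z))) y (ev i) *
          lamPull (fderiv ℝ τ y) a) = 0 := by
      have hd : ∀ v : Eu n, fderiv ℝ (fun z => l.comp (fderiv ℝ τ z)) y v =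
          l.comp (fderiv ℝ (fderiv ℝ τ) y v) := by
        intro v
        have h := ((ContinuousLinearMap.compL ℝ (Eu n) (Eu n) ℂ l).hasFDerivAt.comp y
          (hT.differentiableAt hne).hasFDerivAt).fderiv
        exact DFunLike.congr_fun h v
      have hsymm : IsSymmSndFDerivAt ℝ τ y := hτ.isSymmSndFDerivAt (by
        rw [minSmoothness_of_isRCLikeNormedField]; exact WithTop.coe_le_coe.2 (le_top : (2 : ℕ∞) ≤ ⊤))
      simp only [fderiv_ι hw, hd, ← mul_assoc, ← Finset.sum_mul]
      have : ∀ i : Fin n, ExteriorAlgebra.ι ℂ (dx i) *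
          ExteriorAlgebra.ι ℂ (l.comp (fderiv ℝ (fderiv ℝ τ) y (ev i))) =
          ∑ j, ExteriorAlgebra.ι ℂ (dx i) *
            (l (fderiv ℝ (fderiv ℝ τ) y (ev i) (ev j)) • ExteriorAlgebra.ι ℂ (dx j)) := by
        intro i
        rw [cov_eq_sum (l.comp (fderiv ℝ (fderiv ℝ τ) y (ev i)))]
        simp [Finset.mul_sum]
      simp only [this]
      rw [sum_symm_eq_zero (fun i j => l (fderiv ℝ (fderiv ℝ τ) y (ev i) (ev j)))
        (fun i j => by rw [hsymm (ev i) (ev j)]), zero_mul]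
    rw [s1, s2, add_zero]

/-- The exterior derivative commutes with pullback. -/
theorem flatD_lamPull {n : ℕ} {τ : Eu n → Eu n} {η : Eu n → Lam n} {y : Eu n}
    (hτ : ContDiffAt ℝ ∞ τ y) (hη : DifferentiableAt ℝ η (τ y)) :
    flatD (fun z => lamPull (fderiv ℝ τ z) (η (τ z))) y =
      lamPull (fderiv ℝ τ y) (flatD η (τ y)) := by
  have hT : ContDiffAt ℝ ∞ (fderiv ℝ τ) y := hτ.fderiv_right (by simp)
  have hne : (∞ : ℕ∞ω) ≠ 0 := by simp
  have hητ : HasFDerivAt (fun z => η (τ z)) ((fderiv ℝ η (τ y)).comp (fderiv ℝ τ y)) y :=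
    hη.hasFDerivAt.comp y (hτ.differentiableAt hne).hasFDerivAt
  have key : ∀ v, fderiv ℝ (fun z => lamPull (fderiv ℝ τ z) (η (τ z))) y v =
      lamPull (fderiv ℝ τ y) (fderiv ℝ η (τ y) (fderiv ℝ τ y v)) +
      ∑ k, coordCLM n k (η (τ y)) •
        fderiv ℝ (fun z => lamPull (fderiv ℝ τ z) (Module.finBasis ℂ (Lam n) k)) y v := by
    intro v
    have h1 : (fun z => lamPull (fderiv ℝ τ z) (η (τ z))) = fun z =>
        ∑ k, coordCLM n k (η (τ z)) • lamPull (fderiv ℝ τ z) (Module.finBasis ℂ (Lam n) k) := by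
      ext z; exact lamPull_eq_sum _ _
    have h2 : HasFDerivAt (fun z =>
        ∑ k, coordCLM n k (η (τ z)) • lamPull (fderiv ℝ τ z) (Module.finBasis ℂ (Lam n) k)) _ y :=
      HasFDerivAt.fun_sum (u := Finset.univ) fun k _ =>
        ((coordCLM n k).hasFDerivAt.comp y hητ).smul
          ((contDiffAt_lamPull_const hT (Module.finBasis ℂ (Lam n) k)).differentiableAt
            hne).hasFDerivAt
    rw [h1, h2.fderiv, lamPull_eq_sum (fderiv ℝ τ y) (fderiv ℝ η (τ y) _),
      sum_apply, ← Finset.sum_add_distrib]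
    refine Finset.sum_congr rfl fun k _ => ?_
    rw [add_comm]
    rfl
  unfold flatD
  simp only [key, mul_add, Finset.sum_add_distrib]
  have s2 : ∑ i : Fin n, ExteriorAlgebra.ι ℂ (dx i) * ∑ k, coordCLM n k (η (τ y)) •
        fderiv ℝ (fun z => lamPull (fderiv ℝ τ z) (Module.finBasis ℂ (Lam n) k)) y (ev i) = 0 := by
    simp only [Finset.mul_sum]
    rw [Finset.sum_comm]
    refine Finset.sum_eq_zero fun k _ => ?_
    simp only [mul_smul_comm, ← Finset.smul_sum]
    have := flatD_lamPull_const hτ (Module.finBasis ℂ (Lam n) k)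
    unfold flatD at this
    rw [this, smul_zero]
  rw [s2, add_zero, map_sum]
  simp only [map_mul, lamPull_ι]
  have h3 : ∀ i : Fin n, ExteriorAlgebra.ι ℂ (dx i) *
      lamPull (fderiv ℝ τ y) (fderiv ℝ η (τ y) (fderiv ℝ τ y (ev i))) =
      ∑ j, ((fderiv ℝ τ y (ev i) j : ℝ) : ℂ) • (ExteriorAlgebra.ι ℂ (dx i) *
        lamPull (fderiv ℝ τ y) (fderiv ℝ η (τ y) (ev j))) := by
    intro i
    conv_lhs => rw [eu_eq_sum (fderiv ℝ τ y (ev i))]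
    simp only [map_sum, Finset.mul_sum]
    refine Finset.sum_congr rfl fun j _ => ?_
    have e : fderiv ℝ η (τ y) (fderiv ℝ τ y (ev i) j • ev j) =
        ((fderiv ℝ τ y (ev i) j : ℝ) : ℂ) • fderiv ℝ η (τ y) (ev j) := by
      rw [Complex.coe_smul]
      exact (fderiv ℝ η (τ y)).map_smul _ _
    rw [e, map_smul, mul_smul_comm]
  simp only [h3]
  rw [Finset.sum_comm]
  refine Finset.sum_congr rfl fun j _ => ?_
  rw [cov_eq_sum ((dx j).comp (fderiv ℝ τ y))]
  simp [Finset.sum_mul, dx]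

/-! ### Differential forms on manifolds -/

section Forms

variable {n : ℕ} {M N P : Type*} [TopologicalSpace M] [ChartedSpace (Eu n) M]
  [TopologicalSpace N] [ChartedSpace (Eu n) N] [TopologicalSpace P] [ChartedSpace (Eu n) P]

/-- Pullback of a (not necessarily smooth) form along `f`. The value of a form at a point `x` lies in
the complexified exterior algebra of the dual of `TangentSpace (𝓡 n) x`, which is `Eu n` by
definition. -/
def pull (f : M → N) (φ : N → Lam n) (x : M) : Lam n :=
  lamPull (mfderiv (𝓡 n) (𝓡 n) f x : Eu n →L[ℝ] Eu n) (φ (f x))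

/-- The expression of a form in the preferred chart at `p`, a form on the target of the chart. -/
def chartExpr (φ : M → Lam n) (p : M) : Eu n → Lam n :=
  pull (chartAt (Eu n) p).symm φ

/-- A form is smooth if its expression in every chart is. -/
def IsSmoothForm (φ : M → Lam n) : Prop :=
  ∀ p : M, ContDiffOn ℝ ∞ (chartExpr φ p) (chartAt (Eu n) p).target

/-- The exterior derivative: computed at `x` in the chart at `x`. -/
def extD (φ : M → Lam n) (x : M) : Lam n :=
  pull (chartAt (Eu n) x) (flatD (chartExpr φ x)) x

/-! #### Auxiliary facts -/

theorem pull_comp {f : M → N} {g : N → P} {x : M} (hg : MDifferentiableAt (𝓡 n) (𝓡 n) g (f x))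
    (hf : MDifferentiableAt (𝓡 n) (𝓡 n) f x) (φ : P → Lam n) :
    pull (g ∘ f) φ x = pull f (pull g φ) x := by
  unfold pull
  rw [mfderiv_comp x hg hf]
  exact lamPull_comp _ _ _

theorem pull_congr {f g : M → N} {x : M} (h : f =ᶠ[𝓝 x] g) (φ : N → Lam n) :
    pull f φ x = pull g φ x := by
  unfold pull
  rw [h.eq_of_nhds, h.mfderiv_eq]

theorem pull_congr_right (f : M → N) {φ ψ : N → Lam n} {x : M} (h : φ (f x) = ψ (f x)) :
    pull f φ x = pull f ψ x := by
  unfold pull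
  rw [h]

theorem pull_id (φ : M → Lam n) (x : M) : pull id φ x = φ x := by
  unfold pull
  rw [mfderiv_id]
  exact lamPull_id _

theorem pull_flat (τ : Eu n → Eu n) (φ : Eu n → Lam n) (y : Eu n) :
    pull τ φ y = lamPull (fderiv ℝ τ y) (φ (τ y)) := by
  unfold pull
  rw [mfderiv_eq_fderiv]

theorem IsSmoothForm.contDiffAt {φ : N → Lam n} (hφ : IsSmoothForm φ) (q : N) {y : Eu n}
    (hy : y ∈ (chartAt (Eu n) q).target) : ContDiffAt ℝ ∞ (chartExpr φ q) y :=
  (hφ q).contDiffAt ((chartAt (Eu n) q).open_target.mem_nhds hy)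

theorem infty_ne_zero : (∞ : ℕ∞ω) ≠ 0 := by simp

variable [IsManifold (𝓡 n) ∞ N]

theorem contMDiffAt_chart (p : N) {x : N} (hx : x ∈ (chartAt (Eu n) p).source) :
    ContMDiffAt (𝓡 n) (𝓡 n) ∞ (chartAt (Eu n) p) x :=
  contMDiffAt_of_mem_maximalAtlas (IsManifold.chart_mem_maximalAtlas p) hx

theorem contMDiffAt_chart_symm (p : N) {y : Eu n} (hy : y ∈ (chartAt (Eu n) p).target) :
    ContMDiffAt (𝓡 n) (𝓡 n) ∞ (chartAt (Eu n) p).symm y :=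
  contMDiffAt_symm_of_mem_maximalAtlas (IsManifold.chart_mem_maximalAtlas p) hy

/-- Near a point of its source, a smooth map can be factored through a chart of its target. -/
theorem pull_eq_chart {f : M → N} {x : M} (hf : ContMDiffAt (𝓡 n) (𝓡 n) ∞ f x) {q : N}
    (hq : f x ∈ (chartAt (Eu n) q).source) (φ : N → Lam n) :
    pull f φ x = pull (chartAt (Eu n) q ∘ f) (chartExpr φ q) x := by
  set c := chartAt (Eu n) q
  have h1 : f =ᶠ[𝓝 x] c.symm ∘ (c ∘ f) := by
    filter_upwards [hf.continuousAt.preimage_mem_nhds (c.open_source.mem_nhds hq)] with z hz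
    exact (c.left_inv hz).symm
  rw [pull_congr h1, pull_comp]
  · rfl
  · exact (contMDiffAt_chart_symm q (c.map_source hq)).mdifferentiableAt infty_ne_zero
  · exact ((contMDiffAt_chart q hq).comp x hf).mdifferentiableAt infty_ne_zero

/-- Pulling a smooth form back to `ℝⁿ` along a smooth map gives a smooth form. -/
theorem IsSmoothForm.contDiffAt_pull {φ : N → Lam n} (hφ : IsSmoothForm φ) {U : Set (Eu n)}
    (hU : IsOpen U) {f : Eu n → N} (hf : ContMDiffOn (𝓡 n) (𝓡 n) ∞ f U) {y : Eu n} (hy : y ∈ U) :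
    ContDiffAt ℝ ∞ (pull f φ) y := by
  have hfat : ∀ z ∈ U, ContMDiffAt (𝓡 n) (𝓡 n) ∞ f z := fun z hz => hf.contMDiffAt (hU.mem_nhds hz)
  set c := chartAt (Eu n) (f y) with hc
  have hs : f y ∈ c.source := mem_chart_source _ _
  have hcf : ContDiffAt ℝ ∞ (c ∘ f) y :=
    ((contMDiffAt_chart (f y) hs).comp y (hfat y hy)).contDiffAt
  have h1 : pull f φ =ᶠ[𝓝 y]
      fun z => lamPull (fderiv ℝ (c ∘ f) z) (chartExpr φ (f y) ((c ∘ f) z)) := by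
    filter_upwards [(hfat y hy).continuousAt.preimage_mem_nhds (c.open_source.mem_nhds hs),
      hU.mem_nhds hy] with z hz hzU
    rw [pull_eq_chart (hfat z hzU) hz, pull_flat]
  refine ContDiffAt.congr_of_eventuallyEq ?_ h1
  refine contDiffAt_lamPull (hcf.fderiv_right (by simp)) ?_
  exact (hφ.contDiffAt (f y) (c.map_source hs)).comp y hcf

variable [IsManifold (𝓡 n) ∞ M]

theorem IsSmoothForm.pull {φ : N → Lam n} (hφ : IsSmoothForm φ) {f : M → N}
    (hf : ContMDiff (𝓡 n) (𝓡 n) ∞ f) : IsSmoothForm (pull f φ) := by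
  intro p y hy
  set c := chartAt (Eu n) p with hc
  have hcs : ContMDiffOn (𝓡 n) (𝓡 n) ∞ c.symm c.target :=
    fun z hz => (contMDiffAt_chart_symm p hz).contMDiffWithinAt
  have h := hφ.contDiffAt_pull c.open_target (hf.comp_contMDiffOn hcs) hy
  refine (h.congr_of_eventuallyEq ?_).contDiffWithinAt
  filter_upwards [c.open_target.mem_nhds hy] with z hz
  exact (pull_comp (hf.mdifferentiableAt infty_ne_zero)
    ((contMDiffAt_chart_symm p hz).mdifferentiableAt infty_ne_zero) φ).symm

/-- In every chart the exterior derivative is given by the coordinate formula. -/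
theorem chartExpr_extD {φ : M → Lam n} (hφ : IsSmoothForm φ) (p : M) {y : Eu n}
    (hy : y ∈ (chartAt (Eu n) p).target) :
    chartExpr (extD φ) p y = flatD (chartExpr φ p) y := by
  set c := chartAt (Eu n) p with hc
  set x := c.symm y with hx
  set b := chartAt (Eu n) x with hb
  have hxs : x ∈ b.source := mem_chart_source _ _
  have hcy := contMDiffAt_chart_symm p hy
  have hτ : ContDiffAt ℝ ∞ (b ∘ c.symm) y :=
    ((contMDiffAt_chart x hxs).comp y hcy).contDiffAt
  have e1 : chartExpr (extD φ) p y = pull (b ∘ c.symm) (flatD (chartExpr φ x)) y := by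
    have h1 := pull_comp (f := c.symm) (g := b) (x := y) ((contMDiffAt_chart x hxs).mdifferentiableAt infty_ne_zero)
      (hcy.mdifferentiableAt infty_ne_zero) (flatD (chartExpr φ x))
    rw [h1]
    exact pull_congr_right c.symm rfl
  rw [e1, pull_flat, ← flatD_lamPull hτ
    ((hφ.contDiffAt x (b.map_source hxs)).differentiableAt infty_ne_zero)]
  refine flatD_congr ?_
  filter_upwards [c.open_target.mem_nhds hy,
    hcy.continuousAt.preimage_mem_nhds (b.open_source.mem_nhds hxs)] with z hz hzb
  have := pull_eq_chart (contMDiffAt_chart_symm p hz) hzb φ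
  rw [pull_flat] at this
  exact this.symm

theorem contDiffAt_flatD {η : Eu n → Lam n} {y : Eu n} (hη : ContDiffAt ℝ ∞ η y) :
    ContDiffAt ℝ ∞ (flatD η) y := by
  refine ContDiffAt.sum fun i _ => contDiffAt_lamMul contDiffAt_const ?_
  exact (hη.fderiv_right (by simp)).clm_apply contDiffAt_const

theorem IsSmoothForm.extD {φ : M → Lam n} (hφ : IsSmoothForm φ) : IsSmoothForm (extD φ) := by
  intro p y hy
  refine ((contDiffAt_flatD (hφ.contDiffAt p hy)).congr_of_eventuallyEq ?_).contDiffWithinAt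
  filter_upwards [(chartAt (Eu n) p).open_target.mem_nhds hy] with z hz
  exact chartExpr_extD hφ p hz

end Forms

section Algebra

variable (n : ℕ) (M : Type*) [TopologicalSpace M] [ChartedSpace (Eu n) M]

/-- The algebra of smooth complex differential forms, with the pointwise wedge product. -/
def formSubalgebra : Subalgebra ℂ (M → Lam n) where
  carrier := {φ | IsSmoothForm φ}
  mul_mem' := by
    intro a b ha hb p y hy
    have h := contDiffAt_lamMul (ha.contDiffAt p hy) (hb.contDiffAt p hy)
    refine (h.congr_of_eventuallyEq (.of_forall fun z => ?_)).contDiffWithinAt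
    exact map_mul (lamPull _) _ _
  add_mem' := by
    intro a b ha hb p
    refine ((ha p).add (hb p)).congr fun z _ => ?_
    exact map_add (lamPull _) _ _
  algebraMap_mem' := by
    intro r p
    refine (contDiffOn_const (c := algebraMap ℂ (Lam n) r)).congr fun z _ => ?_
    exact AlgHom.commutes (lamPull _) _

/-- The space `Ω^*(M)` of smooth complex differential forms on `M`. -/
def Form : Type _ := formSubalgebra n M

namespace Form

instance : Ring (Form n M) := inferInstanceAs (Ring (formSubalgebra n M))

instance : Algebra ℂ (Form n M) := inferInstanceAs (Algebra ℂ (formSubalgebra n M))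

variable {n M}

instance : CoeFun (Form n M) (fun _ => M → Lam n) := ⟨fun φ => φ.1⟩

theorem smooth (φ : Form n M) : IsSmoothForm φ.1 := φ.2

variable (n M)

/-- The topology of uniform convergence, on compact subsets of charts, of all partial derivatives
of the coefficients of a form. -/
instance : TopologicalSpace (Form n M) :=
  ⨅ (p : M) (k : ℕ), TopologicalSpace.induced
    (fun φ => UniformOnFun.ofFun {K : Set (Eu n) | IsCompact K ∧ K ⊆ (chartAt (Eu n) p).target}
      (iteratedFDeriv ℝ k (chartExpr φ.1 p)))
    inferInstance

/-- Forms of degree `k`. -/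
def deg (k : ℕ) : Submodule ℂ (Form n M) where
  carrier := {φ | ∀ x, φ x ∈ ⋀[ℂ]^k (Cov n)}
  add_mem' ha hb x := Submodule.add_mem _ (ha x) (hb x)
  zero_mem' _ := Submodule.zero_mem _
  smul_mem' c _ ha x := Submodule.smul_mem _ c (ha x)

/-- The de Rham differential. -/
def d [IsManifold (𝓡 n) ∞ M] : Form n M →ₗ[ℂ] Form n M where
  toFun φ := ⟨extD φ.1, φ.smooth.extD⟩
  map_add' a b := by
    refine Subtype.ext (funext fun x => ?_)
    have h := flatD_add
      ((a.smooth.contDiffAt x (mem_chart_target _ x)).differentiableAt infty_ne_zero)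
      ((b.smooth.contDiffAt x (mem_chart_target _ x)).differentiableAt infty_ne_zero)
    have e : chartExpr (a + b).1 x = fun z => chartExpr a.1 x z + chartExpr b.1 x z :=
      funext fun z => map_add (lamPull _) _ _
    change lamPull _ (flatD (chartExpr (a + b).1 x) _) =
      lamPull _ (flatD (chartExpr a.1 x) _) + lamPull _ (flatD (chartExpr b.1 x) _)
    rw [e, h, map_add]
  map_smul' r a := by
    refine Subtype.ext (funext fun x => ?_)
    have h := flatD_smul r
      ((a.smooth.contDiffAt x (mem_chart_target _ x)).differentiableAt infty_ne_zero)
    have e : chartExpr (r • a).1 x = fun z => r • chartExpr a.1 x z :=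
      funext fun z => map_smul (lamPull _) _ _
    change lamPull _ (flatD (chartExpr (r • a).1 x) _) =
      r • lamPull _ (flatD (chartExpr a.1 x) _)
    rw [e, h, map_smul]

/-- Pullback of smooth forms along a smooth map, as a homomorphism of algebras. -/
def pullback {n : ℕ} {M N : Type*} [TopologicalSpace M] [ChartedSpace (Eu n) M]
    [TopologicalSpace N] [ChartedSpace (Eu n) N] [IsManifold (𝓡 n) ∞ M] [IsManifold (𝓡 n) ∞ N]
    (f : M → N) (hf : ContMDiff (𝓡 n) (𝓡 n) ∞ f) : Form n N →ₐ[ℂ] Form n M where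
  toFun φ := ⟨pull f φ.1, φ.smooth.pull hf⟩
  map_one' := Subtype.ext (funext fun _ => map_one (lamPull _))
  map_mul' _ _ := Subtype.ext (funext fun _ => map_mul (lamPull _) _ _)
  map_zero' := Subtype.ext (funext fun _ => map_zero (lamPull _))
  map_add' _ _ := Subtype.ext (funext fun _ => map_add (lamPull _) _ _)
  commutes' r := Subtype.ext (funext fun _ => AlgHom.commutes (lamPull _) r)

end Form

end Algebra

/-! ### Étale maps and fibre products -/

section Etale

variable {n : ℕ} {X Y Z M N : Type*} [TopologicalSpace X] [TopologicalSpace Y]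
  [TopologicalSpace Z] [TopologicalSpace M] [TopologicalSpace N]

/-- The manifold structure on `X` for which a local homeomorphism `π : X → M` is a local
diffeomorphism. -/
@[reducible] def etaleChartedSpace [ChartedSpace (Eu n) M] (π : X → M) (h : IsLocalHomeomorph π) :
    ChartedSpace (Eu n) X where
  atlas := {e | ∃ x, e = (h.localInverseAt x).symm.trans (chartAt (Eu n) (π x))}
  chartAt x := (h.localInverseAt x).symm.trans (chartAt (Eu n) (π x))
  mem_chart_source x := by simp
  chart_mem_atlas x := ⟨x, rfl⟩

theorem etaleIsManifold [ChartedSpace (Eu n) M] [IsManifold (𝓡 n) ∞ M] (π : X → M)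
    (h : IsLocalHomeomorph π) :
    @IsManifold ℝ _ _ _ _ _ _ (𝓡 n) ∞ X _ (etaleChartedSpace π h) := by
  let := etaleChartedSpace (n := n) π h
  refine isManifold_of_contDiffOn _ _ _ ?_
  rintro e e' ⟨x, rfl⟩ ⟨x', rfl⟩ y hy
  simp only [OpenPartialHomeomorph.trans_symm_eq_symm_trans_symm, OpenPartialHomeomorph.symm_symm,
    OpenPartialHomeomorph.trans_source, OpenPartialHomeomorph.symm_source, modelWithCornersSelf_coe,
    modelWithCornersSelf_coe_symm, Set.preimage_id_eq, Set.range_id, Set.inter_univ, id_eq,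
    Set.mem_inter_iff, Set.mem_preimage, OpenPartialHomeomorph.coe_trans, Function.comp_apply] at hy
  obtain ⟨⟨hy1, hy2⟩, hy3, hy4⟩ := hy
  have hπ : ∀ z ∈ (h.localInverseAt x).source, π (h.localInverseAt x z) = z := fun z hz =>
    h.apply_localInverseAt_of_mem hz
  have hsm := contMDiffAt_chart_symm (π x) hy1
  have e0 : (h.localInverseAt x').symm (h.localInverseAt x ((chartAt (Eu n) (π x)).symm y)) =
      (chartAt (Eu n) (π x)).symm y := by
    rw [h.localInverseAt_symm]
    exact hπ _ hy2
  rw [e0] at hy4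
  have hc : ContDiffAt ℝ ∞ (chartAt (Eu n) (π x') ∘ (chartAt (Eu n) (π x)).symm) y :=
    ((contMDiffAt_chart (π x') hy4).comp y hsm).contDiffAt
  refine (hc.congr_of_eventuallyEq ?_).contDiffWithinAt
  filter_upwards [hsm.continuousAt.preimage_mem_nhds
    ((h.localInverseAt x).open_source.mem_nhds hy2)] with z hz
  have e1 : (h.localInverseAt x').symm (h.localInverseAt x ((chartAt (Eu n) (π x)).symm z)) =
      (chartAt (Eu n) (π x)).symm z := by
    rw [h.localInverseAt_symm]
    exact hπ _ hz
  exact congrArg (chartAt (Eu n) (π x')) e1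

theorem etale_contMDiff [ChartedSpace (Eu n) M] [IsManifold (𝓡 n) ∞ M] (π : X → M)
    (h : IsLocalHomeomorph π) :
    @ContMDiff ℝ _ _ _ _ _ _ (𝓡 n) X _ (etaleChartedSpace π h) _ _ _ _ _ (𝓡 n) M _ _ ∞ π := by
  let := etaleChartedSpace (n := n) π h
  have := etaleIsManifold (n := n) π h
  intro x
  have h1 : ContMDiffAt (𝓡 n) (𝓡 n) ∞ (chartAt (Eu n) x) x :=
    contMDiffAt_chart x (mem_chart_source _ x)
  have h2 : ContMDiffAt (𝓡 n) (𝓡 n) ∞ (chartAt (Eu n) (π x)).symm (chartAt (Eu n) x x) := by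
    apply contMDiffAt_chart_symm
    have e : chartAt (Eu n) x x = chartAt (Eu n) (π x) (π x) := by
      change chartAt (Eu n) (π x) ((h.localInverseAt x).symm x) = _
      rw [h.localInverseAt_symm]
    rw [e]
    exact mem_chart_target _ _
  refine (h2.comp x h1).congr_of_eventuallyEq ?_
  filter_upwards [h.continuous.continuousAt.preimage_mem_nhds
    ((chartAt (Eu n) (π x)).open_source.mem_nhds (mem_chart_source _ _))] with z hz
  change _ = (chartAt (Eu n) (π x)).symm (chartAt (Eu n) (π x) ((h.localInverseAt x).symm z))
  rw [h.localInverseAt_symm]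
  exact ((chartAt (Eu n) (π x)).left_inv hz).symm

/-- A continuous map is smooth if its composition with a local diffeomorphism is. -/
theorem contMDiff_of_comp_localDiffeo [ChartedSpace (Eu n) M] [ChartedSpace (Eu n) N]
    [ChartedSpace (Eu n) X] {s : M → N} (hs : IsLocalDiffeomorph (𝓡 n) (𝓡 n) ∞ s) {g : X → M}
    (hg : Continuous g) (h : ContMDiff (𝓡 n) (𝓡 n) ∞ (s ∘ g)) : ContMDiff (𝓡 n) (𝓡 n) ∞ g := by
  intro x
  have hl := hs (g x)
  have h1 := hl.localInverse_contMDiffAt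
  refine (ContMDiffAt.comp x h1 (h x)).congr_of_eventuallyEq ?_
  filter_upwards [hg.continuousAt.eventually hl.localInverse_eventuallyEq_left] with z hz
  exact hz.symm

/-- The fibre product of two maps. -/
def FiberProd (f : X → Z) (g : Y → Z) : Type _ := {p : X × Y // f p.1 = g p.2}

instance (f : X → Z) (g : Y → Z) : TopologicalSpace (FiberProd f g) :=
  inferInstanceAs (TopologicalSpace {p : X × Y // f p.1 = g p.2})

namespace FiberProd

/-- The first projection. -/
def fst {f : X → Z} {g : Y → Z} (p : FiberProd f g) : X := p.1.1

/-- The second projection. -/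
def snd {f : X → Z} {g : Y → Z} (p : FiberProd f g) : Y := p.1.2

theorem comm {X Y Z : Type*} {f : X → Z} {g : Y → Z} (p : FiberProd f g) : f p.fst = g p.snd := p.2

/-- The point of the fibre product with given projections. -/
def mk {f : X → Z} {g : Y → Z} (x : X) (y : Y) (h : f x = g y) : FiberProd f g := ⟨(x, y), h⟩

theorem continuous_fst {Z : Type*} {f : X → Z} {g : Y → Z} : Continuous (fst : FiberProd f g → X) :=
  _root_.continuous_fst.comp continuous_subtype_val

theorem continuous_snd {Z : Type*} {f : X → Z} {g : Y → Z} : Continuous (snd : FiberProd f g → Y) :=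
  _root_.continuous_snd.comp continuous_subtype_val

theorem isLocalHomeomorph_fst {f : X → Z} {g : Y → Z} (hf : Continuous f)
    (hg : IsLocalHomeomorph g) : IsLocalHomeomorph (fst : FiberProd f g → X) := by
  classical
  intro p
  obtain ⟨e, hpe, rfl⟩ := hg p.snd
  let inv : X → FiberProd f e := fun x =>
    if h : f x ∈ e.target then ⟨(x, e.symm (f x)), (e.right_inv h).symm⟩ else p
  have hinv : ∀ x ∈ f ⁻¹' e.target, (inv x).1 = (x, e.symm (f x)) := by
    intro x hx
    have : f x ∈ e.target := hx
    simp [inv, this]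
  have hmem : ∀ q : FiberProd f e, q.snd ∈ e.source → f q.fst ∈ e.target := by
    intro q hq
    rw [q.comm]
    exact e.map_source hq
  refine ⟨{ toFun := fst
            invFun := inv
            source := snd ⁻¹' e.source
            target := f ⁻¹' e.target
            map_source' := fun q hq => hmem q hq
            map_target' := ?_
            left_inv' := ?_
            right_inv' := ?_
            open_source := e.open_source.preimage continuous_snd
            open_target := e.open_target.preimage hf
            continuousOn_toFun := continuous_fst.continuousOn
            continuousOn_invFun := ?_ }, hpe, rfl⟩
  · intro x hx
    change (inv x).1.2 ∈ e.source
    rw [hinv x hx]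
    exact e.map_target hx
  · intro q hq
    refine Subtype.ext ?_
    rw [hinv _ (hmem q hq)]
    refine Prod.ext rfl ?_
    change e.symm (f q.fst) = q.snd
    rw [q.comm]
    exact e.left_inv hq
  · intro x hx
    change (inv x).1.1 = x
    rw [hinv x hx]
  · refine Topology.IsInducing.subtypeVal.continuousOn_iff.2 ?_
    refine ContinuousOn.congr ?_ hinv
    exact continuousOn_id.prodMk (e.continuousOn_symm.comp hf.continuousOn fun x hx => hx)

end FiberProd

end Etale

/-! ### Smooth étale groupoids -/

section Groupoid

/-- Manifolds of arrows and objects, with source and target maps that are local diffeomorphisms. -/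
structure EtaleQuiver (n : ℕ) (G₁ G₀ : Type*) [TopologicalSpace G₁] [ChartedSpace (Eu n) G₁]
    [TopologicalSpace G₀] [ChartedSpace (Eu n) G₀] where
  source : G₁ → G₀
  target : G₁ → G₀
  isLocalDiffeomorph_source : IsLocalDiffeomorph (𝓡 n) (𝓡 n) ∞ source
  isLocalDiffeomorph_target : IsLocalDiffeomorph (𝓡 n) (𝓡 n) ∞ target

variable {n : ℕ} {G₁ G₀ : Type*} [TopologicalSpace G₁] [ChartedSpace (Eu n) G₁]
  [TopologicalSpace G₀] [ChartedSpace (Eu n) G₀]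

namespace EtaleQuiver

variable (Q : EtaleQuiver n G₁ G₀)

theorem contMDiff_source : ContMDiff (𝓡 n) (𝓡 n) ∞ Q.source :=
  Q.isLocalDiffeomorph_source.contMDiff

theorem contMDiff_target : ContMDiff (𝓡 n) (𝓡 n) ∞ Q.target :=
  Q.isLocalDiffeomorph_target.contMDiff

/-- Pairs of composable arrows `(x, y)`: the target of `x` is the source of `y`. -/
abbrev Comp₂ : Type _ := FiberProd Q.target Q.source

/-- Triples of composable arrows, as pairs of a composable pair `(x, y)` and an arrow `z`. -/
abbrev Comp₃ : Type _ := FiberProd (fun p : Q.Comp₂ => Q.target p.snd) Q.source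

theorem isLocalHomeomorph_fst₂ : IsLocalHomeomorph (FiberProd.fst : Q.Comp₂ → G₁) :=
  FiberProd.isLocalHomeomorph_fst Q.contMDiff_target.continuous
    Q.isLocalDiffeomorph_source.isLocalHomeomorph

theorem isLocalHomeomorph_fst₃ : IsLocalHomeomorph (FiberProd.fst : Q.Comp₃ → Q.Comp₂) :=
  FiberProd.isLocalHomeomorph_fst (Q.contMDiff_target.continuous.comp FiberProd.continuous_snd)
    Q.isLocalDiffeomorph_source.isLocalHomeomorph

/-- The manifold structure on `G₁ ×_{G₀} G₁`, étale over `G₁` by the first projection. -/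
instance : ChartedSpace (Eu n) Q.Comp₂ := etaleChartedSpace _ Q.isLocalHomeomorph_fst₂

/-- The manifold structure on `G₁ ×_{G₀} G₁ ×_{G₀} G₁`, étale over `G₁ ×_{G₀} G₁`. -/
instance : ChartedSpace (Eu n) Q.Comp₃ := etaleChartedSpace _ Q.isLocalHomeomorph_fst₃

variable [IsManifold (𝓡 n) ∞ G₁]

instance : IsManifold (𝓡 n) ∞ Q.Comp₂ := etaleIsManifold _ Q.isLocalHomeomorph_fst₂

instance : IsManifold (𝓡 n) ∞ Q.Comp₃ := etaleIsManifold _ Q.isLocalHomeomorph_fst₃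

theorem contMDiff_fst₂ : ContMDiff (𝓡 n) (𝓡 n) ∞ (FiberProd.fst : Q.Comp₂ → G₁) :=
  etale_contMDiff _ Q.isLocalHomeomorph_fst₂

theorem contMDiff_fst₃ : ContMDiff (𝓡 n) (𝓡 n) ∞ (FiberProd.fst : Q.Comp₃ → Q.Comp₂) :=
  etale_contMDiff _ Q.isLocalHomeomorph_fst₃

theorem contMDiff_snd₂ : ContMDiff (𝓡 n) (𝓡 n) ∞ (FiberProd.snd : Q.Comp₂ → G₁) := by
  refine contMDiff_of_comp_localDiffeo Q.isLocalDiffeomorph_source FiberProd.continuous_snd ?_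
  refine (Q.contMDiff_target.comp Q.contMDiff_fst₂).congr fun p => ?_
  exact p.comm.symm

theorem contMDiff_snd₃ : ContMDiff (𝓡 n) (𝓡 n) ∞ (FiberProd.snd : Q.Comp₃ → G₁) := by
  refine contMDiff_of_comp_localDiffeo Q.isLocalDiffeomorph_source FiberProd.continuous_snd ?_
  refine (Q.contMDiff_target.comp (Q.contMDiff_snd₂.comp Q.contMDiff_fst₃)).congr fun p => ?_
  exact p.comm.symm

end EtaleQuiver

/-- A smooth étale groupoid `G₁ ⇉ G₀`; the product `mul (x, y) = xy` is defined when the target of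
`x` is the source of `y`. -/
structure EtaleGroupoid (n : ℕ) (G₁ G₀ : Type*) [TopologicalSpace G₁] [ChartedSpace (Eu n) G₁]
    [TopologicalSpace G₀] [ChartedSpace (Eu n) G₀] where
  quiver : EtaleQuiver n G₁ G₀
  mul : quiver.Comp₂ → G₁
  unit : G₀ → G₁
  inv : G₁ → G₁
  contMDiff_mul : ContMDiff (𝓡 n) (𝓡 n) ∞ mul
  contMDiff_unit : ContMDiff (𝓡 n) (𝓡 n) ∞ unit
  contMDiff_inv : ContMDiff (𝓡 n) (𝓡 n) ∞ inv
  source_mul : ∀ p, quiver.source (mul p) = quiver.source p.fst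
  target_mul : ∀ p, quiver.target (mul p) = quiver.target p.snd
  source_unit : ∀ m, quiver.source (unit m) = m
  target_unit : ∀ m, quiver.target (unit m) = m
  source_inv : ∀ x, quiver.source (inv x) = quiver.target x
  target_inv : ∀ x, quiver.target (inv x) = quiver.source x
  mul_assoc : ∀ (x y z : G₁) (hxy : quiver.target x = quiver.source y)
    (hyz : quiver.target y = quiver.source z),
    mul (.mk (mul (.mk x y hxy)) z ((target_mul _).trans hyz)) =
      mul (.mk x (mul (.mk y z hyz)) (hxy.trans (source_mul (.mk y z hyz)).symm))
  unit_mul : ∀ x, mul (.mk (unit (quiver.source x)) x (target_unit _)) = x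
  mul_unit : ∀ x, mul (.mk x (unit (quiver.target x)) (source_unit _).symm) = x
  mul_inv : ∀ x, mul (.mk x (inv x) (source_inv x).symm) = unit (quiver.source x)
  inv_mul : ∀ x, mul (.mk (inv x) x (target_inv x)) = unit (quiver.target x)

end Groupoid

/-! ### Topological differential graded para-Hopf algebroids -/

section Algebroid

universe u v

/-- Complete Hausdorff locally convex topological vector spaces over `ℂ`. -/
structure IsCompleteLCS (E : Type*) [AddCommGroup E] [Module ℂ E] [TopologicalSpace E] : Prop where
  isTopologicalAddGroup : IsTopologicalAddGroup E
  continuousSMul : ContinuousSMul ℂ E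
  locallyConvexSpace : LocallyConvexSpace ℝ E
  t2Space : T2Space E
  completeSpace : @CompleteSpace E (IsTopologicalAddGroup.rightUniformSpace E)

/-- Complete locally convex differential graded algebras: `gr` is the grading and `d` the
differential. -/
structure IsTopDGAlgebra {A : Type*} [Ring A] [Algebra ℂ A] [TopologicalSpace A]
    (gr : ℕ → Submodule ℂ A) (d : A →ₗ[ℂ] A) : Prop where
  isCompleteLCS : IsCompleteLCS A
  continuous_mul : Continuous fun p : A × A => p.1 * p.2
  gradedMonoid : SetLike.GradedMonoid gr
  isInternal : DirectSum.IsInternal gr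
  continuous_d : Continuous d
  d_mem : ∀ i, ∀ a ∈ gr i, d a ∈ gr (i + 1)
  d_d : ∀ a, d (d a) = 0
  d_mul : ∀ i, ∀ a ∈ gr i, ∀ b, d (a * b) = d a * b + (-1 : ℂ) ^ i • (a * d b)

/-- Continuous linear maps of degree `0` that commute with the differentials. -/
structure IsTopDGMap {A A' : Type*} [Ring A] [Algebra ℂ A] [TopologicalSpace A]
    [Ring A'] [Algebra ℂ A'] [TopologicalSpace A'] (gr : ℕ → Submodule ℂ A) (d : A →ₗ[ℂ] A)
    (gr' : ℕ → Submodule ℂ A') (d' : A' →ₗ[ℂ] A') (f : A →ₗ[ℂ] A') : Prop where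
  continuous : Continuous f
  map_mem : ∀ i, ∀ a ∈ gr i, f a ∈ gr' i
  map_d : ∀ a, f (d a) = d' (f a)

/-- The data of a bialgebroid `A` over `B`. Here `T` stands for `A ⊗_B A` and `T₃` for
`A ⊗_B A ⊗_B A`, with `ten a a' = a ⊗ a'` and `ten₃ a a' a'' = a ⊗ a' ⊗ a''`. -/
structure BialgebroidData (A : Type u) (B : Type v) (T T₃ : Type u) [Ring A] [Algebra ℂ A]
    [Ring B] [Algebra ℂ B] [AddCommGroup T] [Module ℂ T] [AddCommGroup T₃] [Module ℂ T₃] where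
  grA : ℕ → Submodule ℂ A
  dA : A →ₗ[ℂ] A
  grB : ℕ → Submodule ℂ B
  dB : B →ₗ[ℂ] B
  ten : A →ₗ[ℂ] A →ₗ[ℂ] T
  ten₃ : A →ₗ[ℂ] A →ₗ[ℂ] A →ₗ[ℂ] T₃
  /-- the source map -/
  α : B →ₗ[ℂ] A
  /-- the target map -/
  β : B →ₗ[ℂ] A
  /-- the coproduct -/
  Δ : A →ₗ[ℂ] T
  /-- the counit -/
  ε : A →ₗ[ℂ] B

namespace BialgebroidData

variable {A : Type u} {B : Type v} {T T₃ : Type u} [Ring A] [Algebra ℂ A] [TopologicalSpace A]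
  [Ring B] [Algebra ℂ B] [TopologicalSpace B] [AddCommGroup T] [Module ℂ T] [TopologicalSpace T]
  [AddCommGroup T₃] [Module ℂ T₃] [TopologicalSpace T₃] (H : BialgebroidData A B T T₃)

/-- Bilinear maps that vanish on `(β(b) ⊗ 1 - 1 ⊗ α(b))(a ⊗ a')`, where the product of `A ⊗ A`
is `(a ⊗ a')(c ⊗ c') = (-1) ^ (|a'| |c|) ac ⊗ a'c'`. -/
def IsBalanced {E : Type*} [AddCommGroup E] [Module ℂ E] (f : A →ₗ[ℂ] A →ₗ[ℂ] E) : Prop :=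
  ∀ i j, ∀ b ∈ H.grB i, ∀ a ∈ H.grA j, ∀ a',
    f (H.β b * a) a' = (-1 : ℂ) ^ (i * j) • f a (H.α b * a')

/-- Trilinear maps that are balanced in the first two and in the last two arguments. -/
def IsBalanced₃ {E : Type*} [AddCommGroup E] [Module ℂ E] (f : A →ₗ[ℂ] A →ₗ[ℂ] A →ₗ[ℂ] E) : Prop :=
  (∀ i j, ∀ b ∈ H.grB i, ∀ a ∈ H.grA j, ∀ a' a'',
    f (H.β b * a) a' a'' = (-1 : ℂ) ^ (i * j) • f a (H.α b * a') a'') ∧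
  (∀ i j, ∀ b ∈ H.grB i, ∀ a' ∈ H.grA j, ∀ a a'',
    f a (H.β b * a') a'' = (-1 : ℂ) ^ (i * j) • f a a' (H.α b * a''))

/-- `T`, with `ten`, is the completed projective tensor product `A ⊗_B A`, i.e. the quotient of the
completed projective tensor product `A ⊗ A` by the closed right ideal generated by the elements
`β(b) ⊗ 1 - 1 ⊗ α(b)`: it is complete and universal for jointly continuous balanced bilinear maps
into complete Hausdorff locally convex spaces. -/
structure IsTensorSquare : Prop where
  isCompleteLCS : IsCompleteLCS T
  continuous : Continuous fun p : A × A => H.ten p.1 p.2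
  balanced : H.IsBalanced H.ten
  existsUnique_lift : ∀ (E : Type u) [AddCommGroup E] [Module ℂ E] [TopologicalSpace E],
    IsCompleteLCS E → ∀ f : A →ₗ[ℂ] A →ₗ[ℂ] E, (Continuous fun p : A × A => f p.1 p.2) →
      H.IsBalanced f → ∃! F : T →L[ℂ] E, ∀ a a', F (H.ten a a') = f a a'

/-- `T₃`, with `ten₃`, is the completed projective tensor product `A ⊗_B A ⊗_B A`. -/
structure IsTensorCube : Prop where
  isCompleteLCS : IsCompleteLCS T₃
  continuous : Continuous fun p : A × A × A => H.ten₃ p.1 p.2.1 p.2.2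
  balanced : H.IsBalanced₃ H.ten₃
  existsUnique_lift : ∀ (E : Type u) [AddCommGroup E] [Module ℂ E] [TopologicalSpace E],
    IsCompleteLCS E → ∀ f : A →ₗ[ℂ] A →ₗ[ℂ] A →ₗ[ℂ] E,
      (Continuous fun p : A × A × A => f p.1 p.2.1 p.2.2) →
      H.IsBalanced₃ f → ∃! F : T₃ →L[ℂ] E, ∀ a a' a'', F (H.ten₃ a a' a'') = f a a' a''

/-- The degree `k` part of `A ⊗_B A`. -/
def tenDeg (k : ℕ) : Set T :=
  closure (Submodule.span ℂ {x | ∃ i j, i + j = k ∧ ∃ a ∈ H.grA i, ∃ a' ∈ H.grA j, x = H.ten a a'})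

/-- `R c c' x = x (c ⊗ c')` is the right action of `A ⊗ A` on `A ⊗_B A`. -/
def IsRightMul (R : A →ₗ[ℂ] A →ₗ[ℂ] T →ₗ[ℂ] T) : Prop :=
  (∀ c c', Continuous (R c c')) ∧
  ∀ i j, ∀ a' ∈ H.grA i, ∀ c ∈ H.grA j, ∀ a c',
    R c c' (H.ten a a') = (-1 : ℂ) ^ (i * j) • H.ten (a * c) (a' * c')

/-- Topological differential graded bialgebroids. Each map from `A ⊗_B A` (denoted `F` or by a
similar letter below) is the unique continuous linear map with the given values on `a ⊗ a'`. -/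
structure IsBialgebroid : Prop where
  isTopDGAlgebra_A : IsTopDGAlgebra H.grA H.dA
  isTopDGAlgebra_B : IsTopDGAlgebra H.grB H.dB
  isTensorSquare : H.IsTensorSquare
  isTensorCube : H.IsTensorCube
  /- The source and target maps. -/
  isTopDGMap_α : IsTopDGMap H.grB H.dB H.grA H.dA H.α
  isTopDGMap_β : IsTopDGMap H.grB H.dB H.grA H.dA H.β
  α_one : H.α 1 = 1
  α_mul : ∀ b b', H.α (b * b') = H.α b * H.α b'
  β_one : H.β 1 = 1
  β_mul : ∀ i j, ∀ b ∈ H.grB i, ∀ b' ∈ H.grB j,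
    H.β (b * b') = (-1 : ℂ) ^ (i * j) • (H.β b' * H.β b)
  α_mul_β : ∀ i j, ∀ b ∈ H.grB i, ∀ b' ∈ H.grB j,
    H.α b * H.β b' = (-1 : ℂ) ^ (i * j) • (H.β b' * H.α b)
  /- The coproduct is continuous, of degree 0, and commutes with the differentials, where
  `d (a ⊗ a') = da ⊗ a' + (-1) ^ |a| a ⊗ da'`. -/
  continuous_Δ : Continuous H.Δ
  Δ_mem : ∀ k, ∀ a ∈ H.grA k, H.Δ a ∈ H.tenDeg k
  Δ_d : ∃ dT : T →L[ℂ] T,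
    (∀ i, ∀ a ∈ H.grA i, ∀ a',
      dT (H.ten a a') = H.ten (H.dA a) a' + (-1 : ℂ) ^ i • H.ten a (H.dA a')) ∧
    ∀ a, H.Δ (H.dA a) = dT (H.Δ a)
  /- The coproduct is a bimodule map for `b · a = α(b) a` and `a · b = (-1) ^ (|a| |b|) β(b) a`. -/
  Δ_left : ∃ F : B → T →L[ℂ] T,
    (∀ b a a', F b (H.ten a a') = H.ten (H.α b * a) a') ∧
    ∀ b a, H.Δ (H.α b * a) = F b (H.Δ a)
  Δ_right : ∃ F : B → T →L[ℂ] T,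
    (∀ i j, ∀ b ∈ H.grB i, ∀ a' ∈ H.grA j, ∀ a,
      F b (H.ten a a') = (-1 : ℂ) ^ (i * j) • H.ten a (H.β b * a')) ∧
    ∀ i j, ∀ b ∈ H.grB i, ∀ a ∈ H.grA j, (-1 : ℂ) ^ (i * j) • H.Δ (H.β b * a) = F b (H.Δ a)
  Δ_one : H.Δ 1 = H.ten 1 1
  /- Coassociativity: `J c x = x ⊗ c`, `K a x = a ⊗ x`, `F = Δ ⊗ id`, `F' = id ⊗ Δ`. -/
  coassoc : ∃ (J K : A → T →L[ℂ] T₃) (F F' : T →L[ℂ] T₃),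
    (∀ a b c, J c (H.ten a b) = H.ten₃ a b c) ∧ (∀ a b c, K a (H.ten b c) = H.ten₃ a b c) ∧
    (∀ a c, F (H.ten a c) = J c (H.Δ a)) ∧ (∀ a c, F' (H.ten a c) = K a (H.Δ c)) ∧
    ∀ a, F (H.Δ a) = F' (H.Δ a)
  exists_rightMul : ∃ R, H.IsRightMul R
  Δ_balanced : ∀ R, H.IsRightMul R → ∀ a b, R (H.β b) 1 (H.Δ a) - R 1 (H.α b) (H.Δ a) = 0
  /- Multiplicativity: `F a x = Δ(a) x`, which is well defined by the previous property. -/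
  Δ_mul : ∀ R, H.IsRightMul R → ∃ F : A → T →L[ℂ] T,
    (∀ a c c', F a (H.ten c c') = R c c' (H.Δ a)) ∧ ∀ a a', H.Δ (a * a') = F a (H.Δ a')
  /- The counit. -/
  isTopDGMap_ε : IsTopDGMap H.grA H.dA H.grB H.dB H.ε
  ε_left : ∀ b a, H.ε (H.α b * a) = b * H.ε a
  ε_right : ∀ i j, ∀ b ∈ H.grB i, ∀ a ∈ H.grA j,
    (-1 : ℂ) ^ (i * j) • H.ε (H.β b * a) = H.ε a * b
  ε_one : H.ε 1 = 1
  ε_ker : ∀ a a', H.ε a' = 0 → H.ε (a * a') = 0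
  counit_left : ∃ F : T →L[ℂ] A, (∀ a a', F (H.ten a a') = H.α (H.ε a) * a') ∧
    ∀ a, F (H.Δ a) = a
  counit_right : ∃ F : T →L[ℂ] A,
    (∀ i j, ∀ a ∈ H.grA i, ∀ a' ∈ H.grA j,
      F (H.ten a a') = (-1 : ℂ) ^ (i * j) • (H.β (H.ε a') * a)) ∧
    ∀ a, F (H.Δ a) = a

/-- Topological differential graded para-Hopf algebroids: bialgebroids with a twisted antipode
`S`. -/
structure IsParaHopfAlgebroid (S : A →ₗ[ℂ] A) : Prop where
  isBialgebroid : H.IsBialgebroid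
  isTopDGMap_S : IsTopDGMap H.grA H.dA H.grA H.dA S
  bijective_S : Function.Bijective S
  S_one : S 1 = 1
  S_mul : ∀ i j, ∀ a ∈ H.grA i, ∀ a' ∈ H.grA j, S (a * a') = (-1 : ℂ) ^ (i * j) • (S a' * S a)
  S_S : ∀ a, S (S a) = a
  S_β : ∀ b, S (H.β b) = H.α b
  /- `m (S ⊗ id) Δ = β ε S` -/
  S_counit : ∃ F : T →L[ℂ] A, (∀ a a', F (H.ten a a') = S a * a') ∧
    ∀ a, F (H.Δ a) = H.β (H.ε (S a))
  /- `S(a⁽¹⁾)⁽¹⁾ a⁽²⁾ ⊗ S(a⁽¹⁾)⁽²⁾ = 1 ⊗ S(a)`, where the left side is the image of `Δ(a)` under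
  `a ⊗ a' ↦ Δ(S(a)) (a' ⊗ 1)`. -/
  S_twisted : ∀ R, H.IsRightMul R → ∃ F : T →L[ℂ] T,
    (∀ a a', F (H.ten a a') = R a' 1 (H.Δ (S a))) ∧ ∀ a, F (H.Δ a) = H.ten 1 (S a)

end BialgebroidData

end Algebroid

/-! ### The bialgebroid of differential forms on an étale groupoid -/

namespace EtaleGroupoid

universe u v

variable {n : ℕ} {G₁ : Type u} {G₀ : Type v} [TopologicalSpace G₁] [ChartedSpace (Eu n) G₁]
  [IsManifold (𝓡 n) ∞ G₁] [TopologicalSpace G₀] [ChartedSpace (Eu n) G₀]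
  [IsManifold (𝓡 n) ∞ G₀] (G : EtaleGroupoid n G₁ G₀)

/-- `a ⊗ a'` as the form `pr₁^* a ∧ pr₂^* a'` on `G₁ ×_{G₀} G₁`. -/
def formTen : Form n G₁ →ₗ[ℂ] Form n G₁ →ₗ[ℂ] Form n G.quiver.Comp₂ :=
  (LinearMap.mul ℂ (Form n G.quiver.Comp₂)).compl₁₂
    (Form.pullback _ G.quiver.contMDiff_fst₂).toLinearMap
    (Form.pullback _ G.quiver.contMDiff_snd₂).toLinearMap

/-- `x ⊗ a`, for a form `x` on `G₁ ×_{G₀} G₁` and a form `a` on `G₁`, as a form on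
`G₁ ×_{G₀} G₁ ×_{G₀} G₁`. -/
def formTen' : Form n G.quiver.Comp₂ →ₗ[ℂ] Form n G₁ →ₗ[ℂ] Form n G.quiver.Comp₃ :=
  (LinearMap.mul ℂ (Form n G.quiver.Comp₃)).compl₁₂
    (Form.pullback _ G.quiver.contMDiff_fst₃).toLinearMap
    (Form.pullback _ G.quiver.contMDiff_snd₃).toLinearMap

/-- The bialgebroid `H(G)`. The forms on `G₁ ×_{G₀} G₁` and on `G₁ ×_{G₀} G₁ ×_{G₀} G₁` are its
candidates for `A ⊗_B A` and `A ⊗_B A ⊗_B A`. -/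
def formBialgebroid :
    BialgebroidData (Form n G₁) (Form n G₀) (Form n G.quiver.Comp₂) (Form n G.quiver.Comp₃) where
  grA := Form.deg n G₁
  dA := Form.d n G₁
  grB := Form.deg n G₀
  dB := Form.d n G₀
  ten := G.formTen
  ten₃ := G.formTen.compr₂ G.formTen'
  α := (Form.pullback _ G.quiver.contMDiff_source).toLinearMap
  β := (Form.pullback _ G.quiver.contMDiff_target).toLinearMap
  Δ := (Form.pullback _ G.contMDiff_mul).toLinearMap
  ε := (Form.pullback _ G.contMDiff_unit).toLinearMap

/-- The antipode of `H(G)`, pullback along the inversion. -/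
def formAntipode : Form n G₁ →ₗ[ℂ] Form n G₁ :=
  (Form.pullback _ G.contMDiff_inv).toLinearMap

end EtaleGroupoid

end EtaleHopf

end

/-! All structure maps are pullbacks, so contravariance turns identities of arrows into axioms. The
maps on `A ⊗_B A` that the definition asks for are realised by pullbacks along maps into composable
arrows, by products with fixed forms, or by the exterior derivative. For instance `m(S ⊗ id)` is
pullback along `x ↦ (x⁻¹, x)`, and the twisted antipode axiom uses `(x, y) ↦ ((xy)⁻¹, x)`. Following
such a pullback after `Δ` means pulling back along the product of the pair (`pullback_pair_mul`), so
the last axiom is just `(xy)⁻¹x = y⁻¹`. The Koszul signs agree because forms commute in the graded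
sense; in particular the signed balance condition says `f (a ∧ t^*b, a') = f (a, s^*b ∧ a')`.

The analytic content is that forms on a fibre product `P` of `π : X → Z` and a local diffeomorphism
`s : Y → Z` are the completed tensor product over the forms on `Z`. Choose smooth `ρᵢ`, `θᵢ` on `Y`
with `∑ ρᵢ θᵢ = 1`, locally finite, where `ρᵢ` has compact support in an open set `Uᵢ` on which `s`
is injective. The first projection is then injective over `Uᵢ`, so `ρᵢ w` can be pushed to a form
`Eᵢ w` on `X`, extended by zero, and `w = ∑ p₁^*(Eᵢ w) ∧ p₂^*θᵢ` (`hasSum_ten`). Decomposable forms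
are therefore total, which gives uniqueness of lifts, and the lift of a balanced `f` has to be `F w
= ∑ f (Eᵢ w, θᵢ)` (`exists_lift`). On `w = a ⊗ a'` one has `Eᵢ w = a ∧ π^*(eᵢ a')` with `eᵢ` the
push along `s` (`pushFst_ten`); balance moves `eᵢ a'` to the second argument, where `∑ s^*(eᵢ a') θᵢ
= a'`.

Convergence of `F w` is the delicate point, as there are no support conditions. A neighbourhood of
zero in the forms on `Y` contains all forms that vanish near some compact set, hence all multiples
of all but finitely many `θᵢ`. Joint continuity then places all multiples of `f (x, θᵢ)` in a
prescribed convex neighbourhood, whatever `x` is, and convexity handles their sums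
(`exists_finset_forall_sum_mem`). The series thus converges uniformly in `w`, and `F` is continuous.
Carrying a parameter through this argument allows it to be iterated for the triple product.

Continuity of maps into spaces of forms is reduced by `Form.continuous_iff` to joint continuity of
the derivatives of the coefficients in the parameter and the point. -/

noncomputable section

namespace EtaleHopf

open Set Filter

/-! ### Families of smooth functions with jointly continuous derivatives -/

section Families

variable {n : ℕ} {T : Type*} [TopologicalSpace T]

/-- A family of smooth functions on `U` whose derivatives of order at most `k` depend continuously
on the point and on the parameter. -/
def SmoothFamily {V : Type} [NormedAddCommGroup V] [NormedSpace ℝ V] (k : ℕ) (U : Set (Eu n))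
    (η : T → Eu n → V) : Prop :=
  (∀ t, ContDiffOn ℝ ∞ (η t) U) ∧
    ∀ j ≤ k, ContinuousOn (fun p : T × Eu n => iteratedFDeriv ℝ j (η p.1) p.2) (univ ×ˢ U)

namespace SmoothFamily

variable {V W F : Type} [NormedAddCommGroup V] [NormedSpace ℝ V] [NormedAddCommGroup W]
  [NormedSpace ℝ W] [NormedAddCommGroup F] [NormedSpace ℝ F] {k : ℕ} {U : Set (Eu n)}
  {η : T → Eu n → V} {ζ : T → Eu n → W}

theorem mono {l : ℕ} (h : SmoothFamily k U η) (hl : l ≤ k) : SmoothFamily l U η :=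
  ⟨h.1, fun j hj => h.2 j (hj.trans hl)⟩

theorem contDiffAt (h : SmoothFamily k U η) (hU : IsOpen U) (t : T) {y : Eu n} (hy : y ∈ U) :
    ContDiffAt ℝ ∞ (η t) y := (h.1 t).contDiffAt (hU.mem_nhds hy)

theorem differentiableAt (h : SmoothFamily k U η) (hU : IsOpen U) (t : T) {y : Eu n}
    (hy : y ∈ U) : DifferentiableAt ℝ (η t) y :=
  (h.contDiffAt hU t hy).differentiableAt (by simp)

theorem congr {η' : T → Eu n → V} (h : SmoothFamily k U η) (hU : IsOpen U)
    (e : ∀ t, EqOn (η' t) (η t) U) : SmoothFamily k U η' := by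
  refine ⟨fun t => (h.1 t).congr (e t), fun j hj => (h.2 j hj).congr ?_⟩
  rintro ⟨t, y⟩ ⟨-, hy⟩
  have : η' t =ᶠ[𝓝 y] η t := by
    filter_upwards [hU.mem_nhds hy] with z hz using e t hz
  exact (this.iteratedFDeriv ℝ j).eq_of_nhds

theorem of_local (h : ∀ y ∈ U, ∃ U' ∈ 𝓝 y, SmoothFamily k U' η) : SmoothFamily k U η := by
  refine ⟨fun t y hy => ?_, fun j hj => ?_⟩
  · obtain ⟨U', hU', h'⟩ := h y hy
    exact ((h'.1 t).contDiffAt hU').contDiffWithinAt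
  · rintro ⟨t, y⟩ ⟨-, hy⟩
    obtain ⟨U', hU', h'⟩ := h y hy
    exact ((h'.2 j hj).continuousAt (prod_mem_nhds univ_mem hU')).continuousWithinAt

theorem zero_iff : SmoothFamily 0 U η ↔ (∀ t, ContDiffOn ℝ ∞ (η t) U) ∧
    ContinuousOn (fun p : T × Eu n => η p.1 p.2) (univ ×ˢ U) := by
  refine and_congr_right fun _ => ?_
  have e : (fun p : T × Eu n => iteratedFDeriv ℝ 0 (η p.1) p.2) =
      (continuousMultilinearCurryFin0 ℝ (Eu n) V).symm ∘ fun p => η p.1 p.2 := by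
    ext p; simp [iteratedFDeriv_zero_eq_comp]
  simp only [Nat.le_zero, forall_eq]
  rw [e, LinearIsometryEquiv.comp_continuousOn_iff]

theorem continuousOn (h : SmoothFamily k U η) :
    ContinuousOn (fun p : T × Eu n => η p.1 p.2) (univ ×ˢ U) :=
  (zero_iff.1 (h.mono (Nat.zero_le _))).2

theorem iteratedFDeriv_succ_continuousOn_iff (j : ℕ) (η : T → Eu n → V) :
    ContinuousOn (fun p : T × Eu n => iteratedFDeriv ℝ (j + 1) (η p.1) p.2) (univ ×ˢ U) ↔
    ContinuousOn (fun p : T × Eu n => iteratedFDeriv ℝ j (fderiv ℝ (η p.1)) p.2)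
      (univ ×ˢ U) := by
  have e : (fun p : T × Eu n => iteratedFDeriv ℝ (j + 1) (η p.1) p.2) =
      (continuousMultilinearCurryRightEquiv' ℝ j (Eu n) V).symm ∘
        fun p => iteratedFDeriv ℝ j (fderiv ℝ (η p.1)) p.2 := by
    ext p; simp [iteratedFDeriv_succ_eq_comp_right]
  rw [e, LinearIsometryEquiv.comp_continuousOn_iff]

/-- This is the induction step for the closure properties below: the product and chain rules express
a first derivative through families of the same kind, with values in another space. -/
theorem succ_iff (hU : IsOpen U) : SmoothFamily (k + 1) U η ↔
    SmoothFamily 0 U η ∧ SmoothFamily k U (fun t => fderiv ℝ (η t)) := by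
  constructor
  · intro h
    refine ⟨h.mono (Nat.zero_le _), fun t => (h.1 t).fderiv_of_isOpen hU (by simp), fun j hj => ?_⟩
    exact (iteratedFDeriv_succ_continuousOn_iff j η).1 (h.2 (j + 1) (by lia))
  · rintro ⟨h0, h1⟩
    refine ⟨h0.1, fun j hj => ?_⟩
    cases j with
    | zero => exact h0.2 0 le_rfl
    | succ j => exact (iteratedFDeriv_succ_continuousOn_iff j η).2 (h1.2 j (by lia))

theorem fderiv_family (h : SmoothFamily (k + 1) U η) (hU : IsOpen U) :
    SmoothFamily k U (fun t => fderiv ℝ (η t)) := ((succ_iff hU).1 h).2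

theorem add {ζ : T → Eu n → V} (hU : IsOpen U) (h : SmoothFamily k U η)
    (h' : SmoothFamily k U ζ) : SmoothFamily k U (fun t z => η t z + ζ t z) := by
  refine ⟨fun t => (h.1 t).add (h'.1 t), fun j hj => ((h.2 j hj).add (h'.2 j hj)).congr ?_⟩
  rintro ⟨t, y⟩ ⟨-, hy⟩
  exact iteratedFDeriv_add_apply ((h.contDiffAt hU t hy).of_le (WithTop.coe_le_coe.2 le_top))
    ((h'.contDiffAt hU t hy).of_le (WithTop.coe_le_coe.2 le_top))

theorem clm (hU : IsOpen U) (L : V →L[ℝ] W) (h : SmoothFamily k U η) :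
    SmoothFamily k U (fun t z => L (η t z)) := by
  refine ⟨fun t => L.contDiff.comp_contDiffOn (h.1 t), fun j hj => ?_⟩
  have := (ContinuousLinearMap.compContinuousMultilinearMapL ℝ
    (fun _ : Fin j => Eu n) V W L).continuous.comp_continuousOn (h.2 j hj)
  refine this.congr ?_
  rintro ⟨t, y⟩ ⟨-, hy⟩
  exact L.iteratedFDeriv_comp_left (h.contDiffAt hU t hy) (WithTop.coe_le_coe.2 le_top)

theorem const {g : Eu n → V} (hU : IsOpen U) (hg : ContDiffOn ℝ ∞ g U) :
    SmoothFamily k U (fun _ : T => g) := by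
  refine ⟨fun _ => hg, fun j _ => ?_⟩
  have : ContinuousOn (iteratedFDeriv ℝ j g) U :=
    (hg.continuousOn_iteratedFDerivWithin (m := j) (WithTop.coe_le_coe.2 le_top) hU.uniqueDiffOn).congr
      fun y hy => (iteratedFDerivWithin_of_isOpen j hU hy).symm
  exact this.comp continuousOn_snd fun _ hp => hp.2

theorem of_param {c : T → V} (hc : Continuous c) : SmoothFamily k U (fun t _ => c t) := by
  refine ⟨fun t => contDiffOn_const, fun j _ => ?_⟩
  cases j with
  | zero =>
    refine (zero_iff.2 ⟨fun t => contDiffOn_const, ?_⟩).2 0 le_rfl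
    exact (hc.comp continuous_fst).continuousOn
  | succ j =>
    have e : (fun p : T × Eu n => iteratedFDeriv ℝ (j + 1) (fun _ : Eu n => c p.1) p.2) =
        fun _ => 0 := by
      ext1 p
      rw [iteratedFDeriv_const_of_ne (by simp)]
      rfl
    rw [e]
    exact continuousOn_const

end SmoothFamily

/-- The value spaces are quantified inside the induction because differentiation replaces them by
spaces of linear maps. The Leibniz rule writes the derivative as two bilinear expressions, formed
with `precompR` and `precompL`. -/
theorem SmoothFamily.bilinear_aux {U : Set (Eu n)} (hU : IsOpen U) (k : ℕ) :
    ∀ (V W F : Type) [NormedAddCommGroup V] [NormedSpace ℝ V] [NormedAddCommGroup W]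
      [NormedSpace ℝ W] [NormedAddCommGroup F] [NormedSpace ℝ F] (B : V →L[ℝ] W →L[ℝ] F)
      (η : T → Eu n → V) (ζ : T → Eu n → W), SmoothFamily k U η → SmoothFamily k U ζ →
      SmoothFamily k U (fun t z => B (η t z) (ζ t z)) := by
  have h0 : ∀ (V W F : Type) [NormedAddCommGroup V] [NormedSpace ℝ V] [NormedAddCommGroup W]
      [NormedSpace ℝ W] [NormedAddCommGroup F] [NormedSpace ℝ F] (B : V →L[ℝ] W →L[ℝ] F)
      (η : T → Eu n → V) (ζ : T → Eu n → W), SmoothFamily 0 U η → SmoothFamily 0 U ζ →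
      SmoothFamily 0 U (fun t z => B (η t z) (ζ t z)) := by
    intro V W F _ _ _ _ _ _ B η ζ hη hζ
    rw [SmoothFamily.zero_iff] at *
    exact ⟨fun t => (B.contDiff.comp_contDiffOn (hη.1 t)).clm_apply (hζ.1 t),
      (B.continuous.comp_continuousOn hη.2).clm_apply hζ.2⟩
  induction k with
  | zero => exact h0
  | succ k ih =>
    intro V W F _ _ _ _ _ _ B η ζ hη hζ
    refine (SmoothFamily.succ_iff hU).2
      ⟨h0 V W F B η ζ (hη.mono (Nat.zero_le _)) (hζ.mono (Nat.zero_le _)), ?_⟩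
    have h1 := ih _ _ _ (B.precompR (Eu n)) _ _ (hη.mono k.le_succ) (hζ.fderiv_family hU)
    have h2 := ih _ _ _ (B.precompL (Eu n)) _ _ (hη.fderiv_family hU) (hζ.mono k.le_succ)
    refine (h1.add hU h2).congr hU fun t y hy => ?_
    exact (B.hasFDerivAt_of_bilinear (hη.differentiableAt hU t hy).hasFDerivAt
      (hζ.differentiableAt hU t hy).hasFDerivAt).fderiv

theorem SmoothFamily.bilinear {V W F : Type} [NormedAddCommGroup V] [NormedSpace ℝ V]
    [NormedAddCommGroup W] [NormedSpace ℝ W] [NormedAddCommGroup F] [NormedSpace ℝ F]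
    {U : Set (Eu n)} (hU : IsOpen U) {k : ℕ} (B : V →L[ℝ] W →L[ℝ] F)
    {η : T → Eu n → V} {ζ : T → Eu n → W} (hη : SmoothFamily k U η) (hζ : SmoothFamily k U ζ) :
    SmoothFamily k U (fun t z => B (η t z) (ζ t z)) :=
  SmoothFamily.bilinear_aux hU k V W F B η ζ hη hζ

/-- By the chain rule the derivative is a composition, hence bilinear, of `fderiv (η t) ∘ τ`, to
which the induction hypothesis applies in a new value space, with the parameter-free `fderiv τ`. -/
theorem SmoothFamily.comp_aux {U U' : Set (Eu n)} (hU : IsOpen U) (hU' : IsOpen U')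
    {τ : Eu n → Eu n} (hτ : ContDiffOn ℝ ∞ τ U) (hm : MapsTo τ U U') (k : ℕ) :
    ∀ (V : Type) [NormedAddCommGroup V] [NormedSpace ℝ V] (η : T → Eu n → V),
      SmoothFamily k U' η → SmoothFamily k U (fun t z => η t (τ z)) := by
  have h0 : ∀ (V : Type) [NormedAddCommGroup V] [NormedSpace ℝ V] (η : T → Eu n → V),
      SmoothFamily 0 U' η → SmoothFamily 0 U (fun t z => η t (τ z)) := by
    intro V _ _ η hη
    rw [SmoothFamily.zero_iff] at *
    refine ⟨fun t => (hη.1 t).comp hτ hm, ?_⟩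
    have h : ContinuousOn (fun p : T × Eu n => (p.1, τ p.2)) (univ ×ˢ U) :=
      continuousOn_fst.prodMk (hτ.continuousOn.comp continuousOn_snd fun _ hp => hp.2)
    exact hη.2.comp h fun p hp => ⟨trivial, hm hp.2⟩
  induction k with
  | zero => exact h0
  | succ k ih =>
    intro V _ _ η hη
    refine (SmoothFamily.succ_iff hU).2 ⟨h0 V η (hη.mono (Nat.zero_le _)), ?_⟩
    have h1 := ih _ _ (hη.fderiv_family hU')
    have h2 : SmoothFamily k U (fun _ : T => fderiv ℝ τ) :=
      SmoothFamily.const hU (hτ.fderiv_of_isOpen hU (by simp))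
    refine (SmoothFamily.bilinear hU (ContinuousLinearMap.compL ℝ (Eu n) (Eu n) V) h1 h2).congr hU
      fun t y hy => ?_
    exact ((hη.differentiableAt hU' t (hm hy)).hasFDerivAt.comp y
      ((hτ.contDiffAt (hU.mem_nhds hy)).differentiableAt (by simp)).hasFDerivAt).fderiv

theorem SmoothFamily.comp {V : Type} [NormedAddCommGroup V] [NormedSpace ℝ V]
    {U U' : Set (Eu n)} (hU : IsOpen U) (hU' : IsOpen U')
    {τ : Eu n → Eu n} (hτ : ContDiffOn ℝ ∞ τ U) (hm : MapsTo τ U U') {k : ℕ}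
    {η : T → Eu n → V} (hη : SmoothFamily k U' η) : SmoothFamily k U (fun t z => η t (τ z)) :=
  SmoothFamily.comp_aux hU hU' hτ hm k V η hη

theorem SmoothFamily.lamPull {U : Set (Eu n)} (hU : IsOpen U) {k : ℕ}
    {D : Eu n → (Eu n →L[ℝ] Eu n)} (hD : ContDiffOn ℝ ∞ D U) {η : T → Eu n → Lam n}
    (hη : SmoothFamily k U η) : SmoothFamily k U (fun t z => lamPull (D z) (η t z)) := by
  -- Since `lamPull D` is not linear in `D`, the argument is expanded in a basis: the coordinates
  -- carry the parameter, while the pulled back basis vectors are fixed smooth functions.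
  have key : ∀ s : Finset (Fin (Module.finrank ℂ (Lam n))), SmoothFamily k U (fun t z =>
      ∑ j ∈ s, coordCLM n j (η t z) • EtaleHopf.lamPull (D z) (Module.finBasis ℂ (Lam n) j)) := by
    intro s
    induction s using Finset.induction_on with
    | empty => simpa using SmoothFamily.const hU contDiffOn_const
    | insert j s hj ih =>
      simp only [Finset.sum_insert hj]
      refine SmoothFamily.add hU ?_ ih
      refine SmoothFamily.bilinear hU (ContinuousLinearMap.lsmul ℝ ℂ) (hη.clm hU (coordCLM n j)) ?_
      exact SmoothFamily.const hU fun z hz => (contDiffAt_lamPull_const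
        (hD.contDiffAt (hU.mem_nhds hz)) _).contDiffWithinAt
  refine (key Finset.univ).congr hU fun t z _ => lamPull_eq_sum _ _

end Families

/-! ### The topology on the space of forms -/

section FormTopology

variable {n : ℕ} {M N : Type*} [TopologicalSpace M] [ChartedSpace (Eu n) M]
  [TopologicalSpace N] [ChartedSpace (Eu n) N]

theorem chartExpr_eq_zero {φ : M → Lam n} {p : M} {y : Eu n}
    (h : φ ((chartAt (Eu n) p).symm y) = 0) : chartExpr φ p y = 0 := by
  unfold chartExpr pull
  rw [h, map_zero]

namespace Form

@[ext] theorem ext {φ ψ : Form n M} (h : ∀ x, φ x = ψ x) : φ = ψ := Subtype.ext (funext h)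

@[simp] theorem add_apply (φ ψ : Form n M) (x : M) : (φ + ψ) x = φ x + ψ x := rfl
@[simp] theorem mul_apply (φ ψ : Form n M) (x : M) : (φ * ψ) x = φ x * ψ x := rfl
@[simp] theorem sub_apply (φ ψ : Form n M) (x : M) : (φ - ψ) x = φ x - ψ x := rfl
@[simp] theorem zero_apply (x : M) : (0 : Form n M) x = 0 := rfl
@[simp] theorem smul_apply (c : ℂ) (φ : Form n M) (x : M) : (c • φ) x = c • φ x := rfl

theorem sum_apply {ι : Type*} (s : Finset ι) (φ : ι → Form n M) (x : M) :
    (∑ i ∈ s, φ i) x = ∑ i ∈ s, φ i x := by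
  classical
  induction s using Finset.induction_on with
  | empty => simp
  | insert i s hi ih => rw [Finset.sum_insert hi, Finset.sum_insert hi, add_apply, ih]

@[simp] theorem chartExpr_add (φ ψ : Form n M) (p : M) (y : Eu n) :
    chartExpr (φ + ψ).1 p y = chartExpr φ.1 p y + chartExpr ψ.1 p y := map_add (lamPull _) _ _
@[simp] theorem chartExpr_sub (φ ψ : Form n M) (p : M) (y : Eu n) :
    chartExpr (φ - ψ).1 p y = chartExpr φ.1 p y - chartExpr ψ.1 p y := map_sub (lamPull _) _ _
@[simp] theorem chartExpr_mul (φ ψ : Form n M) (p : M) (y : Eu n) :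
    chartExpr (φ * ψ).1 p y = chartExpr φ.1 p y * chartExpr ψ.1 p y := map_mul (lamPull _) _ _
@[simp] theorem chartExpr_smul (c : ℂ) (φ : Form n M) (p : M) (y : Eu n) :
    chartExpr (c • φ).1 p y = c • chartExpr φ.1 p y := map_smul (lamPull _) _ _
@[simp] theorem chartExpr_zero (p : M) (y : Eu n) :
    chartExpr (0 : Form n M).1 p y = 0 := map_zero (lamPull _)

theorem contDiffAt_chartExpr (φ : Form n M) (p : M) {y : Eu n}
    (hy : y ∈ (chartAt (Eu n) p).target) (k : ℕ) : ContDiffAt ℝ k (chartExpr φ.1 p) y :=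
  (φ.smooth.contDiffAt p hy).of_le (WithTop.coe_le_coe.2 le_top)

theorem iteratedFDeriv_chartExpr_sub (φ ψ : Form n M) (p : M) {y : Eu n}
    (hy : y ∈ (chartAt (Eu n) p).target) (k : ℕ) :
    iteratedFDeriv ℝ k (chartExpr (φ - ψ).1 p) y =
      iteratedFDeriv ℝ k (chartExpr φ.1 p) y - iteratedFDeriv ℝ k (chartExpr ψ.1 p) y := by
  have e : chartExpr φ.1 p = chartExpr (φ - ψ).1 p + chartExpr ψ.1 p := by
    ext1 z; simp
  have := iteratedFDeriv_add_apply ((φ - ψ).contDiffAt_chartExpr p hy k)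
    (ψ.contDiffAt_chartExpr p hy k)
  rw [← e] at this
  rw [this, add_sub_cancel_right]

theorem iteratedFDeriv_chartExpr_smul (c : ℝ) (φ : Form n M) (p : M) {y : Eu n}
    (hy : y ∈ (chartAt (Eu n) p).target) (k : ℕ) :
    iteratedFDeriv ℝ k (chartExpr (c • φ).1 p) y =
      c • iteratedFDeriv ℝ k (chartExpr φ.1 p) y := by
  rw [← iteratedFDeriv_const_smul_apply (φ.contDiffAt_chartExpr p hy k)]
  congr 1
  ext1 z
  exact (chartExpr_smul (c : ℂ) φ p z).trans (Complex.coe_smul c _)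

theorem iteratedFDeriv_chartExpr_zero (p : M) (y : Eu n) (k : ℕ) :
    iteratedFDeriv ℝ k (chartExpr (0 : Form n M).1 p) y = 0 := by
  have e : chartExpr (0 : Form n M).1 p = fun _ => 0 := by ext1 z; simp
  rw [e]
  exact congrFun (iteratedFDeriv_fun_zero (n := k)) y

/-- Convergence of forms is uniform convergence of all derivatives on compact subsets of charts. -/
theorem le_nhds_iff {F : Filter (Form n M)} {φ : Form n M} :
    F ≤ 𝓝 φ ↔ ∀ (p : M) (k : ℕ) (K : Set (Eu n)), IsCompact K → K ⊆ (chartAt (Eu n) p).target →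
      TendstoUniformlyOn (fun ψ : Form n M => iteratedFDeriv ℝ k (chartExpr ψ.1 p))
        (iteratedFDeriv ℝ k (chartExpr φ.1 p)) F K := by
  rw [nhds_iInf, le_iInf_iff]
  refine forall_congr' fun p => ?_
  rw [nhds_iInf, le_iInf_iff]
  refine forall_congr' fun k => ?_
  rw [nhds_induced, ← tendsto_iff_comap, UniformOnFun.tendsto_iff_tendstoUniformlyOn]
  exact ⟨fun h K h1 h2 => h K ⟨h1, h2⟩, fun h K hK => h K hK.1 hK.2⟩

theorem mem_nhds (φ : Form n M) (p : M) (k : ℕ) {K : Set (Eu n)} (hK : IsCompact K)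
    (hKp : K ⊆ (chartAt (Eu n) p).target) {ε : ℝ} (hε : 0 < ε) :
    {ψ : Form n M | ∀ y ∈ K, dist (iteratedFDeriv ℝ k (chartExpr φ.1 p) y)
      (iteratedFDeriv ℝ k (chartExpr ψ.1 p) y) < ε} ∈ 𝓝 φ :=
  Metric.tendstoUniformlyOn_iff.1 (le_nhds_iff.1 le_rfl p k K hK hKp) ε hε

/-- On an open subset of `ℝⁿ`, uniform convergence on compact subsets is locally uniform
convergence. Towards a continuous limit, the latter says that the values converge when parameter and
point move together, which is joint continuity. -/
theorem continuous_iff {T : Type*} [TopologicalSpace T] {Φ : T → Form n M} :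
    Continuous Φ ↔ ∀ (p : M) (k : ℕ),
      SmoothFamily k (chartAt (Eu n) p).target (fun t => chartExpr (Φ t).1 p) := by
  have key : ∀ (p : M) (k : ℕ), (∀ t, TendstoLocallyUniformlyOn
      (fun t => iteratedFDeriv ℝ k (chartExpr (Φ t).1 p))
      (iteratedFDeriv ℝ k (chartExpr (Φ t).1 p)) (𝓝 t) (chartAt (Eu n) p).target) ↔
      ContinuousOn (fun q : T × Eu n => iteratedFDeriv ℝ k (chartExpr (Φ q.1).1 p) q.2)
        (univ ×ˢ (chartAt (Eu n) p).target) := by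
    intro p k
    set U := (chartAt (Eu n) p).target
    have hU : IsOpen U := (chartAt (Eu n) p).open_target
    have hc : ∀ t, ∀ y ∈ U, ContinuousAt (iteratedFDeriv ℝ k (chartExpr (Φ t).1 p)) y :=
      fun t y hy => ((Φ t).smooth.contDiffAt p hy).continuousAt_iteratedFDeriv
        (WithTop.coe_le_coe.2 le_top)
    have hc' : ∀ t, ∀ y ∈ U, Tendsto
        (fun q : T × Eu n => iteratedFDeriv ℝ k (chartExpr (Φ t).1 p) q.2) (𝓝 t ×ˢ 𝓝 y)
        (𝓝 (iteratedFDeriv ℝ k (chartExpr (Φ t).1 p) y)) := fun t y hy =>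
      (hc t y hy).tendsto.comp tendsto_snd
    simp only [hU.tendstoLocallyUniformlyOn_iff_forall_tendsto]
    constructor
    · rintro h ⟨t, y⟩ ⟨-, hy⟩
      refine ContinuousAt.continuousWithinAt ?_
      have := h t y hy
      rw [ContinuousAt, nhds_prod_eq]
      exact (hc' t y hy).congr_uniformity this
    · intro h t y hy
      have h1 := (h.continuousAt ((isOpen_univ.prod hU).mem_nhds ⟨trivial, hy⟩ :
        univ ×ˢ U ∈ 𝓝 (t, y))).tendsto
      rw [nhds_prod_eq] at h1
      exact ((hc' t y hy).prodMk_nhds h1).mono_right (nhds_le_uniformity _)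
  rw [continuous_iff_continuousAt]
  simp only [ContinuousAt, Tendsto, le_nhds_iff]
  constructor
  · intro h p k
    refine ⟨fun t => (Φ t).smooth p, fun j _ => (key p j).1 fun t => ?_⟩
    exact (tendstoLocallyUniformlyOn_iff_forall_isCompact (chartAt (Eu n) p).open_target).2
      fun K h1 h2 => h t p j K h2 h1
  · intro h t p k K h1 h2
    exact (tendstoLocallyUniformlyOn_iff_forall_isCompact (chartAt (Eu n) p).open_target).1
      ((key p k).2 ((h p k).2 k le_rfl) t) K h2 h1

theorem smoothFamily (p : M) (k : ℕ) :
    SmoothFamily k (chartAt (Eu n) p).target (fun φ : Form n M => chartExpr φ.1 p) :=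
  continuous_iff.1 continuous_id p k

theorem smoothFamily_comp {T : Type*} [TopologicalSpace T] {Φ : T → Form n M} (h : Continuous Φ)
    (p : M) (k : ℕ) : SmoothFamily k (chartAt (Eu n) p).target (fun t => chartExpr (Φ t).1 p) :=
  continuous_iff.1 h p k

theorem continuous_mul : Continuous fun p : Form n M × Form n M => p.1 * p.2 := by
  refine continuous_iff.2 fun p k => ?_
  have hU := (chartAt (Eu n) p).open_target
  exact (SmoothFamily.bilinear hU (mulCLM n) (smoothFamily_comp continuous_fst p k)
    (smoothFamily_comp continuous_snd p k)).congr hU fun t y _ => chartExpr_mul t.1 t.2 p y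

theorem continuous_add : Continuous fun p : Form n M × Form n M => p.1 + p.2 := by
  refine continuous_iff.2 fun p k => ?_
  have hU := (chartAt (Eu n) p).open_target
  exact (SmoothFamily.add hU (smoothFamily_comp continuous_fst p k)
    (smoothFamily_comp continuous_snd p k)).congr hU fun t y _ => chartExpr_add t.1 t.2 p y

instance : ContinuousSMul ℂ (Form n M) where
  continuous_smul := by
    refine continuous_iff.2 fun p k => ?_
    have hU := (chartAt (Eu n) p).open_target
    exact (SmoothFamily.bilinear hU (ContinuousLinearMap.lsmul ℝ ℂ)
      (SmoothFamily.of_param continuous_fst) (smoothFamily_comp continuous_snd p k)).congr hU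
      fun t y _ => chartExpr_smul t.1 t.2 p y

instance : IsTopologicalAddGroup (Form n M) where
  continuous_add := continuous_add
  continuous_neg := by
    have h : (fun φ : Form n M => -φ) = fun φ => (-1 : ℂ) • φ := by ext; simp
    rw [h]
    exact continuous_const_smul _

instance : LocallyConvexSpace ℝ (Form n M) := by
  rw [locallyConvexSpace_iff_exists_convex_subset_zero]
  -- The sets that contain a convex neighbourhood of zero form a filter. Comparing it with `𝓝 0` by
  -- `le_nhds_iff` leaves only the basic seminorm conditions to check, and these are convex.
  let F : Filter (Form n M) :=
    { sets := {U | ∃ S ∈ 𝓝 (0 : Form n M), Convex ℝ S ∧ S ⊆ U}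
      univ_sets := ⟨univ, univ_mem, convex_univ, subset_rfl⟩
      sets_of_superset := fun ⟨S, h1, h2, h3⟩ h => ⟨S, h1, h2, h3.trans h⟩
      inter_sets := fun ⟨S, h1, h2, h3⟩ ⟨S', h1', h2', h3'⟩ =>
        ⟨S ∩ S', inter_mem h1 h1', h2.inter h2', inter_subset_inter h3 h3'⟩ }
  have hF : F ≤ 𝓝 0 := by
    refine le_nhds_iff.2 fun p k K h1 h2 => Metric.tendstoUniformlyOn_iff.2 fun ε hε => ?_
    refine ⟨_, mem_nhds 0 p k h1 h2 hε, ?_, subset_rfl⟩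
    intro φ hφ ψ hψ a b ha hb hab y hy
    have h1 := hφ y hy
    have h2' := hψ y hy
    rw [iteratedFDeriv_chartExpr_zero, dist_zero_left] at h1 h2' ⊢
    have e : a • φ + b • ψ = a • φ - (-b) • ψ := by rw [neg_smul, sub_neg_eq_add]
    rw [e, iteratedFDeriv_chartExpr_sub _ _ p (h2 hy), iteratedFDeriv_chartExpr_smul _ _ p (h2 hy),
      iteratedFDeriv_chartExpr_smul _ _ p (h2 hy), neg_smul, sub_neg_eq_add]
    have := convex_ball (0 : ContinuousMultilinearMap ℝ (fun _ : Fin k => Eu n) (Lam n)) ε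
    simpa using this (by simpa using h1) (by simpa using h2') ha hb hab
  intro U hU
  obtain ⟨S, h1, h2, h3⟩ := hF hU
  exact ⟨S, h1, h2, h3⟩

theorem continuous_chartExpr (p : M) {y : Eu n} (hy : y ∈ (chartAt (Eu n) p).target) :
    Continuous fun φ : Form n M => chartExpr φ.1 p y :=
  continuousOn_univ.1 ((smoothFamily p 0).continuousOn.comp (f := fun φ => (φ, y))
    (continuous_id.prodMk continuous_const).continuousOn fun _ _ => ⟨trivial, hy⟩)

theorem hasFDerivAt_iteratedFDeriv_chartExpr (φ : Form n M) (p : M) {y : Eu n}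
    (hy : y ∈ (chartAt (Eu n) p).target) (k : ℕ) :
    HasFDerivAt (iteratedFDeriv ℝ k (chartExpr φ.1 p))
      (iteratedFDeriv ℝ (k + 1) (chartExpr φ.1 p) y).curryLeft y := by
  have h := ((φ.smooth.contDiffAt p hy).differentiableAt_iteratedFDeriv (m := k)
    (WithTop.coe_lt_coe.2 (ENat.natCast_lt_top k))).hasFDerivAt
  have e : (iteratedFDeriv ℝ (k + 1) (chartExpr φ.1 p) y).curryLeft =
      fderiv ℝ (iteratedFDeriv ℝ k (chartExpr φ.1 p)) y := by
    rw [iteratedFDeriv_succ_eq_comp_left]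
    exact (continuousMultilinearCurryLeftEquiv ℝ (fun _ : Fin (k + 1) => Eu n)
      (Lam n)).apply_symm_apply _
  rw [e]
  exact h

/-- A neighbourhood of zero contains all forms that vanish near some compact set. -/
theorem exists_isCompact_of_mem_nhds_zero {N : Set (Form n M)}
    (hN : N ∈ 𝓝 (0 : Form n M)) :
    ∃ C : Set M, IsCompact C ∧ ∀ φ : Form n M, (∀ x ∈ C, ∀ᶠ z in 𝓝 x, φ z = 0) → φ ∈ N := by
  -- The required property again defines a filter, with unions of compact sets handling
  -- intersections, so it needs checking only for one chart, one order and one compact set.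
  let F : Filter (Form n M) :=
    { sets := {U | ∃ C : Set M, IsCompact C ∧
        ∀ φ : Form n M, (∀ x ∈ C, ∀ᶠ z in 𝓝 x, φ z = 0) → φ ∈ U}
      univ_sets := ⟨∅, isCompact_empty, fun _ _ => trivial⟩
      sets_of_superset := fun ⟨C, h1, h2⟩ h => ⟨C, h1, fun φ hφ => h (h2 φ hφ)⟩
      inter_sets := fun ⟨C, h1, h2⟩ ⟨C', h1', h2'⟩ => ⟨C ∪ C', h1.union h1', fun φ hφ =>
        ⟨h2 φ fun x hx => hφ x (.inl hx), h2' φ fun x hx => hφ x (.inr hx)⟩⟩ }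
  have hF : F ≤ 𝓝 0 := by
    refine le_nhds_iff.2 fun p k K h1 h2 => Metric.tendstoUniformlyOn_iff.2 fun ε hε => ?_
    set c := chartAt (Eu n) p
    -- A form that vanishes near the image of `K` has a chart expression that vanishes near `K`, so
    -- that its derivatives vanish on `K` too.
    refine ⟨c.symm '' K, h1.image_of_continuousOn (c.continuousOn_symm.mono h2), ?_⟩
    intro φ hφ y hy
    have h3 := (c.continuousAt_symm (h2 hy)).eventually (hφ _ ⟨y, hy, rfl⟩)
    have h4 : chartExpr φ.1 p =ᶠ[𝓝 y] chartExpr (0 : Form n M).1 p := by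
      filter_upwards [h3] with z hz
      rw [chartExpr_zero, chartExpr_eq_zero hz]
    rw [(h4.iteratedFDeriv ℝ k).eq_of_nhds, dist_self]
    exact hε
  exact hF hN

end Form

end FormTopology

/-! ### Separation, completeness, pullback and differential of forms. -/

section FormTopology

variable {n : ℕ} {M N : Type*} [TopologicalSpace M] [ChartedSpace (Eu n) M]
  [TopologicalSpace N] [ChartedSpace (Eu n) N] [IsManifold (𝓡 n) ∞ M] [IsManifold (𝓡 n) ∞ N]

/-- Recovering values from chart expressions makes evaluation at a point continuous; this gives the
Hausdorff property and pointwise limits. -/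
theorem eq_lamPull_chartExpr (φ : M → Lam n) (x : M) :
    φ x = lamPull (mfderiv (𝓡 n) (𝓡 n) (chartAt (Eu n) x) x : Eu n →L[ℝ] Eu n)
      (chartExpr φ x (chartAt (Eu n) x x)) := by
  have h := pull_eq_chart (f := id) (x := x) contMDiffAt_id (q := x) (mem_chart_source _ x) φ
  rw [pull_id] at h
  exact h

theorem continuous_lamPull (D : Eu n →L[ℝ] Eu n) : Continuous (lamPull D) :=
  (toRealCLM (lamPull D).toLinearMap).continuous

namespace Form

theorem continuous_eval (x : M) : Continuous fun φ : Form n M => φ x := by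
  have h := (continuous_lamPull (mfderiv (𝓡 n) (𝓡 n) (chartAt (Eu n) x) x)).comp
    (continuous_chartExpr x (mem_chart_target _ x))
  exact h.congr fun φ => (eq_lamPull_chartExpr φ.1 x).symm

instance : T2Space (Form n M) :=
  T2Space.of_injective_continuous (f := fun (φ : Form n M) (x : M) => φ x)
    (fun _ _ h => Subtype.ext h) (continuous_pi continuous_eval)

/-- Locally uniform limits commute with differentiation, so the limits of the derivatives of all
orders form a Taylor series for the limit of the coefficients. The limit form itself is defined by
pointwise limits, independently of charts. -/
theorem exists_limit {F : Filter (Form n M)} [F.NeBot]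
    (hF : ∀ (p : M) (k : ℕ) (K : Set (Eu n)), IsCompact K → K ⊆ (chartAt (Eu n) p).target →
      UniformCauchySeqOn (fun ψ : Form n M => iteratedFDeriv ℝ k (chartExpr ψ.1 p)) F K) :
    ∃ φ : Form n M, F ≤ 𝓝 φ := by
  have h1 : ∀ (p : M) (k : ℕ) (y : Eu n), ∃ l, y ∈ (chartAt (Eu n) p).target →
      Tendsto (fun ψ : Form n M => iteratedFDeriv ℝ k (chartExpr ψ.1 p) y) F (𝓝 l) := by
    intro p k y
    by_cases hy : y ∈ (chartAt (Eu n) p).target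
    · have := (hF p k {y} isCompact_singleton (by simpa using hy)).cauchy_map (mem_singleton y)
      obtain ⟨l, hl⟩ := CompleteSpace.complete this
      exact ⟨l, fun _ => hl⟩
    -- Outside the chart nothing is claimed; the value `0` only makes the limits total functions.
    · exact ⟨0, fun h => absurd h hy⟩
  choose g hg using h1
  have h2 : ∀ (p : M) (k : ℕ) (K : Set (Eu n)), IsCompact K → K ⊆ (chartAt (Eu n) p).target →
      TendstoUniformlyOn (fun ψ : Form n M => iteratedFDeriv ℝ k (chartExpr ψ.1 p))
        (fun y => g p k y) F K := fun p k K hK hKp =>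
    (hF p k K hK hKp).tendstoUniformlyOn_of_tendsto fun y hy => hg p k y (hKp hy)
  have h3 : ∀ (p : M) (k : ℕ), TendstoLocallyUniformlyOn
      (fun ψ : Form n M => iteratedFDeriv ℝ k (chartExpr ψ.1 p)) (fun y => g p k y) F
      (chartAt (Eu n) p).target := fun p k =>
    (tendstoLocallyUniformlyOn_iff_forall_isCompact (chartAt (Eu n) p).open_target).2
      fun K hK hK' => h2 p k K hK' hK
  have h4 : ∀ (p : M) (k : ℕ), ∀ y ∈ (chartAt (Eu n) p).target,
      HasFDerivAt (fun y => g p k y) (g p (k + 1) y).curryLeft y := by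
    intro p k y hy
    refine hasFDerivAt_of_tendstoLocallyUniformlyOn (chartAt (Eu n) p).open_target
      (f := fun ψ : Form n M => iteratedFDeriv ℝ k (chartExpr ψ.1 p))
      (g' := fun y => (g p (k + 1) y).curryLeft)
      (f' := fun ψ y => (iteratedFDeriv ℝ (k + 1) (chartExpr ψ.1 p) y).curryLeft) (l := F)
      ?_ (fun ψ y hy => ψ.hasFDerivAt_iteratedFDeriv_chartExpr p hy k) (fun y hy => hg p k y hy) hy
    exact (continuousMultilinearCurryLeftEquiv ℝ (fun _ : Fin (k + 1) => Eu n)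
      (Lam n)).isometry.uniformContinuous.comp_tendstoLocallyUniformlyOn (h3 p (k + 1))
  have h5 : ∀ x : M, ∃ l, Tendsto (fun ψ : Form n M => ψ x) F (𝓝 l) := by
    intro x
    have h := ((continuous_lamPull (mfderiv (𝓡 n) (𝓡 n) (chartAt (Eu n) x) x)).tendsto _).comp
      (((continuousMultilinearCurryFin0 ℝ (Eu n) (Lam n)).continuous.tendsto _).comp
        (hg x 0 (chartAt (Eu n) x x) (mem_chart_target _ x)))
    exact ⟨_, h.congr fun ψ => (eq_lamPull_chartExpr ψ.1 x).symm⟩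
  choose φ hφ using h5
  -- Both sides are limits of the same chart expressions; this ties the limits in the individual
  -- charts to the single form `φ`.
  have h6 : ∀ (p : M), ∀ y ∈ (chartAt (Eu n) p).target, (g p 0 y).curry0 = chartExpr φ p y := by
    intro p y hy
    have ha := ((continuous_lamPull (mfderiv (𝓡 n) (𝓡 n) (chartAt (Eu n) p).symm y)).tendsto
      _).comp (hφ ((chartAt (Eu n) p).symm y))
    have hb := ((continuousMultilinearCurryFin0 ℝ (Eu n) (Lam n)).continuous.tendsto _).comp
        (hg p 0 y hy)
    exact tendsto_nhds_unique hb ha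
  have h7 : ∀ p : M, HasFTaylorSeriesUpToOn ∞ (chartExpr φ p) (fun y k => g p k y)
      (chartAt (Eu n) p).target := fun p =>
    { zero_eq := h6 p
      fderivWithin := fun k _ y hy => (h4 p k y hy).hasFDerivWithinAt
      cont := fun k _ y hy => (h4 p k y hy).continuousAt.continuousWithinAt }
  have h8 : IsSmoothForm φ := fun p => (h7 p).contDiffOn
  refine ⟨⟨φ, h8⟩, le_nhds_iff.2 fun p k K hK hKp => (h2 p k K hK hKp).congr_right fun y hy => ?_⟩
  have hU := (chartAt (Eu n) p).open_target
  rw [← iteratedFDerivWithin_of_isOpen k hU (hKp hy)]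
  exact (h7 p).eq_iteratedFDerivWithin_of_uniqueDiffOn (WithTop.coe_le_coe.2 le_top)
    hU.uniqueDiffOn (hKp hy)

variable (n M) in
theorem completeSpace :
    @CompleteSpace (Form n M) (IsTopologicalAddGroup.rightUniformSpace (Form n M)) := by
  let := IsTopologicalAddGroup.rightUniformSpace (Form n M)
  refine ⟨fun {F} hF => ?_⟩
  have := hF.1
  refine exists_limit fun p k K hK hKp u hu => ?_
  obtain ⟨ε, hε, hεu⟩ := Metric.mem_uniformity_dist.1 hu
  -- The entourages come from neighbourhoods of zero through differences, so a Cauchy filter of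
  -- forms has uniformly Cauchy derivatives on compact subsets of charts.
  have h1 : F ×ˢ F ≤ comap (fun q : Form n M × Form n M => q.2 + -q.1) (𝓝 0) := hF.2
  filter_upwards [h1 (preimage_mem_comap (mem_nhds 0 p k hK hKp hε))] with q hq y hy
  have h2 := hq y hy
  have e : q.2 + -q.1 = q.2 - q.1 := (sub_eq_add_neg _ _).symm
  beta_reduce at h2
  rw [iteratedFDeriv_chartExpr_zero, dist_zero_left, e, iteratedFDeriv_chartExpr_sub _ _ p (hKp hy), ← dist_eq_norm, dist_comm] at h2
  exact hεu h2

theorem isCompleteLCS : IsCompleteLCS (Form n M) :=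
  ⟨inferInstance, inferInstance, inferInstance, inferInstance, completeSpace n M⟩

/-! ### Pullback in families -/

/-- Near each point `g` factors through a chart of `N`. There the pullback is composition with a
fixed smooth map followed by `lamPull` of its derivative, and both operations preserve smooth
families. -/
theorem smoothFamily_pull {T : Type*} [TopologicalSpace T] {Ψ : T → Form n N} (hΨ : Continuous Ψ)
    {U : Set (Eu n)} (hU : IsOpen U) {g : Eu n → N} (hg : ContMDiffOn (𝓡 n) (𝓡 n) ∞ g U) (k : ℕ) :
    SmoothFamily k U (fun t => pull g (Ψ t).1) := by
  refine SmoothFamily.of_local fun y hy => ?_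
  set c := chartAt (Eu n) (g y)
  have hU' : IsOpen (U ∩ g ⁻¹' c.source) := hg.continuousOn.isOpen_inter_preimage hU c.open_source
  refine ⟨_, hU'.mem_nhds ⟨hy, mem_chart_source _ _⟩, ?_⟩
  have hgat : ∀ z ∈ U, ContMDiffAt (𝓡 n) (𝓡 n) ∞ g z := fun z hz => hg.contMDiffAt (hU.mem_nhds hz)
  have hτ : ContDiffOn ℝ ∞ (c ∘ g) (U ∩ g ⁻¹' c.source) := fun z hz =>
    ((contMDiffAt_chart (g y) hz.2).comp z (hgat z hz.1)).contDiffAt.contDiffWithinAt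
  have h1 := (smoothFamily_comp hΨ (g y) k).comp hU' c.open_target hτ
    fun z hz => c.map_source hz.2
  refine (h1.lamPull hU' (hτ.fderiv_of_isOpen hU' (by simp))).congr hU' fun t z hz => ?_
  rw [pull_eq_chart (hgat z hz.1) hz.2, pull_flat]

/-- A family of forms which is, locally on `M`, zero or the pullback of a continuous family. -/
theorem smoothFamily_of_local {T : Type*} [TopologicalSpace T] {Φ : T → M → Lam n}
    {Ψ : T → Form n N} (hΨ : Continuous Ψ)
    (h : ∀ x, ∃ W ∈ 𝓝 x, (∀ t, ∀ z ∈ W, Φ t z = 0) ∨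
      ∃ g : M → N, ContMDiffOn (𝓡 n) (𝓡 n) ∞ g W ∧ ∀ t, ∀ z ∈ W, Φ t z = pull g (Ψ t).1 z)
    (p : M) (k : ℕ) : SmoothFamily k (chartAt (Eu n) p).target (fun t => chartExpr (Φ t) p) := by
  refine SmoothFamily.of_local fun y hy => ?_
  set c := chartAt (Eu n) p
  -- The neighbourhood and the alternative chosen on it are the same for all parameters, which is
  -- what lets joint continuity be checked locally.
  obtain ⟨W', hW', h'⟩ := h (c.symm y)
  obtain ⟨W, hWW', hW, hyW⟩ := mem_nhds_iff.1 hW'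
  have hU : IsOpen (c.target ∩ c.symm ⁻¹' W) := c.isOpen_inter_preimage_symm hW
  refine ⟨_, hU.mem_nhds ⟨hy, hyW⟩, ?_⟩
  rcases h' with h0 | ⟨g, hg, hΦ⟩
  · refine (SmoothFamily.const hU (contDiffOn_const (c := (0 : Lam n)))).congr hU fun t z hz => ?_
    exact chartExpr_eq_zero (h0 t _ (hWW' hz.2))
  · have hcs : ContMDiffOn (𝓡 n) (𝓡 n) ∞ c.symm c.target :=
      fun z hz => (contMDiffAt_chart_symm p hz).contMDiffWithinAt
    refine (smoothFamily_pull hΨ hU ((hg.mono hWW').comp (hcs.mono inter_subset_left)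
      inter_subset_right) k).congr hU fun t z hz => ?_
    have hgz : ContMDiffAt (𝓡 n) (𝓡 n) ∞ g (c.symm z) :=
      (hg.mono hWW').contMDiffAt (hW.mem_nhds hz.2)
    rw [pull_comp (hgz.mdifferentiableAt infty_ne_zero)
      ((contMDiffAt_chart_symm p hz.1).mdifferentiableAt infty_ne_zero)]
    exact pull_congr_right _ (hΦ t _ (hWW' hz.2))

theorem continuous_pullback {f : M → N} (hf : ContMDiff (𝓡 n) (𝓡 n) ∞ f) :
    Continuous (pullback f hf) :=
  continuous_iff.2 fun p k => smoothFamily_of_local continuous_id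
    (fun _ => ⟨univ, univ_mem, .inr ⟨f, hf.contMDiffOn, fun _ _ _ => rfl⟩⟩) p k

theorem continuous_d : Continuous (d n M) := by
  refine continuous_iff.2 fun p k => ?_
  have hU := (chartAt (Eu n) p).open_target
  -- The coordinate formula applies the fixed linear map `L` to the first derivative, so order `k`
  -- for the exterior derivative needs order `k + 1` for the form.
  let L : (Eu n →L[ℝ] Lam n) →L[ℝ] Lam n := ∑ i : Fin n,
    (mulCLM n (ExteriorAlgebra.ι ℂ (dx i))).comp (ContinuousLinearMap.apply ℝ (Lam n) (ev i))
  refine (((smoothFamily p (k + 1)).fderiv_family hU).clm hU L).congr hU fun φ y hy => ?_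
  change chartExpr (extD φ.1) p y = _
  rw [chartExpr_extD φ.smooth p hy]
  simp [L, flatD]

@[simp] theorem pullback_apply {f : M → N} (hf : ContMDiff (𝓡 n) (𝓡 n) ∞ f) (φ : Form n N)
    (x : M) : pullback f hf φ x = pull f φ.1 x := rfl

theorem pullback_pullback {P : Type*} [TopologicalSpace P] [ChartedSpace (Eu n) P]
    [IsManifold (𝓡 n) ∞ P] {f : M → N} {g : N → P} (hf : ContMDiff (𝓡 n) (𝓡 n) ∞ f)
    (hg : ContMDiff (𝓡 n) (𝓡 n) ∞ g) (φ : Form n P) :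
    pullback f hf (pullback g hg φ) = pullback (g ∘ f) (hg.comp hf) φ :=
  Form.ext fun _ => (pull_comp (hg.mdifferentiableAt infty_ne_zero)
    (hf.mdifferentiableAt infty_ne_zero) φ.1).symm

theorem pullback_congr {f g : M → N} (hf : ContMDiff (𝓡 n) (𝓡 n) ∞ f)
    (hg : ContMDiff (𝓡 n) (𝓡 n) ∞ g) (h : ∀ x, f x = g x) (φ : Form n N) :
    pullback f hf φ = pullback g hg φ := by
  obtain rfl : f = g := funext h
  rfl

theorem pullback_of_eq_id {f : M → M} (hf : ContMDiff (𝓡 n) (𝓡 n) ∞ f) (h : ∀ x, f x = x)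
    (φ : Form n M) : pullback f hf φ = φ := by
  obtain rfl : f = id := funext h
  exact Form.ext fun x => pull_id _ x

/-- In the charts at `x` and `f x` this is `flatD_lamPull` for the coordinate expression of `f`;
functoriality of `pull` then removes the charts. -/
theorem pullback_d {f : M → N} (hf : ContMDiff (𝓡 n) (𝓡 n) ∞ f) (φ : Form n N) :
    pullback f hf (d n N φ) = d n M (pullback f hf φ) := by
  refine Form.ext fun x => ?_
  set b := chartAt (Eu n) x
  set c := chartAt (Eu n) (f x)
  have hxb : x ∈ b.source := mem_chart_source _ x
  have hxc : f x ∈ c.source := mem_chart_source _ (f x)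
  have hbs := contMDiffAt_chart_symm x (mem_chart_target (Eu n) x)
  have hbx : b.symm (b x) = x := b.left_inv hxb
  have hfb : ContMDiffAt (𝓡 n) (𝓡 n) ∞ (f ∘ b.symm) (b x) := hf.contMDiffAt.comp _ hbs
  have hcf : ContMDiffAt (𝓡 n) (𝓡 n) ∞ (c ∘ f) x := (contMDiffAt_chart (f x) hxc).comp x hf.contMDiffAt
  have hτ : ContMDiffAt (𝓡 n) (𝓡 n) ∞ (c ∘ f ∘ b.symm) (b x) := by
    refine ContMDiffAt.comp (b x) (contMDiffAt_chart (f x) ?_) hfb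
    simp [hbx]
  have e1 : chartExpr (pull f φ.1) x =ᶠ[𝓝 (b x)]
      fun z => lamPull (fderiv ℝ (c ∘ f ∘ b.symm) z) (chartExpr φ.1 (f x) ((c ∘ f ∘ b.symm) z)) := by
    have h1 : ∀ᶠ z in 𝓝 (b x), f (b.symm z) ∈ c.source :=
      hfb.continuousAt.eventually (c.open_source.mem_nhds (by simpa [hbx] using hxc))
    filter_upwards [b.open_target.mem_nhds (b.map_source hxb), h1] with z hz hzc
    have hz' := contMDiffAt_chart_symm x hz
    rw [← pull_flat, ← pull_eq_chart (f := f ∘ b.symm) (hf.contMDiffAt.comp _ hz') hzc]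
    exact (pull_comp (hf.mdifferentiableAt infty_ne_zero) (hz'.mdifferentiableAt infty_ne_zero)
      φ.1).symm
  have e2 : (c ∘ f ∘ b.symm) (b x) = c (f x) := by simp [hbx]
  have e3 := flatD_lamPull hτ.contDiffAt (η := chartExpr φ.1 (f x)) (by
    rw [e2]
    exact (φ.smooth.contDiffAt (f x) (mem_chart_target _ _)).differentiableAt infty_ne_zero)
  have e4 : c ∘ f =ᶠ[𝓝 x] (c ∘ f ∘ b.symm) ∘ b := by
    filter_upwards [b.open_source.mem_nhds hxb] with z hz
    simp [b.left_inv hz]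
  change pull f (extD φ.1) x = pull b (flatD (chartExpr (pull f φ.1) x)) x
  have e5 : pull b (flatD (chartExpr (pull f φ.1) x)) x =
      pull b (pull (c ∘ f ∘ b.symm) (flatD (chartExpr φ.1 (f x)))) x :=
    pull_congr_right _ (by rw [flatD_congr e1, e3, pull_flat])
  rw [e5, ← pull_comp (hτ.mdifferentiableAt infty_ne_zero)
    ((contMDiffAt_chart x hxb).mdifferentiableAt infty_ne_zero), ← pull_congr e4,
    pull_comp ((contMDiffAt_chart (f x) hxc).mdifferentiableAt infty_ne_zero)
      (hf.mdifferentiableAt infty_ne_zero)]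
  exact pull_congr_right _ rfl

theorem d_apply_eq_zero {φ : Form n M} {x : M}
    (h : flatD (chartExpr φ.1 x) (chartAt (Eu n) x x) = 0) : d n M φ x = 0 := by
  change lamPull _ (flatD (chartExpr φ.1 x) _) = 0
  rw [h, map_zero]

end Form

/-- Second derivatives are symmetric and the `dxᵢ` anticommute, so exchanging the two summation
indices shows that the double sum is its own negative. -/
theorem flatD_flatD {η : Eu n → Lam n} {y : Eu n} (hη : ContDiffAt ℝ ∞ η y) :
    flatD (flatD η) y = 0 := by
  have h2 : DifferentiableAt ℝ (fderiv ℝ η) y :=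
    (hη.fderiv_right (m := ∞) (by simp)).differentiableAt infty_ne_zero
  have hsymm : IsSymmSndFDerivAt ℝ η y := hη.isSymmSndFDerivAt (by
    rw [minSmoothness_of_isRCLikeNormedField]; exact WithTop.coe_le_coe.2 (le_top : (2 : ℕ∞) ≤ ⊤))
  have key : ∀ v, fderiv ℝ (flatD η) y v =
      ∑ j : Fin n, ExteriorAlgebra.ι ℂ (dx j) * fderiv ℝ (fderiv ℝ η) y v (ev j) := by
    intro v
    have h3 : HasFDerivAt (flatD η) (∑ j : Fin n, (mulCLM n (ExteriorAlgebra.ι ℂ (dx j))).comp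
        ((ContinuousLinearMap.apply ℝ (Lam n) (ev j)).comp (fderiv ℝ (fderiv ℝ η) y))) y :=
      HasFDerivAt.fun_sum fun j _ => (mulCLM n (ExteriorAlgebra.ι ℂ (dx j))).hasFDerivAt.comp y
        ((ContinuousLinearMap.apply ℝ (Lam n) (ev j)).hasFDerivAt.comp y h2.hasFDerivAt)
    rw [h3.fderiv]
    simp
  have hs : flatD (flatD η) y = - flatD (flatD η) y := by
    unfold flatD
    change ∑ i, _ * fderiv ℝ (flatD η) y (ev i) = -∑ i, _ * fderiv ℝ (flatD η) y (ev i)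
    simp only [key, Finset.mul_sum]
    conv_lhs => rw [Finset.sum_comm]
    rw [← Finset.sum_neg_distrib]
    refine Finset.sum_congr rfl fun i _ => ?_
    rw [← Finset.sum_neg_distrib]
    refine Finset.sum_congr rfl fun j _ => ?_
    rw [hsymm (ev j) (ev i), ← mul_assoc, ← mul_assoc, ← neg_mul,
      eq_neg_of_add_eq_zero_left (ExteriorAlgebra.ι_add_mul_swap (dx (n := n) j) (dx i))]
  have h2 := add_eq_zero_iff_eq_neg.mpr hs
  rw [← two_smul ℂ] at h2
  exact (smul_eq_zero.mp h2).resolve_left two_ne_zero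

theorem Form.d_d (φ : Form n M) : d n M (d n M φ) = 0 := by
  refine Form.ext fun x => Form.d_apply_eq_zero ?_
  have h : chartExpr (d n M φ).1 x =ᶠ[𝓝 (chartAt (Eu n) x x)] flatD (chartExpr φ.1 x) := by
    filter_upwards [(chartAt (Eu n) x).open_target.mem_nhds (mem_chart_target _ x)] with z hz
    exact chartExpr_extD φ.smooth x hz
  rw [flatD_congr h, flatD_flatD (φ.smooth.contDiffAt x (mem_chart_target _ x))]

end FormTopology

/-! ### Grading -/

section ExteriorGrading

variable {n : ℕ}

theorem lamPull_mem (D : Eu n →L[ℝ] Eu n) {k : ℕ} {x : Lam n} (hx : x ∈ ⋀[ℂ]^k (Cov n)) :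
    lamPull D x ∈ ⋀[ℂ]^k (Cov n) := by
  have h1 : (LinearMap.range (ExteriorAlgebra.ι ℂ (M := Cov n))).map (lamPull D).toLinearMap ≤
      LinearMap.range (ExteriorAlgebra.ι ℂ (M := Cov n)) := by
    rintro _ ⟨_, ⟨l, rfl⟩, rfl⟩
    exact ⟨l.comp D, (lamPull_ι D l).symm⟩
  have h2 := Submodule.mem_map_of_mem (f := (lamPull D).toLinearMap) hx
  rw [Submodule.map_pow] at h2
  exact pow_le_pow_left' h1 k h2

theorem ι_mul_comm (l : Cov n) {k : ℕ} {x : Lam n} (hx : x ∈ ⋀[ℂ]^k (Cov n)) :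
    ExteriorAlgebra.ι ℂ l * x = (-1 : ℂ) ^ k • (x * ExteriorAlgebra.ι ℂ l) := by
  induction hx using Submodule.pow_induction_on_left' with
  | algebraMap r => simp [Algebra.commutes]
  | add x y i _ _ hx hy => rw [mul_add, hx, hy, add_mul, smul_add]
  | mem_mul m hm i x _ ih =>
    obtain ⟨l', rfl⟩ := hm
    rw [← mul_assoc, eq_neg_of_add_eq_zero_left (ExteriorAlgebra.ι_add_mul_swap l l'), neg_mul,
      mul_assoc, ih, mul_smul_comm, mul_assoc, pow_succ, mul_neg_one, neg_smul]

theorem lam_mul_comm {i j : ℕ} {x y : Lam n} (hx : x ∈ ⋀[ℂ]^i (Cov n)) (hy : y ∈ ⋀[ℂ]^j (Cov n)) :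
    x * y = (-1 : ℂ) ^ (i * j) • (y * x) := by
  induction hx using Submodule.pow_induction_on_left' with
  | algebraMap r => simp [Algebra.commutes]
  | add x x' i _ _ hx hx' => rw [mul_add, add_mul, hx, hx', smul_add]
  | mem_mul m hm i x _ ih =>
    obtain ⟨l, rfl⟩ := hm
    rw [mul_assoc, ih, mul_smul_comm, ← mul_assoc, ι_mul_comm l hy, smul_mul_assoc, smul_smul,
      mul_assoc, Nat.succ_mul, pow_add]

/-- The component of degree `k`. -/
def lamProj (n k : ℕ) : Lam n →ₗ[ℂ] Lam n := GradedAlgebra.proj (fun i : ℕ => ⋀[ℂ]^i (Cov n)) k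

theorem lamProj_mem (k : ℕ) (x : Lam n) : lamProj n k x ∈ ⋀[ℂ]^k (Cov n) :=
  SetLike.coe_mem (DirectSum.decompose (fun i : ℕ => ⋀[ℂ]^i (Cov n)) x k)

theorem lamProj_of_mem {k : ℕ} {x : Lam n} (hx : x ∈ ⋀[ℂ]^k (Cov n)) : lamProj n k x = x :=
  DirectSum.decompose_of_mem_same (fun i : ℕ => ⋀[ℂ]^i (Cov n)) hx

theorem lamProj_of_mem_ne {k l : ℕ} {x : Lam n} (hx : x ∈ ⋀[ℂ]^k (Cov n)) (h : k ≠ l) :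
    lamProj n l x = 0 :=
  DirectSum.decompose_of_mem_ne (fun i : ℕ => ⋀[ℂ]^i (Cov n)) hx h

/-- The degree projections are thereby compatible with charts, so the components of a smooth form
are smooth. -/
theorem lamProj_lamPull (D : Eu n →L[ℝ] Eu n) (k : ℕ) (x : Lam n) :
    lamProj n k (lamPull D x) = lamPull D (lamProj n k x) := by
  induction x using DirectSum.Decomposition.inductionOn (fun i : ℕ => ⋀[ℂ]^i (Cov n)) with
  | zero => simp
  | @homogeneous i m =>
    by_cases h : i = k
    · subst h
      rw [lamProj_of_mem m.2, lamProj_of_mem (lamPull_mem D m.2)]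
    · rw [lamProj_of_mem_ne m.2 h, lamProj_of_mem_ne (lamPull_mem D m.2) h, map_zero]
  | add x y hx hy => simp only [map_add, hx, hy]

/-- An independent family in a finite-dimensional space has only finitely many nonzero members. The
resulting bound makes the degree decomposition of forms one finite sum, uniform over the points. -/
theorem exists_exteriorPower_eq_bot (n : ℕ) : ∃ N : ℕ, ∀ k, N ≤ k → ⋀[ℂ]^k (Cov n) = ⊥ := by
  have h := (DirectSum.Decomposition.isInternal
    (fun i : ℕ => ⋀[ℂ]^i (Cov n))).submodule_iSupIndep
  obtain ⟨N, hN⟩ := (WellFoundedGT.finite_ne_bot_of_iSupIndep h).bddAbove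
  refine ⟨N + 1, fun k hk => ?_⟩
  by_contra hne
  have := hN hne
  lia

theorem sum_lamProj {N : ℕ} (hN : ∀ k, N ≤ k → ⋀[ℂ]^k (Cov n) = ⊥) (x : Lam n) :
    ∑ k ∈ Finset.range N, lamProj n k x = x := by
  classical
  conv_rhs => rw [← DirectSum.sum_support_decompose (fun i : ℕ => ⋀[ℂ]^i (Cov n)) x]
  symm
  refine Finset.sum_subset (fun k hk => ?_) fun k _ hk => ?_
  · by_contra hk'
    have h := lamProj_mem k x
    rw [hN k (by simpa using hk')] at h
    exact (DFinsupp.mem_support_iff.1 hk) (Subtype.ext h)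
  · rw [DFinsupp.notMem_support_iff] at hk
    rw [hk]
    rfl

end ExteriorGrading

namespace Form

variable {n : ℕ} {M N : Type*} [TopologicalSpace M] [ChartedSpace (Eu n) M]
  [TopologicalSpace N] [ChartedSpace (Eu n) N]

theorem mul_comm_of_mem {i j : ℕ} {a b : Form n M} (ha : a ∈ deg n M i) (hb : b ∈ deg n M j) :
    a * b = (-1 : ℂ) ^ (i * j) • (b * a) :=
  Form.ext fun x => lam_mul_comm (ha x) (hb x)

/-- The component of degree `k` of a form. -/
def projDeg (n : ℕ) (M : Type*) [TopologicalSpace M] [ChartedSpace (Eu n) M] (k : ℕ) :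
    Form n M →ₗ[ℂ] Form n M where
  toFun φ := ⟨fun x => lamProj n k (φ x), fun p =>
    ((toRealCLM (lamProj n k)).contDiff.comp_contDiffOn (φ.smooth p)).congr fun _ _ =>
      (lamProj_lamPull _ k _).symm⟩
  map_add' _ _ := Form.ext fun _ => map_add (lamProj n k) _ _
  map_smul' _ _ := Form.ext fun _ => map_smul (lamProj n k) _ _

theorem projDeg_mem (k : ℕ) (φ : Form n M) : projDeg n M k φ ∈ deg n M k :=
  fun _ => lamProj_mem k _

theorem isInternal_deg : DirectSum.IsInternal (deg n M) := by
  obtain ⟨N, hN⟩ := exists_exteriorPower_eq_bot n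
  have : DirectSum.Decomposition (deg n M) := .ofLinearMap (deg n M)
    (∑ k ∈ Finset.range N, (DirectSum.lof ℂ ℕ (fun i => deg n M i) k) ∘ₗ
      (projDeg n M k).codRestrict (deg n M k) (projDeg_mem k))
    (by
      ext φ x
      simp only [LinearMap.comp_apply, LinearMap.sum_apply, map_sum, LinearMap.id_apply]
      refine Eq.trans ?_ (sum_lamProj hN (φ x))
      rw [sum_apply]
      refine Finset.sum_congr rfl fun k _ => ?_
      rw [DirectSum.coeLinearMap_lof]
      rfl)
    (by
      ext1 k
      ext1 φ
      simp only [LinearMap.comp_apply, LinearMap.sum_apply, LinearMap.id_apply,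
        DirectSum.coeLinearMap_lof]
      by_cases hk : k < N
      · rw [Finset.sum_eq_single k]
        · congr 1
          exact Subtype.ext (Form.ext fun x => lamProj_of_mem (φ.2 x))
        · intro j _ hj
          have e : (projDeg n M j).codRestrict (deg n M j) (projDeg_mem j) φ.1 = 0 :=
            Subtype.ext (Form.ext fun x => lamProj_of_mem_ne (φ.2 x) hj.symm)
          rw [e, map_zero]
        · simp [hk]
      · have e : φ = 0 := by
          refine Subtype.ext (Form.ext fun x => ?_)
          have h := φ.2 x
          rw [hN k (by lia)] at h
          exact h
        simp [e])
  exact DirectSum.Decomposition.isInternal _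

theorem deg_induction {p : Form n M → Prop} (hom : ∀ i, ∀ φ ∈ deg n M i, p φ)
    (add : ∀ φ ψ, p φ → p ψ → p (φ + ψ)) (φ : Form n M) : p φ := by
  have h : φ ∈ ⨆ i, deg n M i := by
    rw [isInternal_deg.submodule_iSup_eq_top]
    trivial
  exact Submodule.iSup_induction _ (motive := p) h hom (hom 0 0 (Submodule.zero_mem _)) add

theorem gradedMonoid_deg : SetLike.GradedMonoid (deg n M) where
  one_mem _ := SetLike.GradedOne.one_mem (A := fun i : ℕ => ⋀[ℂ]^i (Cov n))
  mul_mem _ _ _ _ ha hb x := SetLike.GradedMul.mul_mem (A := fun i : ℕ => ⋀[ℂ]^i (Cov n)) (ha x) (hb x)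

theorem pullback_mem [IsManifold (𝓡 n) ∞ M] [IsManifold (𝓡 n) ∞ N] {f : M → N}
    (hf : ContMDiff (𝓡 n) (𝓡 n) ∞ f) {k : ℕ} {φ : Form n N} (hφ : φ ∈ deg n N k) :
    pullback f hf φ ∈ deg n M k :=
  fun x => lamPull_mem _ (hφ (f x))

theorem chartExpr_mem {k : ℕ} {φ : Form n M} (hφ : φ ∈ deg n M k) (p : M) (y : Eu n) :
    chartExpr φ.1 p y ∈ ⋀[ℂ]^k (Cov n) := lamPull_mem _ (hφ _)

theorem differentiableAt_chartExpr (φ : Form n M) (x : M) :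
    DifferentiableAt ℝ (chartExpr φ.1 x) (chartAt (Eu n) x x) :=
  (φ.smooth.contDiffAt x (mem_chart_target _ x)).differentiableAt infty_ne_zero

variable [IsManifold (𝓡 n) ∞ M]

theorem d_mem {i : ℕ} {a : Form n M} (ha : a ∈ deg n M i) : d n M a ∈ deg n M (i + 1) := by
  intro x
  refine lamPull_mem _ (Submodule.sum_mem _ fun j _ => ?_)
  -- The coefficients are fixed by the linear projection to degree `i`. Differentiating this
  -- identity shows that their partial derivatives have degree `i` as well.
  have h1 := (toRealCLM (lamProj n i)).hasFDerivAt.comp _ (a.differentiableAt_chartExpr x).hasFDerivAt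
  have h2 : (toRealCLM (lamProj n i)) ∘ chartExpr a.1 x = chartExpr a.1 x :=
    funext fun y => lamProj_of_mem (chartExpr_mem ha x y)
  rw [h2] at h1
  rw [h1.fderiv, add_comm i 1]
  refine SetLike.GradedMul.mul_mem (A := fun i : ℕ => ⋀[ℂ]^i (Cov n)) ?_ (lamProj_mem i _)
  change _ ∈ LinearMap.range (ExteriorAlgebra.ι ℂ (M := Cov n)) ^ 1
  rw [pow_one]
  exact ⟨_, rfl⟩

theorem d_mul {i : ℕ} {a : Form n M} (ha : a ∈ deg n M i) (b : Form n M) :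
    d n M (a * b) = d n M a * b + (-1 : ℂ) ^ i • (a * d n M b) := by
  refine Form.ext fun x => ?_
  set y := chartAt (Eu n) x x
  have h1 : flatD (chartExpr (a * b).1 x) y = flatD (chartExpr a.1 x) y * chartExpr b.1 x y +
      (-1 : ℂ) ^ i • (chartExpr a.1 x y * flatD (chartExpr b.1 x) y) := by
    have e : chartExpr (a * b).1 x = fun z => chartExpr a.1 x z * chartExpr b.1 x z :=
      funext fun z => chartExpr_mul a b x z
    rw [e]
    unfold flatD
    rw [Finset.sum_mul, Finset.mul_sum, Finset.smul_sum, ← Finset.sum_add_distrib]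
    refine Finset.sum_congr rfl fun j _ => ?_
    rw [fderiv_lamMul (a.differentiableAt_chartExpr x) (b.differentiableAt_chartExpr x), mul_add,
      add_comm, mul_assoc, ← mul_assoc _ (chartExpr a.1 x y), ι_mul_comm _ (chartExpr_mem ha x y),
      smul_mul_assoc, mul_assoc]
  have e (φ : Form n M) : d n M φ x = lamPull (mfderiv (𝓡 n) (𝓡 n) (chartAt (Eu n) x) x)
      (flatD (chartExpr φ.1 x) y) := rfl
  rw [add_apply, smul_apply, mul_apply, mul_apply, e, e, e, h1, map_add, map_mul, map_smul, map_mul,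
    ← eq_lamPull_chartExpr, ← eq_lamPull_chartExpr]

theorem isTopDGAlgebra : IsTopDGAlgebra (deg n M) (d n M) where
  isCompleteLCS := isCompleteLCS
  continuous_mul := continuous_mul
  gradedMonoid := gradedMonoid_deg
  isInternal := isInternal_deg
  continuous_d := continuous_d
  d_mem _ _ ha := d_mem ha
  d_d := d_d
  d_mul _ _ ha b := d_mul ha b

theorem isTopDGMap_pullback [IsManifold (𝓡 n) ∞ N] {f : M → N} (hf : ContMDiff (𝓡 n) (𝓡 n) ∞ f) :
    IsTopDGMap (deg n N) (d n N) (deg n M) (d n M) (pullback f hf).toLinearMap where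
  continuous := continuous_pullback hf
  map_mem _ _ ha := pullback_mem hf ha
  map_d := pullback_d hf

/-- A smooth function as a form of degree `0`. -/
def ofFun (ρ : M → ℝ) (hρ : ContMDiff (𝓡 n) 𝓘(ℝ) ∞ ρ) : Form n M :=
  ⟨fun x => algebraMap ℂ (Lam n) (ρ x), fun p => by
    have h : ContDiffOn ℝ ∞ (ρ ∘ (chartAt (Eu n) p).symm) (chartAt (Eu n) p).target := fun y hy =>
      (hρ.contMDiffAt.comp y (contMDiffAt_chart_symm p hy)).contDiffAt.contDiffWithinAt
    have h' := (toRealCLM (Algebra.linearMap ℂ (Lam n))).contDiff.comp_contDiffOn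
      (Complex.ofRealCLM.contDiff.comp_contDiffOn h)
    exact h'.congr fun y _ => AlgHom.commutes (lamPull _) _⟩

@[simp] theorem ofFun_apply (ρ : M → ℝ) (hρ : ContMDiff (𝓡 n) 𝓘(ℝ) ∞ ρ) (x : M) :
    ofFun ρ hρ x = algebraMap ℂ (Lam n) (ρ x) := rfl

theorem ofFun_mem (ρ : M → ℝ) (hρ : ContMDiff (𝓡 n) 𝓘(ℝ) ∞ ρ) : ofFun ρ hρ ∈ deg n M 0 := by
  intro x
  change _ ∈ LinearMap.range (ExteriorAlgebra.ι ℂ (M := Cov n)) ^ 0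
  rw [pow_zero]
  exact Submodule.algebraMap_mem _

end Form

/-! ### Locally finite sums and cutoff functions -/

/-- Only finitely many `S i` meet a given compact set, so every partial sum over a larger index set
agrees with `w` near it, and such differences lie in the given neighbourhood of zero. Closedness of
the `S i` provides agreement near the compact set and not only on it. -/
theorem Form.hasSum_of_locallyFinite {n : ℕ} {M ι : Type*} [TopologicalSpace M]
    [ChartedSpace (Eu n) M] {φ : ι → Form n M} {w : Form n M} {S : ι → Set M}
    (hS : LocallyFinite S) (hSc : ∀ i, IsClosed (S i))
    (hw : ∀ z (s : Finset ι), (∀ i ∉ s, z ∉ S i) → ∑ i ∈ s, φ i z = w z) : HasSum φ w := by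
  rw [HasSum, SummationFilter.unconditional_filter, ← tendsto_sub_nhds_zero_iff]
  intro N hN
  obtain ⟨C, hC, hCN⟩ := Form.exists_isCompact_of_mem_nhds_zero hN
  have hfin := hS.finite_nonempty_inter_compact hC
  have hclosed : IsClosed (⋃ i : {i // i ∉ hfin.toFinset}, S i) :=
    (hS.comp_injective Subtype.val_injective).isClosed_iUnion fun i => hSc i
  refine Filter.mem_map.2 (Filter.mem_atTop_sets.2 ⟨hfin.toFinset, fun s hs => hCN _ fun x hx => ?_⟩)
  have hx' : x ∈ (⋃ i : {i // i ∉ hfin.toFinset}, S i)ᶜ := by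
    intro hmem
    obtain ⟨i, hi⟩ := mem_iUnion.1 hmem
    exact i.2 (hfin.mem_toFinset.2 ⟨x, hi, hx⟩)
  filter_upwards [hclosed.isOpen_compl.mem_nhds hx'] with z hz
  have h0 : ∀ i ∉ hfin.toFinset, z ∉ S i := fun i hi hzi =>
    hz (mem_iUnion.2 ⟨⟨i, hi⟩, hzi⟩)
  rw [Form.sub_apply, Form.sum_apply, hw z s fun i hi => h0 i fun h => hi (hs h), sub_self]

section Cutoff

variable {n : ℕ} {M : Type*} [TopologicalSpace M] [ChartedSpace (Eu n) M]

/-- Bump functions supply the claim near each point; compactness reduces it to a finite sum of them.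
-/
theorem exists_smooth_pos_of_isCompact [T2Space M] [IsManifold (𝓡 n) ∞ M] {K O : Set M}
    (hK : IsCompact K) (hO : IsOpen O) (hKO : K ⊆ O) :
    ∃ g : M → ℝ, ContMDiff (𝓡 n) 𝓘(ℝ) ∞ g ∧ (∀ x, 0 ≤ g x) ∧ HasCompactSupport g ∧
      tsupport g ⊆ O ∧ ∀ x ∈ K, 0 < g x := by
  refine hK.induction_on (p := fun K => ∃ g : M → ℝ, ContMDiff (𝓡 n) 𝓘(ℝ) ∞ g ∧ (∀ x, 0 ≤ g x) ∧
    HasCompactSupport g ∧ tsupport g ⊆ O ∧ ∀ x ∈ K, 0 < g x) ?_ ?_ ?_ ?_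
  · exact ⟨0, contMDiff_const, fun _ => le_rfl, HasCompactSupport.zero, by simp [tsupport], by simp⟩
  · rintro s t hst ⟨g, h1, h2, h3, h4, h5⟩
    exact ⟨g, h1, h2, h3, h4, fun x hx => h5 x (hst hx)⟩
  · rintro s t ⟨g, h1, h2, h3, h4, h5⟩ ⟨g', h1', h2', h3', h4', h5'⟩
    refine ⟨g + g', h1.add h1', fun x => add_nonneg (h2 x) (h2' x), h3.add h3',
      (tsupport_add g g').trans (union_subset h4 h4'), ?_⟩
    rintro x (hx | hx)
    · exact add_pos_of_pos_of_nonneg (h5 x hx) (h2' x)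
    · exact add_pos_of_nonneg_of_pos (h2 x) (h5' x hx)
  · intro x hx
    obtain ⟨f, -, hf⟩ := (SmoothBumpFunction.nhds_basis_tsupport (I := 𝓡 n) x).mem_iff.1
      (hO.mem_nhds (hKO hx))
    refine ⟨Function.support f, mem_nhdsWithin_of_mem_nhds f.support_mem_nhds,
      f, f.contMDiff, fun _ => f.nonneg, f.hasCompactSupport, hf, fun y hy => ?_⟩
    exact lt_of_le_of_ne f.nonneg (Ne.symm hy)

/-- Smooth compactly supported functions `ρᵢ` and `θᵢ` with `∑ᵢ ρᵢ θᵢ = 1`, subordinate to a family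
of open sets indexed by the points. -/
structure CutoffFamily (n : ℕ) {M : Type*} [TopologicalSpace M] [ChartedSpace (Eu n) M]
    (U : M → Set M) where
  ρ : M → M → ℝ
  θ : M → M → ℝ
  contMDiff_ρ : ∀ i, ContMDiff (𝓡 n) 𝓘(ℝ) ∞ (ρ i)
  contMDiff_θ : ∀ i, ContMDiff (𝓡 n) 𝓘(ℝ) ∞ (θ i)
  hasCompactSupport_ρ : ∀ i, HasCompactSupport (ρ i)
  tsupport_ρ_subset : ∀ i, tsupport (ρ i) ⊆ U i
  θ_eq_zero : ∀ i x, ρ i x = 0 → θ i x = 0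
  locallyFinite : LocallyFinite fun i => tsupport (ρ i)
  sum_eq : ∀ x (s : Finset M), (∀ i ∉ s, x ∉ tsupport (ρ i)) → ∑ i ∈ s, ρ i x * θ i x = 1

/-- A locally finite refinement `v` of the supports of bump functions is shrunk to a cover `w` whose
closures are compact and lie in `v`, and `gᵢ` is positive on the closure of `wᵢ` with support in
`vᵢ`. Dividing by `∑ gᵢ²` instead of `∑ gᵢ` leaves a factor `gᵢ` for each of `ρᵢ = gᵢ` and `θᵢ = gᵢ
/ Q`, so both have the same zeros. -/
theorem CutoffFamily.nonempty [T2Space M] [ParacompactSpace M] [IsManifold (𝓡 n) ∞ M]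
    {U : M → Set M} (hUo : ∀ x, IsOpen (U x)) (hU : ∀ x, x ∈ U x) :
    Nonempty (CutoffFamily n U) := by
  have h0 : ∀ x, ∃ f : SmoothBumpFunction (𝓡 n) x, tsupport f ⊆ U x := fun x => by
    obtain ⟨f, -, hf⟩ := (SmoothBumpFunction.nhds_basis_tsupport (I := 𝓡 n) x).mem_iff.1
      ((hUo x).mem_nhds (hU x))
    exact ⟨f, hf⟩
  choose f hf using h0
  obtain ⟨v, hvo, hvc, hvf, hvs⟩ := precise_refinement (fun x => Function.support (f x))
    (fun x => (f x).isOpen_support) (eq_univ_of_forall fun x => mem_iUnion.2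
      ⟨x, mem_of_mem_nhds (f x).support_mem_nhds⟩)
  obtain ⟨w, hwc, hwo, hws⟩ := exists_iUnion_eq_closure_subset hvo (fun x => hvf.point_finite x) hvc
  have hK : ∀ i, IsCompact (closure (w i)) := fun i =>
    (f i).hasCompactSupport.isCompact.of_isClosed_subset isClosed_closure
      ((hws i).trans ((hvs i).trans subset_closure))
  choose g g1 g2 g3 g4 g5 using fun i => exists_smooth_pos_of_isCompact (n := n) (hK i) (hvo i) (hws i)
  have hlf : LocallyFinite fun i => tsupport (g i) := hvf.subset g4
  have hpf : ∀ x, {i | x ∈ tsupport (g i)}.Finite := hlf.point_finite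
  have hg0 : ∀ i x, x ∉ tsupport (g i) → g i x = 0 := fun i x hx => image_eq_zero_of_notMem_tsupport hx
  let Q : M → ℝ := fun x => ∑ᶠ i, g i x * g i x
  have hQs : ContMDiff (𝓡 n) 𝓘(ℝ) ∞ Q := by
    refine contMDiff_finsum (fun i => (g1 i).mul (g1 i)) (hlf.subset fun i x hx => ?_)
    by_contra h
    exact hx (by simp [hg0 i x h])
  have hQ : ∀ x (s : Finset M), (∀ i ∉ s, x ∉ tsupport (g i)) → Q x = ∑ i ∈ s, g i x * g i x := by
    intro x s hs
    refine finsum_eq_sum_of_support_subset _ fun i hi => ?_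
    by_contra h
    exact hi (by simp [hg0 i x (hs i h)])
  have hQpos : ∀ x, 0 < Q x := by
    intro x
    rw [hQ x (hpf x).toFinset (by simp)]
    obtain ⟨i, hi⟩ := mem_iUnion.1 (hwc.symm ▸ mem_univ x : x ∈ ⋃ i, w i)
    have hpos := g5 i x (subset_closure hi)
    refine Finset.sum_pos' (fun i _ => mul_self_nonneg _) ⟨i, ?_, mul_pos hpos hpos⟩
    rw [Set.Finite.mem_toFinset]
    by_contra h
    exact hpos.ne' (hg0 i x h)
  exact ⟨{
    ρ := g
    θ := fun i x => g i x / Q x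
    contMDiff_ρ := g1
    contMDiff_θ := fun i => (g1 i).div₀ hQs fun x => (hQpos x).ne'
    hasCompactSupport_ρ := g3
    tsupport_ρ_subset := fun i => (g4 i).trans ((hvs i).trans (subset_closure.trans (hf i)))
    θ_eq_zero := fun i x h => by simp [h]
    locallyFinite := hlf
    sum_eq := fun x s hs => by
      simp only [mul_div_assoc', ← Finset.sum_div]
      rw [← hQ x s hs, div_self (hQpos x).ne'] }⟩

end Cutoff

/-! ### Pushforward along local diffeomorphisms -/

section Push

variable {n : ℕ} {P X : Type*} [TopologicalSpace P] [ChartedSpace (Eu n) P]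
  [TopologicalSpace X] [ChartedSpace (Eu n) X]

open Classical in
/-- The form on `X`, supported in the image of `W`, that corresponds to the restriction of `w` to
`W` under a local diffeomorphism `h` that is injective on `W`. -/
def push (h : P → X) (W : Set P) (w : P → Lam n) (x : X) : Lam n :=
  if hx : ∃ p ∈ W, h p = x then
    lamPull (ContinuousLinearMap.inverse
      (mfderiv (𝓡 n) (𝓡 n) h hx.choose : Eu n →L[ℝ] Eu n)) (w hx.choose)
  else 0

variable {h : P → X} {W : Set P} {w : P → Lam n}

theorem push_of_notMem {x : X} (hx : x ∉ h '' W) : push h W w x = 0 := dif_neg hx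

theorem push_apply (hinj : InjOn h W) {p : P} (hp : p ∈ W) : push h W w (h p) =
    lamPull (ContinuousLinearMap.inverse (mfderiv (𝓡 n) (𝓡 n) h p : Eu n →L[ℝ] Eu n)) (w p) := by
  have hx : ∃ q ∈ W, h q = h p := ⟨p, hp, rfl⟩
  have e : hx.choose = p := hinj hx.choose_spec.1 hp hx.choose_spec.2
  have key : ∀ q, q = p →
      lamPull (ContinuousLinearMap.inverse (mfderiv (𝓡 n) (𝓡 n) h q : Eu n →L[ℝ] Eu n)) (w q) =
      lamPull (ContinuousLinearMap.inverse (mfderiv (𝓡 n) (𝓡 n) h p : Eu n →L[ℝ] Eu n)) (w p) := by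
    rintro _ rfl
    rfl
  rw [push, dif_pos hx]
  exact key _ e

theorem push_apply_eq_zero (hinj : InjOn h W) {S : Set X} (hw : ∀ p ∈ W, h p ∉ S → w p = 0) {x : X}
    (hx : x ∉ S) : push h W w x = 0 := by
  by_cases hxW : x ∈ h '' W
  · obtain ⟨p, hp, rfl⟩ := hxW
    rw [push_apply hinj hp, hw p hp hx, map_zero]
  · exact push_of_notMem hxW

theorem mfderiv_isInvertible (hh : IsLocalDiffeomorph (𝓡 n) (𝓡 n) ∞ h) (p : P) :
    (mfderiv (𝓡 n) (𝓡 n) h p : Eu n →L[ℝ] Eu n).IsInvertible :=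
  ⟨(hh p).mfderivToContinuousLinearEquiv infty_ne_zero,
    (hh p).mfderivToContinuousLinearEquiv_coe infty_ne_zero⟩

theorem lamPull_inverse {D : Eu n →L[ℝ] Eu n} (hD : D.IsInvertible) (v : Lam n) :
    lamPull D (lamPull D.inverse v) = v := by
  rw [← lamPull_comp, hD.inverse_comp_self, lamPull_id]

theorem lamPull_inverse' {D : Eu n →L[ℝ] Eu n} (hD : D.IsInvertible) (v : Lam n) :
    lamPull D.inverse (lamPull D v) = v := by
  rw [← lamPull_comp, hD.self_comp_inverse, lamPull_id]

theorem pull_push (hh : IsLocalDiffeomorph (𝓡 n) (𝓡 n) ∞ h) (hinj : InjOn h W) {p : P}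
    (hp : p ∈ W) : pull h (push h W w) p = w p := by
  rw [pull, push_apply hinj hp, lamPull_inverse (mfderiv_isInvertible hh p)]

theorem push_eq_of_pull_eq (hh : IsLocalDiffeomorph (𝓡 n) (𝓡 n) ∞ h) (hinj : InjOn h W) {p : P}
    (hp : p ∈ W) {φ : X → Lam n} (hφ : pull h φ p = w p) : push h W w (h p) = φ (h p) := by
  rw [push_apply hinj hp, ← hφ, pull, lamPull_inverse' (mfderiv_isInvertible hh p)]

/-- A local inverse of `h` takes values in `W` near `h p`, and there the push is pullback along it.
The neighbourhood and the inverse are chosen before `w`, as `Form.smoothFamily_of_local` requires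
for families. -/
theorem push_locally_pull (hh : IsLocalDiffeomorph (𝓡 n) (𝓡 n) ∞ h) (hinj : InjOn h W)
    (hW : IsOpen W) {p : P} (hp : p ∈ W) : ∃ V ∈ 𝓝 (h p), ∃ g : X → P,
      ContMDiffOn (𝓡 n) (𝓡 n) ∞ g V ∧ ∀ w : P → Lam n, ∀ z ∈ V, push h W w z = pull g w z := by
  set g := (hh p).localInverse
  have hgs : h p ∈ g.source := (hh p).localInverse_mem_source
  have hg : ContMDiffOn (𝓡 n) (𝓡 n) ∞ g g.source := g.contMDiffOn
  have hgp : g (h p) = p := (hh p).localInverse_left_inv (hh p).localInverse_mem_target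
  have hV : IsOpen (g.source ∩ g ⁻¹' W) := hg.continuousOn.isOpen_inter_preimage g.open_source hW
  refine ⟨_, hV.mem_nhds ⟨hgs, by rwa [mem_preimage, hgp]⟩, g, hg.mono inter_subset_left, ?_⟩
  intro w z hz
  have h1 : h (g z) = z := (hh p).localInverse_right_inv hz.1
  have h2 : h ∘ g =ᶠ[𝓝 z] id := by
    filter_upwards [g.open_source.mem_nhds hz.1] with y hy
    exact (hh p).localInverse_right_inv hy
  rw [← pull_id (push h W w) z, ← pull_congr h2, pull_comp]
  · exact pull_congr_right _ (pull_push hh hinj hz.2)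
  · exact (hh (g z)).mdifferentiableAt infty_ne_zero
  · exact (hg.contMDiffAt (g.open_source.mem_nhds hz.1)).mdifferentiableAt infty_ne_zero

variable [IsManifold (𝓡 n) ∞ P] [IsManifold (𝓡 n) ∞ X]

/-- Extension by zero stays smooth: a point of `S` lies in the image of `W`, where the push is
pullback along a local inverse, and the complement of the closed set `S` is a neighbourhood of all
other points on which the push is zero. -/
theorem smoothFamily_push (hh : IsLocalDiffeomorph (𝓡 n) (𝓡 n) ∞ h) (hinj : InjOn h W)
    (hW : IsOpen W) {S : Set X} (hS : IsClosed S) (hSW : S ⊆ h '' W) {T : Type*}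
    [TopologicalSpace T] {Ψ : T → Form n P} (hΨ : Continuous Ψ)
    (h0 : ∀ t, ∀ p ∈ W, h p ∉ S → Ψ t p = 0) (q : X) (k : ℕ) :
    SmoothFamily k (chartAt (Eu n) q).target (fun t => chartExpr (push h W (Ψ t).1) q) := by
  refine Form.smoothFamily_of_local hΨ (fun x => ?_) q k
  by_cases hx : x ∈ S
  · obtain ⟨p, hp, rfl⟩ := hSW hx
    obtain ⟨V, hV, g, hg, hgV⟩ := push_locally_pull hh hinj hW hp
    exact ⟨V, hV, .inr ⟨g, hg, fun t => hgV _⟩⟩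
  · exact ⟨Sᶜ, hS.isOpen_compl.mem_nhds hx, .inl fun t z hz => push_apply_eq_zero hinj (h0 t) hz⟩

/-- Pushforward of `κ ∧ w`, where `κ` vanishes on the part of `W` that is not mapped to `S`. -/
def Form.push (hh : IsLocalDiffeomorph (𝓡 n) (𝓡 n) ∞ h) (hinj : InjOn h W)
    (hW : IsOpen W) {S : Set X} (hS : IsClosed S) (hSW : S ⊆ h '' W) (κ : Form n P)
    (hκ : ∀ p ∈ W, h p ∉ S → κ p = 0) : Form n P →ₗ[ℂ] Form n X where
  toFun w := ⟨EtaleHopf.push h W (κ * w).1, fun q =>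
    -- Smoothness of a single form is the case of a one-point parameter space.
    (smoothFamily_push hh hinj hW hS hSW (Ψ := fun _ : Unit => κ * w) continuous_const
      (fun _ p hp hpS => by rw [Form.mul_apply, hκ p hp hpS, zero_mul]) q 0).1 ()⟩
  map_add' a b := Form.ext fun x => by
    change EtaleHopf.push h W _ x = EtaleHopf.push h W _ x + EtaleHopf.push h W _ x
    by_cases hx : x ∈ h '' W
    · obtain ⟨p, hp, rfl⟩ := hx
      rw [push_apply hinj hp, push_apply hinj hp, push_apply hinj hp, mul_add, ← map_add]
      rfl
    · rw [push_of_notMem hx, push_of_notMem hx, push_of_notMem hx, add_zero]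
  map_smul' c a := Form.ext fun x => by
    change EtaleHopf.push h W _ x = c • EtaleHopf.push h W _ x
    by_cases hx : x ∈ h '' W
    · obtain ⟨p, hp, rfl⟩ := hx
      rw [push_apply hinj hp, push_apply hinj hp, mul_smul_comm, ← map_smul]
      rfl
    · rw [push_of_notMem hx, push_of_notMem hx, smul_zero]

namespace Form

variable {hh : IsLocalDiffeomorph (𝓡 n) (𝓡 n) ∞ h} {hinj : InjOn h W}
    {hW : IsOpen W} {S : Set X} {hS : IsClosed S} {hSW : S ⊆ h '' W} {κ : Form n P}
    {hκ : ∀ p ∈ W, h p ∉ S → κ p = 0}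

theorem continuous_push : Continuous (Form.push hh hinj hW hS hSW κ hκ) :=
  continuous_iff.2 fun q k => smoothFamily_push hh hinj hW hS hSW (Ψ := fun w => κ * w)
    (continuous_mul.comp (continuous_const.prodMk continuous_id))
    (fun _ p hp hpS => by rw [Form.mul_apply, hκ p hp hpS, zero_mul]) q k

theorem push_mem {k : ℕ} {w : Form n P} (hw : w ∈ deg n P k) (hκ0 : κ ∈ deg n P 0) :
    Form.push hh hinj hW hS hSW κ hκ w ∈ deg n X k := by
  intro x
  change EtaleHopf.push h W (κ * w).1 x ∈ _
  by_cases hx : x ∈ h '' W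
  · obtain ⟨p, hp, rfl⟩ := hx
    rw [push_apply hinj hp]
    refine lamPull_mem _ ?_
    have := (gradedMonoid_deg (n := n) (M := P)).mul_mem hκ0 hw
    rw [zero_add] at this
    exact this p
  · rw [push_of_notMem hx]
    exact Submodule.zero_mem _

theorem push_apply_of_notMem {w : Form n P} {x : X} (hx : x ∉ h '' W) :
    Form.push hh hinj hW hS hSW κ hκ w x = 0 := push_of_notMem hx

theorem pull_push_apply {w : Form n P} {p : P} (hp : p ∈ W) :
    EtaleHopf.pull h (Form.push hh hinj hW hS hSW κ hκ w).1 p = κ p * w p := pull_push hh hinj hp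

end Form

end Push

/-! ### Sums in complete locally convex spaces -/

/-- The tails are small uniformly in the parameter, so the partial sums converge uniformly and their
limit inherits continuity. -/
theorem exists_continuous_hasSum {ι T E : Type*} [TopologicalSpace T] [AddCommGroup E]
    [TopologicalSpace E] [IsTopologicalAddGroup E]
    (hE : @CompleteSpace E (IsTopologicalAddGroup.rightUniformSpace E)) {g : ι → T → E}
    (hg : ∀ i, Continuous (g i))
    (hv : ∀ V ∈ 𝓝 (0 : E), ∃ J : Finset ι, ∀ s : Finset ι, Disjoint s J → ∀ t, ∑ i ∈ s, g i t ∈ V) :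
    ∃ G : T → E, Continuous G ∧ ∀ t, HasSum (fun i => g i t) (G t) := by
  classical
  let := IsTopologicalAddGroup.rightUniformSpace E
  have : IsUniformAddGroup E := isUniformAddGroup_of_addCommGroup
  have hs : ∀ t, Summable fun i => g i t := fun t => summable_iff_vanishing.2 fun V hV => by
    obtain ⟨J, hJ⟩ := hv V hV
    exact ⟨J, fun s hs => hJ s hs t⟩
  refine ⟨fun t => ∑' i, g i t, ?_, fun t => (hs t).hasSum⟩
  have hu : TendstoUniformly (fun (s : Finset ι) t => ∑ i ∈ s, g i t) (fun t => ∑' i, g i t)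
      atTop := by
    intro u hu
    rw [uniformity_eq_comap_nhds_zero] at hu
    obtain ⟨V, hV, hVu⟩ := hu
    -- Closedness carries the bound to the limit of partial sums. The negation enters because
    -- subtracting a larger partial sum from a smaller one leaves minus a tail.
    obtain ⟨V', hV', hV'c, hV'V⟩ := exists_mem_nhds_isClosed_subset hV
    have hneg : Neg.neg ⁻¹' V' ∈ 𝓝 (0 : E) := continuous_neg.continuousAt.preimage_mem_nhds (by simpa)
    obtain ⟨J, hJ⟩ := hv _ hneg
    filter_upwards [eventually_ge_atTop J] with s hsJ t
    refine hVu (hV'V ?_)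
    have hlim : Tendsto (fun s' : Finset ι => (∑ i ∈ s, g i t) - ∑ i ∈ s', g i t) atTop
        (𝓝 ((∑ i ∈ s, g i t) - ∑' i, g i t)) := tendsto_const_nhds.sub (hs t).hasSum
    refine hV'c.mem_of_tendsto hlim ?_
    filter_upwards [eventually_ge_atTop s] with s' hs'
    rw [← Finset.sum_sdiff hs', sub_add_cancel_right]
    exact hJ _ (Finset.disjoint_of_subset_right hsJ Finset.sdiff_disjoint) t
  exact hu.continuous (Frequently.of_forall fun s => continuous_finsetSum s fun i _ => hg i)

/-- The sum is the average of the vectors `s.card • g i`, all of which lie in `V` by hypothesis. -/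
theorem sum_mem_of_forall_smul_mem {ι E : Type*} [AddCommGroup E] [Module ℂ E] {V : Set E}
    (hV : Convex ℝ V) (h0 : (0 : E) ∈ V) {s : Finset ι} {g : ι → E}
    (hg : ∀ i ∈ s, ∀ c : ℂ, c • g i ∈ V) : ∑ i ∈ s, g i ∈ V := by
  rcases s.eq_empty_or_nonempty with rfl | hs
  · simpa using h0
  have hc : (s.card : ℝ) ≠ 0 := by simpa using hs.ne_empty
  have e : ∑ i ∈ s, g i = ∑ i ∈ s, (s.card : ℝ)⁻¹ • (s.card : ℝ) • g i :=
    Finset.sum_congr rfl fun i _ => (inv_smul_smul₀ hc _).symm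
  rw [e]
  refine hV.sum_mem (fun _ _ => by positivity) (by simp [hc]) fun i hi => ?_
  have := hg i hi (s.card : ℝ)
  rwa [Complex.coe_smul] at this

/-! ### Forms on fibre products with a local diffeomorphism -/

section FiberProduct

variable {n : ℕ} {X Y Z P : Type*}
  [TopologicalSpace X] [ChartedSpace (Eu n) X]
  [TopologicalSpace Y] [ChartedSpace (Eu n) Y]
  [TopologicalSpace Z] [ChartedSpace (Eu n) Z]
  [TopologicalSpace P] [ChartedSpace (Eu n) P]

/-- `P` is the fibre product of a smooth map `π` and a local diffeomorphism `s`. -/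
structure IsEtaleFiberProduct (n : ℕ) {X Y Z P : Type*}
    [TopologicalSpace X] [ChartedSpace (Eu n) X] [TopologicalSpace Y] [ChartedSpace (Eu n) Y]
    [TopologicalSpace Z] [ChartedSpace (Eu n) Z] [TopologicalSpace P] [ChartedSpace (Eu n) P]
    (π : X → Z) (s : Y → Z) (p₁ : P → X) (p₂ : P → Y) : Prop where
  contMDiff_π : ContMDiff (𝓡 n) (𝓡 n) ∞ π
  isLocalDiffeomorph_s : IsLocalDiffeomorph (𝓡 n) (𝓡 n) ∞ s
  isLocalDiffeomorph_fst : IsLocalDiffeomorph (𝓡 n) (𝓡 n) ∞ p₁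
  contMDiff_snd : ContMDiff (𝓡 n) (𝓡 n) ∞ p₂
  comm : ∀ p, π (p₁ p) = s (p₂ p)
  ext : ∀ p q, p₁ p = p₁ q → p₂ p = p₂ q → p = q
  exists_point : ∀ x y, π x = s y → ∃ p, p₁ p = x ∧ p₂ p = y

/-- Open neighbourhoods of the points on which `s` is injective. -/
structure InjectiveNhds {Y Z : Type*} [TopologicalSpace Y] (s : Y → Z) (U : Y → Set Y) : Prop where
  isOpen : ∀ y, IsOpen (U y)
  mem : ∀ y, y ∈ U y
  injOn : ∀ y, InjOn s (U y)

theorem InjectiveNhds.exists_of_isLocalDiffeomorph {s : Y → Z}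
    (hs : IsLocalDiffeomorph (𝓡 n) (𝓡 n) ∞ s) : ∃ U, InjectiveNhds s U := by
  choose U h1 h2 h3 using hs.isLocalHomeomorph.isLocallyInjective
  exact ⟨U, h1, h2, h3⟩

namespace IsEtaleFiberProduct

variable {π : X → Z} {s : Y → Z} {p₁ : P → X} {p₂ : P → Y}

theorem contMDiff_fst (H : IsEtaleFiberProduct n π s p₁ p₂) : ContMDiff (𝓡 n) (𝓡 n) ∞ p₁ := H.isLocalDiffeomorph_fst.contMDiff

theorem contMDiff_s (H : IsEtaleFiberProduct n π s p₁ p₂) : ContMDiff (𝓡 n) (𝓡 n) ∞ s := H.isLocalDiffeomorph_s.contMDiff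

/-- Equal first projections force equal images of the second projections under `s`, which is
injective on `W`. -/
theorem injOn_fst (H : IsEtaleFiberProduct n π s p₁ p₂)
    {W : Set Y} (hW : InjOn s W) : InjOn p₁ (p₂ ⁻¹' W) := fun p hp q hq h =>
  H.ext p q h (hW hp hq (by rw [← H.comm, ← H.comm, h]))

variable {U : Y → Set Y}

/-- The smooth function `θᵢ` as a form. -/
def cutoff [IsManifold (𝓡 n) ∞ Y] (c : CutoffFamily n U) (i : Y) : Form n Y :=
  Form.ofFun (c.θ i) (c.contMDiff_θ i)

/-- Only finitely many cutoff functions matter for the values of a continuous multilinear map in a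
given neighbourhood of zero. -/
theorem exists_finset_forall_sum_mem [IsManifold (𝓡 n) ∞ Y] (c : CutoffFamily n U) {C E : Type*} [AddCommGroup C] [Module ℂ C]
    [TopologicalSpace C] [ContinuousSMul ℂ C] [AddCommGroup E] [Module ℂ E] [TopologicalSpace E]
    [IsTopologicalAddGroup E] [ContinuousSMul ℂ E] [LocallyConvexSpace ℝ E]
    (f : Form n X →ₗ[ℂ] Form n Y →ₗ[ℂ] C →ₗ[ℂ] E)
    (hf : Continuous fun q : Form n X × Form n Y × C => f q.1 q.2.1 q.2.2) {V : Set E}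
    (hV : V ∈ 𝓝 0) : ∃ J : Finset Y, ∀ t : Finset Y, Disjoint t J →
      ∀ (x : Y → Form n X) (z : C), ∑ i ∈ t, f (x i) (cutoff c i) z ∈ V := by
  obtain ⟨V', hV', hconv, hV'V⟩ := locallyConvexSpace_iff_exists_convex_subset_zero ℝ E |>.1
    inferInstance V hV
  have h1 : (fun q : Form n X × Form n Y × C => f q.1 q.2.1 q.2.2) ⁻¹' V' ∈ 𝓝 (0, 0, 0) :=
    hf.continuousAt.preimage_mem_nhds (by simpa using hV')
  rw [mem_nhds_prod_iff] at h1
  obtain ⟨N₁, hN₁, N', hN', hsub⟩ := h1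
  rw [mem_nhds_prod_iff] at hN'
  obtain ⟨N₂, hN₂, N₃, hN₃, hsub'⟩ := hN'
  -- By local finiteness only finitely many supports meet `K`; for the other indices all multiples
  -- of `θᵢ` vanish near `K` and so belong to `N₂`.
  obtain ⟨K, hK, hKN⟩ := Form.exists_isCompact_of_mem_nhds_zero hN₂
  have hfin := c.locallyFinite.finite_nonempty_inter_compact hK
  refine ⟨hfin.toFinset, fun t ht x z => hV'V ?_⟩
  refine sum_mem_of_forall_smul_mem hconv (mem_of_mem_nhds hV') fun i hi r => ?_
  have hiK : ∀ y ∈ K, y ∉ tsupport (c.ρ i) := fun y hy hyi =>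
    Finset.disjoint_left.1 ht hi (hfin.mem_toFinset.2 ⟨y, hyi, hy⟩)
  have hcut : ∀ r : ℂ, r • cutoff c i ∈ N₂ := by
    refine fun r => hKN _ fun y hy => ?_
    filter_upwards [(isClosed_tsupport _).isOpen_compl.mem_nhds (hiK y hy)] with v hv
    have : c.θ i v = 0 := c.θ_eq_zero i v (image_eq_zero_of_notMem_tsupport hv)
    simp [cutoff, this]
  have hx0 : ∀ᶠ ε : ℂ in 𝓝[≠] 0, ε • x i ∈ N₁ := by
    refine nhdsWithin_le_nhds ?_
    have : Continuous fun ε : ℂ => ε • x i := continuous_id.smul continuous_const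
    exact this.continuousAt.preimage_mem_nhds (by simpa using hN₁)
  have hz0 : ∀ᶠ ε : ℂ in 𝓝[≠] 0, ε • z ∈ N₃ := by
    refine nhdsWithin_le_nhds ?_
    have : Continuous fun ε : ℂ => ε • z := continuous_id.smul continuous_const
    exact this.continuousAt.preimage_mem_nhds (by simpa using hN₃)
  -- The factor `ε` moves `x i` into `N₁` and `z` into `N₃`, and the compensating `r / ε²` is
  -- harmless on `θᵢ`. This is why the exceptional set depends on neither `x` nor `z`.
  obtain ⟨ε, ⟨hε1, hε2⟩, hε0⟩ := ((hx0.and hz0).and self_mem_nhdsWithin).exists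
  have h2 : f (ε • x i) ((r / (ε * ε)) • cutoff c i) (ε • z) ∈ V' :=
    hsub (mk_mem_prod hε1 (hsub' (mk_mem_prod (hcut _) hε2)))
  have hε0' : ε ≠ 0 := hε0
  have e : r • f (x i) (cutoff c i) z = f (ε • x i) ((r / (ε * ε)) • cutoff c i) (ε • z) := by
    simp only [map_smul, LinearMap.smul_apply, smul_smul]
    congr 1
    field_simp
  rw [e]
  exact h2

variable [IsManifold (𝓡 n) ∞ X] [IsManifold (𝓡 n) ∞ Y] [IsManifold (𝓡 n) ∞ Z]
  [IsManifold (𝓡 n) ∞ P] (H : IsEtaleFiberProduct n π s p₁ p₂)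

/-- The form `pr₁^* a ∧ pr₂^* a'` on the fibre product. -/
def ten : Form n X →ₗ[ℂ] Form n Y →ₗ[ℂ] Form n P :=
  (LinearMap.mul ℂ (Form n P)).compl₁₂
    (Form.pullback _ H.contMDiff_fst).toLinearMap (Form.pullback _ H.contMDiff_snd).toLinearMap

theorem ten_apply (a : Form n X) (a' : Form n Y) :
    H.ten a a' = Form.pullback _ H.contMDiff_fst a * Form.pullback _ H.contMDiff_snd a' := rfl

theorem continuous_ten : Continuous fun q : Form n X × Form n Y => H.ten q.1 q.2 :=
  Form.continuous_mul.comp (((Form.continuous_pullback H.contMDiff_fst).comp continuous_fst).prodMk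
    ((Form.continuous_pullback H.contMDiff_snd).comp continuous_snd))

theorem pullback_pullback (b : Form n Z) :
    Form.pullback _ H.contMDiff_fst (Form.pullback _ H.contMDiff_π b) =
      Form.pullback _ H.contMDiff_snd (Form.pullback _ H.contMDiff_s b) := by
  rw [Form.pullback_pullback, Form.pullback_pullback]
  exact Form.pullback_congr _ _ H.comm b

theorem ten_balanced (a : Form n X) (b : Form n Z) (a' : Form n Y) :
    H.ten (a * Form.pullback _ H.contMDiff_π b) a' =
      H.ten a (Form.pullback _ H.contMDiff_s b * a') := by
  rw [ten_apply, ten_apply, map_mul, map_mul, H.pullback_pullback, mul_assoc]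

variable [T2Space Z] (hU : InjectiveNhds s U) (c : CutoffFamily n U)

/-- Pushforward to the base of the restriction of `ρᵢ a` to `Uᵢ`. -/
def pushBase (i : Y) : Form n Y →ₗ[ℂ] Form n Z :=
  Form.push H.isLocalDiffeomorph_s (hU.injOn i) (hU.isOpen i)
    (S := s '' tsupport (c.ρ i))
    -- The image of the support is compact, hence closed in the Hausdorff base; this is where
    -- compact supports are needed.
    (((c.hasCompactSupport_ρ i).isCompact.image H.contMDiff_s.continuous).isClosed)
    (image_mono (c.tsupport_ρ_subset i)) (Form.ofFun (c.ρ i) (c.contMDiff_ρ i)) (by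
      intro y _ hy
      have : c.ρ i y = 0 := image_eq_zero_of_notMem_tsupport fun h => hy (mem_image_of_mem s h)
      simp [this])

/-- Pushforward along the first projection of the restriction of `ρᵢ w` to the part of the fibre
product that lies over `Uᵢ`. -/
def pushFst (i : Y) : Form n P →ₗ[ℂ] Form n X :=
  Form.push H.isLocalDiffeomorph_fst (H.injOn_fst (hU.injOn i))
    ((hU.isOpen i).preimage H.contMDiff_snd.continuous) (S := π ⁻¹' (s '' tsupport (c.ρ i)))
    (((c.hasCompactSupport_ρ i).isCompact.image H.contMDiff_s.continuous).isClosed.preimage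
      H.contMDiff_π.continuous)
    (by
      rintro x ⟨y, hy, hyx⟩
      obtain ⟨p, rfl, rfl⟩ := H.exists_point x y hyx.symm
      exact ⟨p, c.tsupport_ρ_subset i hy, rfl⟩)
    (Form.ofFun (c.ρ i ∘ p₂) ((c.contMDiff_ρ i).comp H.contMDiff_snd)) (by
      intro p _ hp
      have : c.ρ i (p₂ p) = 0 := image_eq_zero_of_notMem_tsupport fun h =>
        hp (by rw [mem_preimage, H.comm]; exact mem_image_of_mem s h)
      simp [this])

theorem pullback_pushBase_apply {i : Y} (a : Form n Y) {y : Y} (hy : y ∈ U i) :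
    Form.pullback _ H.contMDiff_s (H.pushBase hU c i a) y =
      algebraMap ℂ (Lam n) (c.ρ i y) * a y := Form.pull_push_apply hy

theorem pullback_pushFst_apply {i : Y} (w : Form n P) {p : P} (hp : p₂ p ∈ U i) :
    Form.pullback _ H.contMDiff_fst (H.pushFst hU c i w) p =
      algebraMap ℂ (Lam n) (c.ρ i (p₂ p)) * w p := Form.pull_push_apply (W := p₂ ⁻¹' U i) hp

theorem pushFst_apply_of_notMem {i : Y} (w : Form n P) {x : X} (hx : x ∉ p₁ '' (p₂ ⁻¹' U i)) :
    H.pushFst hU c i w x = 0 := push_of_notMem hx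

/-- This is base change: pushing `ρᵢ a'` from the fibre product along `p₁` agrees with pushing it
along `s` and pulling back along `π`, while `a` comes from `X` and leaves the push as a factor. Over
`Uᵢ` it is enough to compare pullbacks along `p₁`; outside the image both sides vanish. -/
theorem pushFst_ten (i : Y) (a : Form n X) (a' : Form n Y) :
    H.pushFst hU c i (H.ten a a') =
      a * Form.pullback _ H.contMDiff_π (H.pushBase hU c i a') := by
  refine Form.ext fun x => ?_
  by_cases hx : x ∈ p₁ '' (p₂ ⁻¹' U i)
  · obtain ⟨p, hp, rfl⟩ := hx
    have e : Form.pullback _ H.contMDiff_snd (Form.pullback _ H.contMDiff_s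
        (H.pushBase hU c i a')) p = algebraMap ℂ (Lam n) (c.ρ i (p₂ p)) *
          Form.pullback _ H.contMDiff_snd a' p := by
      have e1 := pull_congr_right p₂ (ψ := fun y => algebraMap ℂ (Lam n) (c.ρ i y) * a' y)
        (H.pullback_pushBase_apply hU c a' hp)
      rw [Form.pullback_apply, e1, pull, map_mul, AlgHom.commutes]
      rfl
    have key : Form.pullback _ H.contMDiff_fst (a * Form.pullback _ H.contMDiff_π
        (H.pushBase hU c i a')) p =
        algebraMap ℂ (Lam n) (c.ρ i (p₂ p)) * H.ten a a' p := by
      rw [map_mul, H.pullback_pullback, Form.mul_apply, e, ten_apply, Form.mul_apply,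
        ← mul_assoc, ← Algebra.commutes, mul_assoc]
    exact push_eq_of_pull_eq H.isLocalDiffeomorph_fst (H.injOn_fst (hU.injOn i)) hp key
  · rw [H.pushFst_apply_of_notMem hU c _ hx]
    have h0 : H.pushBase hU c i a' (π x) = 0 := by
      refine Form.push_apply_of_notMem ?_
      rintro ⟨y, hy, hyx⟩
      obtain ⟨p, rfl, rfl⟩ := H.exists_point x y hyx.symm
      exact hx ⟨p, hy, rfl⟩
    have h1 : Form.pullback _ H.contMDiff_π (H.pushBase hU c i a') x = 0 := by
      rw [Form.pullback_apply, pull, h0, map_zero]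
    rw [Form.mul_apply, h1, mul_zero]

/-- On `Uᵢ` the pullback undoes the push. Elsewhere the pulled back form need not vanish, because
`s` may have other points in its fibres, and the factor `θᵢ` is there to remove it. -/
theorem pullback_pushBase_mul_cutoff_apply (i : Y) (a : Form n Y) (y : Y) :
    (Form.pullback _ H.contMDiff_s (H.pushBase hU c i a) * cutoff c i) y =
      ((c.ρ i y * c.θ i y : ℝ) : ℂ) • a y := by
  rw [Form.mul_apply, cutoff, Form.ofFun_apply, ← Algebra.commutes, ← Algebra.smul_def]
  by_cases hy : y ∈ U i
  · rw [H.pullback_pushBase_apply hU c a hy, ← Algebra.smul_def, smul_smul, Complex.ofReal_mul, mul_comm]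
  · have h0 : c.ρ i y = 0 :=
      image_eq_zero_of_notMem_tsupport fun h => hy (c.tsupport_ρ_subset i h)
    simp [h0, c.θ_eq_zero i y h0]

theorem ten_pushFst_cutoff_apply (i : Y) (w : Form n P) (p : P) :
    H.ten (H.pushFst hU c i w) (cutoff c i) p =
      ((c.ρ i (p₂ p) * c.θ i (p₂ p) : ℝ) : ℂ) • w p := by
  have e0 : Form.pullback _ H.contMDiff_snd (cutoff c i) p =
      algebraMap ℂ (Lam n) (c.θ i (p₂ p)) := AlgHom.commutes (lamPull _) _
  rw [ten_apply, Form.mul_apply, e0, ← Algebra.commutes, ← Algebra.smul_def]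
  by_cases hy : p₂ p ∈ U i
  · rw [H.pullback_pushFst_apply hU c w hy, ← Algebra.smul_def, smul_smul, Complex.ofReal_mul, mul_comm]
  · have h0 : c.ρ i (p₂ p) = 0 :=
      image_eq_zero_of_notMem_tsupport fun h => hy (c.tsupport_ρ_subset i h)
    simp [h0, c.θ_eq_zero i _ h0]

theorem hasSum_mul_cutoff (a : Form n Y) : HasSum
    (fun i => Form.pullback _ H.contMDiff_s (H.pushBase hU c i a) * cutoff c i) a := by
  refine Form.hasSum_of_locallyFinite c.locallyFinite (fun i => isClosed_tsupport _)
    fun z t ht => ?_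
  simp only [H.pullback_pushBase_mul_cutoff_apply hU c]
  rw [← Finset.sum_smul, ← Complex.ofReal_sum, c.sum_eq z t ht, Complex.ofReal_one, one_smul]

/-- Every form on the fibre product is a sum of decomposable ones. -/
theorem hasSum_ten (w : Form n P) :
    HasSum (fun i => H.ten (H.pushFst hU c i w) (cutoff c i)) w := by
  refine Form.hasSum_of_locallyFinite
    (c.locallyFinite.preimage_continuous H.contMDiff_snd.continuous)
    (fun i => (isClosed_tsupport _).preimage H.contMDiff_snd.continuous) fun z t ht => ?_
  simp only [H.ten_pushFst_cutoff_apply hU c]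
  rw [← Finset.sum_smul, ← Complex.ofReal_sum, c.sum_eq (p₂ z) t ht, Complex.ofReal_one, one_smul]

/-- Existence part of the universal property of forms on fibre products, with a parameter. -/
theorem exists_lift [T2Space Y] [ParacompactSpace Y] {C E : Type*} [AddCommGroup C] [Module ℂ C]
    [TopologicalSpace C] [ContinuousSMul ℂ C] [AddCommGroup E] [Module ℂ E] [TopologicalSpace E]
    (hE : IsCompleteLCS E) (f : Form n X →ₗ[ℂ] Form n Y →ₗ[ℂ] C →ₗ[ℂ] E)
    (hf : Continuous fun q : Form n X × Form n Y × C => f q.1 q.2.1 q.2.2)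
    (hb : ∀ a b a', f (a * Form.pullback _ H.contMDiff_π b) a' =
      f a (Form.pullback _ H.contMDiff_s b * a')) :
    ∃ F : Form n P →ₗ[ℂ] C →ₗ[ℂ] E, (Continuous fun q : Form n P × C => F q.1 q.2) ∧
      ∀ a a', F (H.ten a a') = f a a' := by
  obtain ⟨U, hU⟩ := InjectiveNhds.exists_of_isLocalDiffeomorph H.isLocalDiffeomorph_s
  obtain ⟨c⟩ := CutoffFamily.nonempty (n := n) hU.isOpen hU.mem
  have := hE.isTopologicalAddGroup
  have := hE.continuousSMul
  have := hE.locallyConvexSpace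
  have := hE.t2Space
  -- The candidate applies `f` term by term to the expansion of `hasSum_ten`; the uniform bound on
  -- tails gives convergence and joint continuity in the form and the parameter.
  obtain ⟨G, hG, hsum⟩ := exists_continuous_hasSum hE.completeSpace
    (g := fun (i : Y) (q : Form n P × C) => f (H.pushFst hU c i q.1) (cutoff c i) q.2)
    (fun i => hf.comp ((Form.continuous_push.comp continuous_fst).prodMk
      (continuous_const.prodMk continuous_snd)))
    (fun V hV => by
      obtain ⟨J, hJ⟩ := exists_finset_forall_sum_mem c f hf hV
      exact ⟨J, fun t ht q => hJ t ht _ _⟩)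
  -- Linearity and the values on decomposable forms all follow from uniqueness of sums.
  have huniq : ∀ q y, HasSum (fun i => f (H.pushFst hU c i q.1) (cutoff c i) q.2) y → G q = y :=
    fun q y h => (hsum q).unique h
  refine ⟨LinearMap.mk₂ ℂ (fun w z => G (w, z)) (fun w w' z => huniq _ _ ?_)
    (fun r w z => huniq _ _ ?_) (fun w z z' => huniq _ _ ?_) (fun r w z => huniq _ _ ?_), hG,
    fun a a' => LinearMap.ext fun z => huniq _ _ ?_⟩
  · simpa using (hsum (w, z)).add (hsum (w', z))
  · simpa using (hsum (w, z)).const_smul r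
  · simpa using (hsum (w, z)).add (hsum (w, z'))
  · simpa using (hsum (w, z)).const_smul r
  -- On `a ⊗ a'` the balance condition moves the pushed part of `a'` into the second argument, where
  -- the terms add up to `a'` by `hasSum_mul_cutoff`.
  · have hcont : Continuous fun a'' : Form n Y => f a a'' z :=
      hf.comp (continuous_const.prodMk (continuous_id.prodMk continuous_const))
    have h := (H.hasSum_mul_cutoff hU c a').map ((f a).flip z) hcont
    refine Eq.mp (congrArg (fun g => HasSum g _) (funext fun i => ?_)) h
    change f a _ z = f _ _ z
    rw [H.pushFst_ten, hb]

/-- A continuous linear map on the fibre product is determined by its values on decomposable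
forms. -/
theorem eq_of_ten [T2Space Y] [ParacompactSpace Y] {E : Type*} [AddCommGroup E] [Module ℂ E]
    [TopologicalSpace E] [T2Space E] {F F' : Form n P →ₗ[ℂ] E} (hF : Continuous F)
    (hF' : Continuous F') (h : ∀ a a', F (H.ten a a') = F' (H.ten a a')) : F = F' := by
  obtain ⟨U, hU⟩ := InjectiveNhds.exists_of_isLocalDiffeomorph H.isLocalDiffeomorph_s
  obtain ⟨c⟩ := CutoffFamily.nonempty (n := n) hU.isOpen hU.mem
  refine LinearMap.ext fun w => ?_
  have h1 := (H.hasSum_ten hU c w).map F hF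
  have h2 := (H.hasSum_ten hU c w).map F' hF'
  refine h1.unique ?_
  convert h2 using 1
  ext i
  exact h _ _

theorem mem_closure_span_ten [T2Space Y] [ParacompactSpace Y] {k : ℕ} {w : Form n P}
    (hw : w ∈ Form.deg n P k) : w ∈ closure (Submodule.span ℂ {x | ∃ i j, i + j = k ∧
      ∃ a ∈ Form.deg n X i, ∃ a' ∈ Form.deg n Y j, x = H.ten a a'} : Set (Form n P)) := by
  obtain ⟨U, hU⟩ := InjectiveNhds.exists_of_isLocalDiffeomorph H.isLocalDiffeomorph_s
  obtain ⟨c⟩ := CutoffFamily.nonempty (n := n) hU.isOpen hU.mem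
  refine mem_closure_of_tendsto (H.hasSum_ten hU c w) (Eventually.of_forall fun t => ?_)
  -- Pushing preserves the degree and `θᵢ` is a function, so each term of the expansion has bidegree
  -- `(k, 0)`.
  exact Submodule.sum_mem _ fun i _ => Submodule.subset_span ⟨k, 0, add_zero k, _,
    Form.push_mem hw (Form.ofFun_mem _ _), _, Form.ofFun_mem _ _, rfl⟩

end IsEtaleFiberProduct

end FiberProduct

/-! ### Fibre products of composable arrows -/

/-- The charts of `X` are charts of `M` composed with `π`. Read in them, a local inverse of `π` is a
chart of `M` and hence smooth. -/
theorem etale_isLocalDiffeomorph {n : ℕ} {X M : Type*} [TopologicalSpace X] [TopologicalSpace M]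
    [ChartedSpace (Eu n) M] [IsManifold (𝓡 n) ∞ M] (π : X → M) (h : IsLocalHomeomorph π) :
    @IsLocalDiffeomorph ℝ _ _ _ _ _ _ _ _ _ _ _ (𝓡 n) (𝓡 n) X _ (etaleChartedSpace π h) M _ _ ∞
      π := by
  let := etaleChartedSpace (n := n) π h
  have := etaleIsManifold (n := n) π h
  intro x
  obtain ⟨e, hx, he⟩ := h x
  refine ⟨{ e.toPartialEquiv with
            open_source := e.open_source
            open_target := e.open_target
            contMDiffOn_toFun := (etale_contMDiff π h).contMDiffOn.congr fun z _ => congrFun he.symm z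
            contMDiffOn_invFun := fun y hy => ContMDiffAt.contMDiffWithinAt ?_ }, hx,
    fun z _ => congrFun he z⟩
  have hπ : ∀ z ∈ e.target, π (e.symm z) = z := fun z hz => by rw [he]; exact e.right_inv hz
  refine contMDiffAt_iff_target.2 ⟨e.continuousAt_symm hy, ?_⟩
  refine (contMDiffAt_chart (π (e.symm y)) (x := y) ?_).congr_of_eventuallyEq ?_
  · rw [hπ y hy]
    exact mem_chart_source _ y
  · filter_upwards [e.open_target.mem_nhds hy] with z hz
    change chartAt (Eu n) (π (e.symm y)) ((h.localInverseAt (e.symm y)).symm (e.symm z)) = _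
    rw [h.localInverseAt_symm, hπ z hz]

/-! ### The universal property without parameter, and products of decomposable forms. -/

namespace IsEtaleFiberProduct

variable {n : ℕ} {X Y Z P : Type*}
  [TopologicalSpace X] [ChartedSpace (Eu n) X] [TopologicalSpace Y] [ChartedSpace (Eu n) Y]
  [TopologicalSpace Z] [ChartedSpace (Eu n) Z] [TopologicalSpace P] [ChartedSpace (Eu n) P]
  [IsManifold (𝓡 n) ∞ X] [IsManifold (𝓡 n) ∞ Y] [IsManifold (𝓡 n) ∞ Z] [IsManifold (𝓡 n) ∞ P]
  {π : X → Z} {s : Y → Z} {p₁ : P → X} {p₂ : P → Y} (H : IsEtaleFiberProduct n π s p₁ p₂)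

/-- The universal property of the forms on a fibre product. -/
theorem existsUnique_lift [T2Space Z] [T2Space Y] [ParacompactSpace Y] {E : Type*}
    [AddCommGroup E] [Module ℂ E] [TopologicalSpace E]
    (hE : IsCompleteLCS E) (f : Form n X →ₗ[ℂ] Form n Y →ₗ[ℂ] E)
    (hf : Continuous fun q : Form n X × Form n Y => f q.1 q.2)
    (hb : ∀ a b a', f (a * Form.pullback _ H.contMDiff_π b) a' =
      f a (Form.pullback _ H.contMDiff_s b * a')) :
    ∃! F : Form n P →L[ℂ] E, ∀ a a', F (H.ten a a') = f a a' := by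
  have := hE.continuousSMul
  have := hE.t2Space
  -- The parameter space is `ℂ`, acting by scalars on the values of `f`; the lift is evaluated at
  -- `1`.
  obtain ⟨F, hF, hFt⟩ := H.exists_lift hE (f.compr₂ (LinearMap.lsmul ℂ E).flip)
    (continuous_snd.comp continuous_snd |>.smul
      (hf.comp (continuous_fst.prodMk (continuous_fst.comp continuous_snd))))
    (fun a b a' => by simp only [LinearMap.compr₂_apply, hb])
  refine ⟨⟨F.flip 1, hF.comp (continuous_id.prodMk continuous_const)⟩, fun a a' => ?_,
    fun F' hF' => ?_⟩
  · exact (DFunLike.congr_fun (hFt a a') 1).trans (one_smul ℂ _)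
  · refine ContinuousLinearMap.coe_injective (H.eq_of_ten F'.continuous
      (hF.comp (continuous_id.prodMk continuous_const)) fun a a' => (hF' a a').trans ?_)
    exact ((DFunLike.congr_fun (hFt a a') 1).trans (one_smul ℂ _)).symm

theorem continuous_ten_comp {W : Type*} [TopologicalSpace W] {f : W → Form n X} {g : W → Form n Y}
    (hf : Continuous f) (hg : Continuous g) : Continuous fun w => H.ten (f w) (g w) :=
  H.continuous_ten.comp (hf.prodMk hg)

theorem ten_mul_ten {i j : ℕ} {a' : Form n Y} (ha' : a' ∈ Form.deg n Y i) {b : Form n X}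
    (hb : b ∈ Form.deg n X j) (a : Form n X) (b' : Form n Y) :
    H.ten a a' * H.ten b b' = (-1 : ℂ) ^ (i * j) • H.ten (a * b) (a' * b') := by
  simp only [ten_apply, map_mul]
  rw [mul_assoc, ← mul_assoc _ _ (Form.pullback _ _ b'),
    Form.mul_comm_of_mem (Form.pullback_mem H.contMDiff_snd ha')
      (Form.pullback_mem H.contMDiff_fst hb)]
  simp only [smul_mul_assoc, mul_smul_comm, mul_assoc]

end IsEtaleFiberProduct

theorem neg_one_pow_smul_smul {E : Type*} [AddCommGroup E] [Module ℂ E] (k : ℕ) (x : E) :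
    (-1 : ℂ) ^ k • (-1 : ℂ) ^ k • x = x := by
  rw [smul_smul, ← mul_pow]
  simp

namespace Form

variable {n : ℕ} {M N : Type*} [TopologicalSpace M] [ChartedSpace (Eu n) M]
  [TopologicalSpace N] [ChartedSpace (Eu n) N]

/-- Pullback as a continuous linear map. -/
def pullbackL [IsManifold (𝓡 n) ∞ M] [IsManifold (𝓡 n) ∞ N] {f : M → N}
    (hf : ContMDiff (𝓡 n) (𝓡 n) ∞ f) : Form n N →L[ℂ] Form n M :=
  ⟨(pullback f hf).toLinearMap, continuous_pullback hf⟩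

/-- Multiplication on the left as a continuous linear map. -/
def mulLeftL (a : Form n M) : Form n M →L[ℂ] Form n M :=
  ⟨LinearMap.mulLeft ℂ a, continuous_mul.comp (continuous_const.prodMk continuous_id)⟩

/-- Multiplication on the right as a continuous linear map. -/
def mulRightL (a : Form n M) : Form n M →L[ℂ] Form n M :=
  ⟨LinearMap.mulRight ℂ a, continuous_mul.comp (continuous_id.prodMk continuous_const)⟩

theorem mul_comm_of_mem' {i j : ℕ} {a b : Form n M} (ha : a ∈ deg n M i) (hb : b ∈ deg n M j) :
    (-1 : ℂ) ^ (i * j) • (a * b) = b * a := by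
  rw [mul_comm_of_mem ha hb, neg_one_pow_smul_smul]

end Form

/-! ### The groupoid -/

namespace EtaleQuiver

variable {n : ℕ} {G₁ G₀ M : Type*} [TopologicalSpace G₁] [ChartedSpace (Eu n) G₁]
  [TopologicalSpace G₀] [ChartedSpace (Eu n) G₀] [TopologicalSpace M] [ChartedSpace (Eu n) M]
  (Q : EtaleQuiver n G₁ G₀)

/-- The map into the space of composable pairs with given components. -/
def pair (x y : M → G₁) (h : ∀ m, Q.target (x m) = Q.source (y m)) (m : M) : Q.Comp₂ :=
  .mk (x m) (y m) (h m)

variable [IsManifold (𝓡 n) ∞ G₁] [IsManifold (𝓡 n) ∞ G₀]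

theorem isEtaleFiberProduct₂ : IsEtaleFiberProduct n Q.target Q.source
    (FiberProd.fst : Q.Comp₂ → G₁) (FiberProd.snd : Q.Comp₂ → G₁) where
  contMDiff_π := Q.contMDiff_target
  isLocalDiffeomorph_s := Q.isLocalDiffeomorph_source
  isLocalDiffeomorph_fst := etale_isLocalDiffeomorph _ Q.isLocalHomeomorph_fst₂
  contMDiff_snd := Q.contMDiff_snd₂
  comm := FiberProd.comm
  ext _ _ h h' := Subtype.ext (Prod.ext h h')
  exists_point x y h := ⟨.mk x y h, rfl, rfl⟩

theorem isEtaleFiberProduct₃ : IsEtaleFiberProduct n (fun p : Q.Comp₂ => Q.target p.snd) Q.source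
    (FiberProd.fst : Q.Comp₃ → Q.Comp₂) (FiberProd.snd : Q.Comp₃ → G₁) where
  contMDiff_π := Q.contMDiff_target.comp Q.contMDiff_snd₂
  isLocalDiffeomorph_s := Q.isLocalDiffeomorph_source
  isLocalDiffeomorph_fst := etale_isLocalDiffeomorph _ Q.isLocalHomeomorph_fst₃
  contMDiff_snd := Q.contMDiff_snd₃
  comm := FiberProd.comm
  ext _ _ h h' := Subtype.ext (Prod.ext h h')
  exists_point x y h := ⟨.mk x y h, rfl, rfl⟩

/-- The first projection is a local diffeomorphism and its composition with the pair is `x`, so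
smoothness follows from that of `x` once the pair is continuous. -/
theorem contMDiff_pair {x y : M → G₁} (hx : ContMDiff (𝓡 n) (𝓡 n) ∞ x)
    (hy : ContMDiff (𝓡 n) (𝓡 n) ∞ y) (h : ∀ m, Q.target (x m) = Q.source (y m)) :
    ContMDiff (𝓡 n) (𝓡 n) ∞ (Q.pair x y h) :=
  contMDiff_of_comp_localDiffeo (etale_isLocalDiffeomorph _ Q.isLocalHomeomorph_fst₂)
    ((hx.continuous.prodMk hy.continuous).subtype_mk _) hx

/-- This computes on decomposable forms the maps out of `A ⊗_B A` that are pullbacks along pairs of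
arrows. -/
theorem pullback_pair_ten [IsManifold (𝓡 n) ∞ M] {x y : M → G₁} (hx : ContMDiff (𝓡 n) (𝓡 n) ∞ x)
    (hy : ContMDiff (𝓡 n) (𝓡 n) ∞ y) (h : ∀ m, Q.target (x m) = Q.source (y m))
    (a a' : Form n G₁) : Form.pullback _ (Q.contMDiff_pair hx hy h)
      (Q.isEtaleFiberProduct₂.ten a a') = Form.pullback x hx a * Form.pullback y hy a' := by
  rw [IsEtaleFiberProduct.ten_apply, map_mul, Form.pullback_pullback, Form.pullback_pullback]
  rfl

end EtaleQuiver

namespace EtaleGroupoid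

/-! ### Identities of arrows in the groupoid. -/

section Algebraic

variable {n : ℕ} {G₁ G₀ : Type*} [TopologicalSpace G₁] [ChartedSpace (Eu n) G₁]
  [TopologicalSpace G₀] [ChartedSpace (Eu n) G₀] (G : EtaleGroupoid n G₁ G₀)

/-- The proof of composability depends on the arrows, so factors cannot simply be rewritten inside a
product. -/
theorem mul_congr {x x' y y' : G₁} (hx : x = x') (hy : y = y')
    (h : G.quiver.target x = G.quiver.source y) (h' : G.quiver.target x' = G.quiver.source y') :
    G.mul (.mk x y h) = G.mul (.mk x' y' h') := by
  subst hx hy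
  rfl

theorem eq_inv_of_mul_eq {x y : G₁} (h : G.quiver.target x = G.quiver.source y)
    (hxy : G.mul (.mk x y h) = G.unit (G.quiver.source x)) : y = G.inv x := by
  have h1 : G.quiver.target (G.mul (.mk (G.inv x) x (G.target_inv x))) = G.quiver.source y :=
    (G.target_mul _).trans h
  have h2 : G.quiver.target (G.inv x) = G.quiver.source (G.mul (.mk x y h)) :=
    (G.target_inv x).trans (G.source_mul (.mk x y h)).symm
  have e1 := G.mul_congr (y := y) (by rw [G.inv_mul, h]) rfl h1 (G.target_unit _)
  have e2 := G.mul_congr (x := G.inv x) rfl (by rw [hxy, G.target_inv]) h2 (G.source_unit _).symm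
  rw [← G.unit_mul y, ← e1, G.mul_assoc _ _ _ (G.target_inv x) h, e2, G.mul_unit]

theorem inv_inv (x : G₁) : G.inv (G.inv x) = x :=
  (G.eq_inv_of_mul_eq (G.target_inv x) (by rw [G.inv_mul, G.source_inv])).symm

theorem inv_unit (m : G₀) : G.inv (G.unit m) = G.unit m := by
  have h : G.quiver.target (G.unit m) = G.quiver.source (G.unit m) := by
    rw [G.target_unit, G.source_unit]
  refine (G.eq_inv_of_mul_eq h ?_).symm
  rw [G.mul_congr (x' := G.unit (G.quiver.source (G.unit m))) (by rw [G.source_unit]) rfl h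
    (G.target_unit _), G.unit_mul, G.source_unit]

theorem target_inv_mul (p : G.quiver.Comp₂) :
    G.quiver.target (G.inv (G.mul p)) = G.quiver.source p.fst :=
  (G.target_inv _).trans (G.source_mul p)

/-- Uniqueness of inverses is used twice: `x(y(xy)⁻¹)` is a unit, so `y(xy)⁻¹ = x⁻¹`; then
`y((xy)⁻¹x) = x⁻¹x` is a unit too. This is the twisted antipode axiom at the level of arrows. -/
theorem inv_mul_mul_fst (p : G.quiver.Comp₂) :
    G.mul (.mk (G.inv (G.mul p)) p.fst (G.target_inv_mul p)) = G.inv p.snd := by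
  have h1 : G.quiver.target p.snd = G.quiver.source (G.inv (G.mul p)) := by
    rw [G.source_inv, G.target_mul]
  have e1 : G.mul (.mk p.snd (G.inv (G.mul p)) h1) = G.inv p.fst := by
    refine G.eq_inv_of_mul_eq (p.comm.trans (G.source_mul (.mk _ _ h1)).symm) ?_
    rw [← G.mul_assoc _ _ _ p.comm h1, ← G.source_mul p]
    exact G.mul_inv (G.mul p)
  refine G.eq_inv_of_mul_eq (h1.trans (G.source_mul (.mk _ _ (G.target_inv_mul p))).symm) ?_
  rw [← G.mul_assoc _ _ _ h1 (G.target_inv_mul p), G.mul_congr e1 rfl _ (G.target_inv p.fst),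
    G.inv_mul, p.comm]

end Algebraic

-- Forms on composable pairs and triples as tensor products.

universe u v

variable {n : ℕ} {G₁ : Type u} {G₀ : Type v} [TopologicalSpace G₁] [ChartedSpace (Eu n) G₁]
  [IsManifold (𝓡 n) ∞ G₁] [TopologicalSpace G₀] [ChartedSpace (Eu n) G₀]
  [IsManifold (𝓡 n) ∞ G₀] (G : EtaleGroupoid n G₁ G₀)

/-- Moving `β(b)` to the right of `a` produces exactly the sign in the definition of balance. By
additivity it suffices to treat homogeneous forms. -/
theorem balanced_of_isBalanced {E : Type*} [AddCommGroup E] [Module ℂ E]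
    {f : Form n G₁ →ₗ[ℂ] Form n G₁ →ₗ[ℂ] E} (hf : G.formBialgebroid.IsBalanced f)
    (a : Form n G₁) (b : Form n G₀) (a' : Form n G₁) :
    f (a * Form.pullback _ G.quiver.contMDiff_target b) a' =
      f a (Form.pullback _ G.quiver.contMDiff_source b * a') := by
  induction b using Form.deg_induction with
  | add b b' h h' => simp only [map_add, mul_add, add_mul, LinearMap.add_apply, h, h']
  | hom i b hb =>
    induction a using Form.deg_induction with
    | add a b h h' => simp only [map_add, add_mul, LinearMap.add_apply, h, h']
    | hom j a ha =>
      rw [← Form.mul_comm_of_mem' (Form.pullback_mem _ hb) ha, map_smul, LinearMap.smul_apply]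
      refine (congrArg _ (hf i j b hb a ha a')).trans ?_
      rw [neg_one_pow_smul_smul]
      rfl

theorem isBalanced_of_balanced {E : Type*} [AddCommGroup E] [Module ℂ E]
    {f : Form n G₁ →ₗ[ℂ] Form n G₁ →ₗ[ℂ] E}
    (hf : ∀ a b a', f (a * Form.pullback _ G.quiver.contMDiff_target b) a' =
      f a (Form.pullback _ G.quiver.contMDiff_source b * a')) : G.formBialgebroid.IsBalanced f := by
  intro i j b hb a ha a'
  change f (Form.pullback _ G.quiver.contMDiff_target b * a) a' =
    _ • f a (Form.pullback _ G.quiver.contMDiff_source b * a')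
  rw [← hf, ← LinearMap.smul_apply, ← map_smul,
    Form.mul_comm_of_mem (Form.pullback_mem _ hb) ha]

theorem ten_one_mul (b : Form n G₀) (a a' : Form n G₁) :
    G.quiver.isEtaleFiberProduct₂.ten a a' *
      Form.pullback _ G.quiver.contMDiff_snd₂ (Form.pullback _ G.quiver.contMDiff_target b) =
    G.quiver.isEtaleFiberProduct₂.ten a (a' * Form.pullback _ G.quiver.contMDiff_target b) := by
  rw [IsEtaleFiberProduct.ten_apply, IsEtaleFiberProduct.ten_apply, map_mul]
  exact _root_.mul_assoc (Form.pullback _ G.quiver.contMDiff_fst₂ a)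
    (Form.pullback _ G.quiver.contMDiff_snd₂ a') _

theorem ten₃_apply (a b c : Form n G₁) : G.formBialgebroid.ten₃ a b c =
    G.quiver.isEtaleFiberProduct₃.ten (G.quiver.isEtaleFiberProduct₂.ten a b) c := rfl

theorem isBalanced₃ : G.formBialgebroid.IsBalanced₃ G.formBialgebroid.ten₃ := by
  have h2 := G.quiver.isEtaleFiberProduct₂.ten_balanced
  have h3 := G.quiver.isEtaleFiberProduct₃.ten_balanced
  constructor
  · intro i j b hb a ha a' a''
    have h := G.isBalanced_of_balanced h2 i j b hb a ha a'
    simp only [ten₃_apply]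
    rw [h, map_smul, LinearMap.smul_apply]
  · intro i j b hb a' ha' a a''
    refine G.isBalanced_of_balanced (f := G.formBialgebroid.ten₃ a) (fun a' b a'' => ?_)
      i j b hb a' ha' a''
    simp only [ten₃_apply]
    rw [← h3, ← ten_one_mul, Form.pullback_pullback]
    rfl

theorem continuous_ten₃ : Continuous fun p : Form n G₁ × Form n G₁ × Form n G₁ =>
    G.formBialgebroid.ten₃ p.1 p.2.1 p.2.2 := by
  have h : Continuous fun p : Form n G₁ × Form n G₁ × Form n G₁ =>
      G.quiver.isEtaleFiberProduct₂.ten p.1 p.2.1 :=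
    G.quiver.isEtaleFiberProduct₂.continuous_ten_comp continuous_fst
      (continuous_fst.comp continuous_snd)
  simp only [ten₃_apply]
  exact G.quiver.isEtaleFiberProduct₃.continuous_ten_comp h (continuous_snd.comp continuous_snd)

variable [T2Space G₁] [ParacompactSpace G₁] [T2Space G₀]

theorem isTensorSquare : G.formBialgebroid.IsTensorSquare where
  isCompleteLCS := Form.isCompleteLCS
  continuous := G.quiver.isEtaleFiberProduct₂.continuous_ten
  balanced := G.isBalanced_of_balanced G.quiver.isEtaleFiberProduct₂.ten_balanced
  existsUnique_lift _ _ _ _ hE f hf hb :=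
    G.quiver.isEtaleFiberProduct₂.existsUnique_lift hE f hf (G.balanced_of_isBalanced hb)

/-- Totality of decomposable forms is used in two stages, first over triples and then, with the
third factor fixed, over pairs. -/
theorem eq_of_ten₃ {E : Type*} [AddCommGroup E] [Module ℂ E] [TopologicalSpace E] [T2Space E]
    {F F' : Form n G.quiver.Comp₃ →L[ℂ] E} (h : ∀ a a' a'', F (G.formBialgebroid.ten₃ a a' a'') =
      F' (G.formBialgebroid.ten₃ a a' a'')) : F = F' := by
  refine ContinuousLinearMap.coe_injective (G.quiver.isEtaleFiberProduct₃.eq_of_ten F.continuous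
    F'.continuous fun w a'' => ?_)
  have hc : Continuous fun w => G.quiver.isEtaleFiberProduct₃.ten w a'' :=
    G.quiver.isEtaleFiberProduct₃.continuous_ten.comp (continuous_id.prodMk continuous_const)
  exact DFunLike.congr_fun (G.quiver.isEtaleFiberProduct₂.eq_of_ten
    (F := F.toLinearMap ∘ₗ G.quiver.isEtaleFiberProduct₃.ten.flip a'')
    (F' := F'.toLinearMap ∘ₗ G.quiver.isEtaleFiberProduct₃.ten.flip a'')
    (F.continuous.comp hc) (F'.continuous.comp hc) fun a a' => h a a' a'') w

/-- The first two variables are lifted with the third as parameter. A second lift, over triples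
viewed as pairs times arrows, needs balance for every form on pairs: on decomposable forms this is
the second balance condition of `f`, and the general case follows by continuity. -/
theorem exists_lift₃ {E : Type*} [AddCommGroup E] [Module ℂ E] [TopologicalSpace E]
    (hE : IsCompleteLCS E) (f : Form n G₁ →ₗ[ℂ] Form n G₁ →ₗ[ℂ] Form n G₁ →ₗ[ℂ] E)
    (hf : Continuous fun p : Form n G₁ × Form n G₁ × Form n G₁ => f p.1 p.2.1 p.2.2)
    (hb : G.formBialgebroid.IsBalanced₃ f) : ∃ F : Form n G.quiver.Comp₃ →L[ℂ] E,
      ∀ a a' a'', F (G.formBialgebroid.ten₃ a a' a'') = f a a' a'' := by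
  have := hE.t2Space
  obtain ⟨F₂, hF₂, hF₂t⟩ := G.quiver.isEtaleFiberProduct₂.exists_lift hE f hf fun a b a' =>
    LinearMap.ext fun a'' => G.balanced_of_isBalanced (f := f.compr₂ (LinearMap.applyₗ a''))
      (fun i j b hb' a ha a' => hb.1 i j b hb' a ha a' a'') a b a'
  have hF₂c : ∀ a, Continuous fun w => F₂ w a := fun a =>
    hF₂.comp (continuous_id.prodMk continuous_const)
  have hbal : ∀ w b a'', F₂ (w * Form.pullback _ G.quiver.isEtaleFiberProduct₃.contMDiff_π b) a'' =
      F₂ w (Form.pullback _ G.quiver.isEtaleFiberProduct₃.contMDiff_s b * a'') := by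
    intro w b a''
    have e : Form.pullback _ G.quiver.isEtaleFiberProduct₃.contMDiff_π b =
        Form.pullback _ G.quiver.contMDiff_snd₂
          (Form.pullback _ G.quiver.contMDiff_target b) :=
      (Form.pullback_pullback _ _ b).symm
    rw [e]
    refine DFunLike.congr_fun (G.quiver.isEtaleFiberProduct₂.eq_of_ten
      (F := (F₂.flip a'') ∘ₗ LinearMap.mulRight ℂ _)
      (F' := F₂.flip (Form.pullback _ G.quiver.contMDiff_source b * a''))
      ((hF₂c a'').comp (Form.mulRightL _).continuous) (hF₂c _) fun a a' => ?_) w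
    change F₂ (G.quiver.isEtaleFiberProduct₂.ten a a' * _) a'' =
      F₂ (G.quiver.isEtaleFiberProduct₂.ten a a') _
    rw [ten_one_mul, hF₂t, hF₂t]
    exact G.balanced_of_isBalanced (f := f a)
      (fun i j b hb' a' ha' a'' => hb.2 i j b hb' a' ha' a a'') a' b a''
  obtain ⟨F, hF, -⟩ := G.quiver.isEtaleFiberProduct₃.existsUnique_lift hE F₂ hF₂ hbal
  refine ⟨F, fun a a' a'' => ?_⟩
  rw [ten₃_apply, hF, hF₂t]

theorem isTensorCube : G.formBialgebroid.IsTensorCube where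
  isCompleteLCS := Form.isCompleteLCS
  continuous := G.continuous_ten₃
  balanced := G.isBalanced₃
  existsUnique_lift _ _ _ _ hE f hf hb := by
    have := hE.t2Space
    obtain ⟨F, hF⟩ := G.exists_lift₃ hE f hf hb
    exact ⟨F, hF, fun F' hF' => G.eq_of_ten₃ fun a a' a'' => (hF' a a' a'').trans (hF a a' a'').symm⟩

end EtaleGroupoid

/-! ### The coproduct -/

namespace EtaleGroupoid

universe u v

variable {n : ℕ} {G₁ : Type u} {G₀ : Type v} [TopologicalSpace G₁] [ChartedSpace (Eu n) G₁]
  [IsManifold (𝓡 n) ∞ G₁] [TopologicalSpace G₀] [ChartedSpace (Eu n) G₀]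
  [IsManifold (𝓡 n) ∞ G₀] (G : EtaleGroupoid n G₁ G₀)

theorem ten_apply (a a' : Form n G₁) : G.formBialgebroid.ten a a' =
    Form.pullback _ G.quiver.contMDiff_fst₂ a * Form.pullback _ G.quiver.contMDiff_snd₂ a' := rfl

theorem pullback_mul_source (b : Form n G₀) :
    Form.pullback _ G.contMDiff_mul (Form.pullback _ G.quiver.contMDiff_source b) =
      Form.pullback _ G.quiver.contMDiff_fst₂ (Form.pullback _ G.quiver.contMDiff_source b) := by
  rw [Form.pullback_pullback, Form.pullback_pullback]
  exact Form.pullback_congr _ _ G.source_mul b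

theorem pullback_mul_target (b : Form n G₀) :
    Form.pullback _ G.contMDiff_mul (Form.pullback _ G.quiver.contMDiff_target b) =
      Form.pullback _ G.quiver.contMDiff_snd₂ (Form.pullback _ G.quiver.contMDiff_target b) := by
  rw [Form.pullback_pullback, Form.pullback_pullback]
  exact Form.pullback_congr _ _ G.target_mul b

/-- Functoriality of pullback turns a product identity of arrows into an identity for the coproduct;
the counit, antipode and coassociativity axioms are proved this way. -/
theorem pullback_pair_mul {M : Type*} [TopologicalSpace M] [ChartedSpace (Eu n) M]
    [IsManifold (𝓡 n) ∞ M] {x y z : M → G₁} (hx : ContMDiff (𝓡 n) (𝓡 n) ∞ x)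
    (hy : ContMDiff (𝓡 n) (𝓡 n) ∞ y) (hz : ContMDiff (𝓡 n) (𝓡 n) ∞ z)
    (h : ∀ m, G.quiver.target (x m) = G.quiver.source (y m))
    (hxyz : ∀ m, G.mul (.mk (x m) (y m) (h m)) = z m) (a : Form n G₁) :
    Form.pullback _ (G.quiver.contMDiff_pair hx hy h) (G.formBialgebroid.Δ a) =
      Form.pullback z hz a :=
  (Form.pullback_pullback _ G.contMDiff_mul a).trans (Form.pullback_congr _ _ hxyz a)

theorem pullback_id (a : Form n G₁) : Form.pullback id contMDiff_id a = a :=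
  Form.pullback_of_eq_id _ (fun _ => rfl) a

theorem d_ten {i : ℕ} {a : Form n G₁} (ha : a ∈ Form.deg n G₁ i) (a' : Form n G₁) :
    Form.d n _ (G.formBialgebroid.ten a a') = G.formBialgebroid.ten (Form.d n _ a) a' +
      (-1 : ℂ) ^ i • G.formBialgebroid.ten a (Form.d n _ a') := by
  rw [ten_apply, Form.d_mul (Form.pullback_mem _ ha), ← Form.pullback_d, ← Form.pullback_d]
  rfl

theorem coproduct_left : ∃ F : Form n G₀ → Form n G.quiver.Comp₂ →L[ℂ] Form n G.quiver.Comp₂,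
    (∀ b a a', F b (G.formBialgebroid.ten a a') =
      G.formBialgebroid.ten (G.formBialgebroid.α b * a) a') ∧
    ∀ b a, G.formBialgebroid.Δ (G.formBialgebroid.α b * a) = F b (G.formBialgebroid.Δ a) := by
  refine ⟨fun b => Form.mulLeftL (Form.pullback _ G.quiver.contMDiff_fst₂
    (Form.pullback _ G.quiver.contMDiff_source b)), fun b a a' => ?_, fun b a => ?_⟩
  · rw [ten_apply, ten_apply, map_mul (Form.pullback _ G.quiver.contMDiff_fst₂),
      _root_.mul_assoc]
    rfl
  · refine (map_mul (Form.pullback _ G.contMDiff_mul) _ _).trans ?_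
    exact congrArg (· * Form.pullback _ G.contMDiff_mul a) (G.pullback_mul_source b)

theorem coproduct_right : ∃ F : Form n G₀ → Form n G.quiver.Comp₂ →L[ℂ] Form n G.quiver.Comp₂,
    (∀ i j, ∀ b ∈ Form.deg n G₀ i, ∀ a' ∈ Form.deg n G₁ j, ∀ a,
      F b (G.formBialgebroid.ten a a') =
        (-1 : ℂ) ^ (i * j) • G.formBialgebroid.ten a (G.formBialgebroid.β b * a')) ∧
    ∀ i j, ∀ b ∈ Form.deg n G₀ i, ∀ a ∈ Form.deg n G₁ j,
      (-1 : ℂ) ^ (i * j) • G.formBialgebroid.Δ (G.formBialgebroid.β b * a) =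
        F b (G.formBialgebroid.Δ a) := by
  have key : ∀ i j, ∀ b ∈ Form.deg n G₀ i, ∀ a ∈ Form.deg n G₁ j,
      (-1 : ℂ) ^ (i * j) • (G.formBialgebroid.β b * a) = a * G.formBialgebroid.β b :=
    fun i j b hb a ha => Form.mul_comm_of_mem' (Form.pullback_mem G.quiver.contMDiff_target hb) ha
  refine ⟨fun b => Form.mulRightL (Form.pullback _ G.quiver.contMDiff_snd₂
    (Form.pullback _ G.quiver.contMDiff_target b)), fun i j b hb a' ha' a => ?_,
    fun i j b hb a ha => ?_⟩
  · rw [← map_smul, key i j b hb a' ha']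
    exact G.ten_one_mul b a a'
  · rw [← map_smul, key i j b hb a ha]
    refine (map_mul (Form.pullback _ G.contMDiff_mul) _ _).trans ?_
    exact congrArg (Form.pullback _ G.contMDiff_mul a * ·) (G.pullback_mul_target b)

/-! ### Coassociativity -/

/-- The projection `(x, y, z) ↦ (y, z)`. -/
def pr₂₃ : G.quiver.Comp₃ → G.quiver.Comp₂ :=
  G.quiver.pair (fun p => p.fst.snd) FiberProd.snd FiberProd.comm

theorem contMDiff_pr₂₃ : ContMDiff (𝓡 n) (𝓡 n) ∞ G.pr₂₃ :=
  G.quiver.contMDiff_pair (G.quiver.contMDiff_snd₂.comp G.quiver.contMDiff_fst₃)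
    G.quiver.contMDiff_snd₃ _

theorem coproduct_coassoc :
    ∃ (J K : Form n G₁ → Form n G.quiver.Comp₂ →L[ℂ] Form n G.quiver.Comp₃)
      (F F' : Form n G.quiver.Comp₂ →L[ℂ] Form n G.quiver.Comp₃),
      (∀ a b c, J c (G.formBialgebroid.ten a b) = G.formBialgebroid.ten₃ a b c) ∧
      (∀ a b c, K a (G.formBialgebroid.ten b c) = G.formBialgebroid.ten₃ a b c) ∧
      (∀ a c, F (G.formBialgebroid.ten a c) = J c (G.formBialgebroid.Δ a)) ∧
      (∀ a c, F' (G.formBialgebroid.ten a c) = K a (G.formBialgebroid.Δ c)) ∧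
      ∀ a, F (G.formBialgebroid.Δ a) = F' (G.formBialgebroid.Δ a) := by
  have h₁ : ContMDiff (𝓡 n) (𝓡 n) ∞ fun p : G.quiver.Comp₃ => p.fst.fst :=
    G.quiver.contMDiff_fst₂.comp G.quiver.contMDiff_fst₃
  have h₁₂ : ContMDiff (𝓡 n) (𝓡 n) ∞ fun p : G.quiver.Comp₃ => G.mul p.fst :=
    G.contMDiff_mul.comp G.quiver.contMDiff_fst₃
  have h₂₃ : ContMDiff (𝓡 n) (𝓡 n) ∞ fun p : G.quiver.Comp₃ => G.mul (G.pr₂₃ p) :=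
    G.contMDiff_mul.comp G.contMDiff_pr₂₃
  have e : ∀ p : G.quiver.Comp₃, G.quiver.target (G.mul p.fst) = G.quiver.source p.snd :=
    fun p => (G.target_mul p.fst).trans p.comm
  have e' : ∀ p : G.quiver.Comp₃, G.quiver.target p.fst.fst = G.quiver.source (G.mul (G.pr₂₃ p)) :=
    fun p => p.fst.comm.trans (G.source_mul (G.pr₂₃ p)).symm
  -- The maps are `J c x = pr₁₂^*x ∧ pr₃^*c` and `K a x = pr₁^*a ∧ pr₂₃^*x`, while `F` and `F'` are
  -- pullbacks along `(xy, z)` and `(x, yz)`. Their agreement on coproducts is associativity.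
  refine ⟨fun c => (Form.mulRightL (Form.pullback _ G.quiver.contMDiff_snd₃ c)).comp
      (Form.pullbackL G.quiver.contMDiff_fst₃),
    fun a => (Form.mulLeftL (Form.pullback _ h₁ a)).comp (Form.pullbackL G.contMDiff_pr₂₃),
    Form.pullbackL (G.quiver.contMDiff_pair h₁₂ G.quiver.contMDiff_snd₃ e),
    Form.pullbackL (G.quiver.contMDiff_pair h₁ h₂₃ e'),
    fun a b c => rfl, fun a b c => ?_, fun a c => ?_, fun a c => ?_, fun a => ?_⟩
  · have h := G.quiver.pullback_pair_ten
      (G.quiver.contMDiff_snd₂.comp G.quiver.contMDiff_fst₃) G.quiver.contMDiff_snd₃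
      FiberProd.comm b c
    refine (congrArg (Form.pullback _ h₁ a * ·) h).trans ?_
    rw [ten₃_apply, IsEtaleFiberProduct.ten_apply, IsEtaleFiberProduct.ten_apply, map_mul,
      Form.pullback_pullback, Form.pullback_pullback, _root_.mul_assoc]
    rfl
  · refine (G.quiver.pullback_pair_ten h₁₂ G.quiver.contMDiff_snd₃ e a c).trans ?_
    exact congrArg (· * Form.pullback _ G.quiver.contMDiff_snd₃ c)
      (Form.pullback_pullback G.quiver.contMDiff_fst₃ G.contMDiff_mul a).symm
  · refine (G.quiver.pullback_pair_ten h₁ h₂₃ e' a c).trans ?_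
    exact congrArg (Form.pullback _ h₁ a * ·)
      (Form.pullback_pullback G.contMDiff_pr₂₃ G.contMDiff_mul c).symm
  · have h := G.contMDiff_mul.comp (G.quiver.contMDiff_pair h₁ h₂₃ e')
    exact (G.pullback_pair_mul h₁₂ G.quiver.contMDiff_snd₃ h e
      (fun p => G.mul_assoc _ _ _ p.fst.comm p.comm) a).trans
      (G.pullback_pair_mul h₁ h₂₃ h e' (fun _ => rfl) a).symm

/-! ### Multiplicativity -/

theorem exists_isRightMul : ∃ R, G.formBialgebroid.IsRightMul R := by
  refine ⟨G.formTen.compr₂ (LinearMap.mul ℂ _).flip, fun c c' =>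
    (Form.mulRightL (G.formTen c c')).continuous, fun i j a' ha' c hc a c' => ?_⟩
  exact G.quiver.isEtaleFiberProduct₂.ten_mul_ten ha' hc a c'

theorem balanced_one (b : Form n G₀) : G.formBialgebroid.ten (G.formBialgebroid.β b) 1 =
    G.formBialgebroid.ten 1 (G.formBialgebroid.α b) := by
  have h := G.quiver.isEtaleFiberProduct₂.ten_balanced 1 b 1
  rw [one_mul, mul_one] at h
  exact h

/-! ### The counit -/

theorem counit_source (b : Form n G₀) : Form.pullback _ G.contMDiff_unit
    (Form.pullback _ G.quiver.contMDiff_source b) = b := by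
  rw [Form.pullback_pullback]
  exact Form.pullback_of_eq_id _ G.source_unit b

theorem counit_target (b : Form n G₀) : Form.pullback _ G.contMDiff_unit
    (Form.pullback _ G.quiver.contMDiff_target b) = b := by
  rw [Form.pullback_pullback]
  exact Form.pullback_of_eq_id _ G.target_unit b

theorem counit_left : ∃ F : Form n G.quiver.Comp₂ →L[ℂ] Form n G₁,
    (∀ a a', F (G.formBialgebroid.ten a a') =
      G.formBialgebroid.α (G.formBialgebroid.ε a) * a') ∧
    ∀ a, F (G.formBialgebroid.Δ a) = a := by
  have h : ContMDiff (𝓡 n) (𝓡 n) ∞ fun x => G.unit (G.quiver.source x) :=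
    G.contMDiff_unit.comp G.quiver.contMDiff_source
  refine ⟨Form.pullbackL (G.quiver.contMDiff_pair h contMDiff_id fun x => G.target_unit _),
    fun a a' => ?_, fun a => ?_⟩
  · refine (G.quiver.pullback_pair_ten h contMDiff_id _ a a').trans ?_
    rw [pullback_id]
    exact congrArg (· * a')
      (Form.pullback_pullback G.quiver.contMDiff_source G.contMDiff_unit a).symm
  · exact (G.pullback_pair_mul h contMDiff_id contMDiff_id _ G.unit_mul a).trans (pullback_id a)

theorem counit_right : ∃ F : Form n G.quiver.Comp₂ →L[ℂ] Form n G₁,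
    (∀ i j, ∀ a ∈ Form.deg n G₁ i, ∀ a' ∈ Form.deg n G₁ j, F (G.formBialgebroid.ten a a') =
      (-1 : ℂ) ^ (i * j) • (G.formBialgebroid.β (G.formBialgebroid.ε a') * a)) ∧
    ∀ a, F (G.formBialgebroid.Δ a) = a := by
  have h : ContMDiff (𝓡 n) (𝓡 n) ∞ fun x => G.unit (G.quiver.target x) :=
    G.contMDiff_unit.comp G.quiver.contMDiff_target
  refine ⟨Form.pullbackL (G.quiver.contMDiff_pair contMDiff_id h fun x => (G.source_unit _).symm),
    fun i j a ha a' ha' => ?_, fun a => ?_⟩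
  · refine (G.quiver.pullback_pair_ten contMDiff_id h _ a a').trans ?_
    rw [pullback_id,
      Form.mul_comm_of_mem ha (Form.pullback_mem h ha')]
    exact congrArg (fun c => (-1 : ℂ) ^ (i * j) • (c * a))
      (Form.pullback_pullback G.quiver.contMDiff_target G.contMDiff_unit a').symm
  · exact (G.pullback_pair_mul contMDiff_id h contMDiff_id _ G.mul_unit a).trans (pullback_id a)

/-! ### The antipode -/

theorem antipode_antipode (a : Form n G₁) : G.formAntipode (G.formAntipode a) = a :=
  (Form.pullback_pullback G.contMDiff_inv G.contMDiff_inv a).trans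
    (Form.pullback_of_eq_id _ G.inv_inv a)

theorem antipode_β (b : Form n G₀) :
    G.formAntipode (G.formBialgebroid.β b) = G.formBialgebroid.α b :=
  (Form.pullback_pullback G.contMDiff_inv G.quiver.contMDiff_target b).trans
    (Form.pullback_congr _ G.quiver.contMDiff_source G.target_inv b)

theorem antipode_mul {i j : ℕ} {a a' : Form n G₁} (ha : a ∈ Form.deg n G₁ i)
    (ha' : a' ∈ Form.deg n G₁ j) :
    G.formAntipode (a * a') = (-1 : ℂ) ^ (i * j) • (G.formAntipode a' * G.formAntipode a) :=
  (map_mul (Form.pullback _ G.contMDiff_inv) a a').trans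
    (Form.mul_comm_of_mem (Form.pullback_mem _ ha) (Form.pullback_mem _ ha'))

/-- The map restricts forms to the pairs `(x⁻¹, x)`, whose product is the unit at the target of `x`.
On the other side inversion disappears because it fixes units. -/
theorem antipode_counit : ∃ F : Form n G.quiver.Comp₂ →L[ℂ] Form n G₁,
    (∀ a a', F (G.formBialgebroid.ten a a') = G.formAntipode a * a') ∧
    ∀ a, F (G.formBialgebroid.Δ a) =
      G.formBialgebroid.β (G.formBialgebroid.ε (G.formAntipode a)) := by
  refine ⟨Form.pullbackL (G.quiver.contMDiff_pair G.contMDiff_inv contMDiff_id G.target_inv),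
    fun a a' => ?_, fun a => ?_⟩
  · refine (G.quiver.pullback_pair_ten G.contMDiff_inv contMDiff_id _ a a').trans ?_
    rw [pullback_id]
    rfl
  · refine (G.pullback_pair_mul G.contMDiff_inv contMDiff_id
      (G.contMDiff_unit.comp G.quiver.contMDiff_target) _ G.inv_mul a).trans (Eq.symm ?_)
    refine (congrArg (Form.pullback _ G.quiver.contMDiff_target)
      (Form.pullback_pullback G.contMDiff_unit G.contMDiff_inv a)).trans ?_
    rw [Form.pullback_pullback]
    exact Form.pullback_congr _ _ (fun x => G.inv_unit _) a

variable [T2Space G₁] [ParacompactSpace G₁] [T2Space G₀]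

/-- The sign rule prescribes the action on decomposable forms, which are total. Axioms about an
arbitrary `R` therefore concern the wedge product with `c ⊗ c'` alone. -/
theorem isRightMul_apply {R : Form n G₁ →ₗ[ℂ] Form n G₁ →ₗ[ℂ]
      Form n G.quiver.Comp₂ →ₗ[ℂ] Form n G.quiver.Comp₂}
    (hR : G.formBialgebroid.IsRightMul R) (c c' : Form n G₁) (w : Form n G.quiver.Comp₂) :
    R c c' w = w * G.formBialgebroid.ten c c' := by
  refine DFunLike.congr_fun (G.quiver.isEtaleFiberProduct₂.eq_of_ten (F := R c c')
    (F' := LinearMap.mulRight ℂ (G.formBialgebroid.ten c c')) (hR.1 c c')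
    (Form.mulRightL _).continuous fun a a' => ?_) w
  change _ = G.quiver.isEtaleFiberProduct₂.ten a a' * G.quiver.isEtaleFiberProduct₂.ten c c'
  induction a' using Form.deg_induction with
  | add x y hx hy => simp only [map_add, add_mul, hx, hy]
  | hom i a' ha' =>
    induction c using Form.deg_induction with
    | add x y hx hy => simp only [map_add, LinearMap.add_apply, mul_add, hx, hy]
    | hom j c hc =>
      rw [IsEtaleFiberProduct.ten_mul_ten _ ha' hc]
      exact hR.2 i j a' ha' c hc a c'

/-- Under pullback along `(x, y) ↦ ((xy)⁻¹, x)` the first component turns `a` into `Δ(S a)` and the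
second turns `a'` into `a' ⊗ 1`. The product of the pair is `y⁻¹`, which accounts for `1 ⊗ S(a)`. -/
theorem antipode_twisted {R : Form n G₁ →ₗ[ℂ] Form n G₁ →ₗ[ℂ]
      Form n G.quiver.Comp₂ →ₗ[ℂ] Form n G.quiver.Comp₂}
    (hR : G.formBialgebroid.IsRightMul R) :
    ∃ F : Form n G.quiver.Comp₂ →L[ℂ] Form n G.quiver.Comp₂,
      (∀ a a', F (G.formBialgebroid.ten a a') =
        R a' 1 (G.formBialgebroid.Δ (G.formAntipode a))) ∧
      ∀ a, F (G.formBialgebroid.Δ a) = G.formBialgebroid.ten 1 (G.formAntipode a) := by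
  have h : ContMDiff (𝓡 n) (𝓡 n) ∞ fun p => G.inv (G.mul p) :=
    G.contMDiff_inv.comp G.contMDiff_mul
  refine ⟨Form.pullbackL (G.quiver.contMDiff_pair h G.quiver.contMDiff_fst₂ G.target_inv_mul),
    fun a a' => ?_, fun a => ?_⟩
  · refine (G.quiver.pullback_pair_ten h G.quiver.contMDiff_fst₂ _ a a').trans ?_
    rw [G.isRightMul_apply hR, ten_apply, map_one, mul_one]
    exact congrArg (· * Form.pullback _ G.quiver.contMDiff_fst₂ a')
      (Form.pullback_pullback G.contMDiff_mul G.contMDiff_inv a).symm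
  · rw [ten_apply, map_one, one_mul]
    exact (G.pullback_pair_mul h G.quiver.contMDiff_fst₂
      (G.contMDiff_inv.comp G.quiver.contMDiff_snd₂) _ G.inv_mul_mul_fst a).trans
      (Form.pullback_pullback G.quiver.contMDiff_snd₂ G.contMDiff_inv a).symm

/-! ### Verification of the axioms. -/

theorem isBialgebroid : G.formBialgebroid.IsBialgebroid where
  isTopDGAlgebra_A := Form.isTopDGAlgebra
  isTopDGAlgebra_B := Form.isTopDGAlgebra
  isTensorSquare := G.isTensorSquare
  isTensorCube := G.isTensorCube
  isTopDGMap_α := Form.isTopDGMap_pullback G.quiver.contMDiff_source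
  isTopDGMap_β := Form.isTopDGMap_pullback G.quiver.contMDiff_target
  α_one := map_one (Form.pullback _ G.quiver.contMDiff_source)
  α_mul := map_mul (Form.pullback _ G.quiver.contMDiff_source)
  β_one := map_one (Form.pullback _ G.quiver.contMDiff_target)
  β_mul i j b hb b' hb' := (map_mul (Form.pullback _ G.quiver.contMDiff_target) b b').trans
    (Form.mul_comm_of_mem (Form.pullback_mem _ hb) (Form.pullback_mem _ hb'))
  α_mul_β i j b hb b' hb' := Form.mul_comm_of_mem
    (Form.pullback_mem G.quiver.contMDiff_source hb)
    (Form.pullback_mem G.quiver.contMDiff_target hb')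
  continuous_Δ := Form.continuous_pullback G.contMDiff_mul
  Δ_mem k a ha := G.quiver.isEtaleFiberProduct₂.mem_closure_span_ten
    (Form.pullback_mem G.contMDiff_mul ha)
  Δ_d := ⟨⟨Form.d n _, Form.continuous_d⟩, fun i a ha a' => G.d_ten ha a',
    fun a => Form.pullback_d G.contMDiff_mul a⟩
  Δ_left := G.coproduct_left
  Δ_right := G.coproduct_right
  Δ_one := by
    rw [ten_apply, map_one (Form.pullback _ G.quiver.contMDiff_fst₂),
      map_one (Form.pullback _ G.quiver.contMDiff_snd₂), mul_one]
    exact map_one (Form.pullback _ G.contMDiff_mul)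
  coassoc := G.coproduct_coassoc
  exists_rightMul := G.exists_isRightMul
  Δ_balanced R hR a b := by
    rw [G.isRightMul_apply hR, G.isRightMul_apply hR, balanced_one, sub_self]
  Δ_mul R hR := ⟨fun a => Form.mulLeftL (G.formBialgebroid.Δ a),
    fun a c c' => (G.isRightMul_apply hR c c' _).symm,
    fun a a' => map_mul (Form.pullback _ G.contMDiff_mul) a a'⟩
  isTopDGMap_ε := Form.isTopDGMap_pullback G.contMDiff_unit
  ε_left b a := (map_mul (Form.pullback _ G.contMDiff_unit) _ a).trans
    (congrArg (· * Form.pullback _ G.contMDiff_unit a) (G.counit_source b))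
  ε_right i j b hb a ha := by
    have h : G.formBialgebroid.ε (G.formBialgebroid.β b * a) = b * G.formBialgebroid.ε a :=
      (map_mul (Form.pullback _ G.contMDiff_unit) _ a).trans
        (congrArg (· * Form.pullback _ G.contMDiff_unit a) (G.counit_target b))
    rw [h]
    exact Form.mul_comm_of_mem' hb (Form.pullback_mem G.contMDiff_unit ha)
  ε_one := map_one (Form.pullback _ G.contMDiff_unit)
  ε_ker a a' h := by
    refine (map_mul (Form.pullback _ G.contMDiff_unit) a a').trans ?_
    exact (congrArg (Form.pullback _ G.contMDiff_unit a * ·) h).trans (mul_zero _)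
  counit_left := G.counit_left
  counit_right := G.counit_right

theorem isParaHopfAlgebroid : G.formBialgebroid.IsParaHopfAlgebroid G.formAntipode where
  isBialgebroid := G.isBialgebroid
  isTopDGMap_S := Form.isTopDGMap_pullback G.contMDiff_inv
  bijective_S := Function.Involutive.bijective G.antipode_antipode
  S_one := map_one (Form.pullback _ G.contMDiff_inv)
  S_mul _ _ _ ha _ ha' := G.antipode_mul ha ha'
  S_S := G.antipode_antipode
  S_β := G.antipode_β
  S_counit := G.antipode_counit
  S_twisted _ hR := G.antipode_twisted hR

end EtaleGroupoid

end EtaleHopf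

end

theorem proposition2p1 {n : ℕ} {G₁ : Type*} {G₀ : Type*}
    [TopologicalSpace G₁] [ChartedSpace (EuclideanSpace ℝ (Fin n)) G₁] [IsManifold (𝓡 n) ∞ G₁]
    [T2Space G₁] [ParacompactSpace G₁]
    [TopologicalSpace G₀] [ChartedSpace (EuclideanSpace ℝ (Fin n)) G₀] [IsManifold (𝓡 n) ∞ G₀]
    [T2Space G₀] [ParacompactSpace G₀]
    (G : EtaleHopf.EtaleGroupoid n G₁ G₀) :
    G.formBialgebroid.IsParaHopfAlgebroid G.formAntipode :=
  G.isParaHopfAlgebroid
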